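/- Let $\omega=e^{2\pi i/8}$ and consider the hyperelliptic curves $$C_2=\{y^2=x_0x_1(x_0^4+x_1^4)\}\subset\mathbb P(1,1,3),\qquad C_3=\{y^2=x_0^8+x_1^8\}\subset\mathbb P(1,1,4)$$ over $\mathbb C$, of genus $2$ and $3$, with the $\mathbb Z_8$-actions generated by $g(x_0:x_1:y)=(x_0:\omega^2x_1:\omega y)$ on $C_2$ and $g(x_0:x_1:y)=(x_0:\omega x_1:y)$ on $C_3$. Let $Y=C_2\times C_2\times C_3$, with coordinates $(x_{0i}:x_{1i}:y_i)$ on the $i$-th factor, let $G=\mathbb Z_8$ act diagonally on $Y$, let $\pi\colon Y\to X=Y/G$ be the quotient, and let $\rho\colon\widehat X\to X$ be any resolution of singularities (a proper birational morphism from a smooth variety). Put $u_i=x_{1i}/x_{0i}$, $v_1=y_1/x_{01}^3$, $v_2=y_2/x_{02}^3$, $v_3=y_3/x_{03}^4$ and $\theta=\frac{du_1}{2v_1}\wedge\frac{du_2}{2v_2}\wedge\frac{du_3}{2v_3}$; a monomial $\prod_{i}x_{0i}^{a_i}x_{1i}^{b_i}$ with $a_1+b_1=a_2+b_2=2$, $a_3+b_3=4$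 is identified with the bicanonical form $u_1^{b_1}u_2^{b_2}u_3^{b_3}\,\theta^{\otimes2}$ on $Y$. Let $\widetilde Y$ be the normalization of $Y\times_X\widehat X$, with its morphisms $\phi\colon\widetilde Y\to Y$ (proper, birational) and $\epsilon\colon\widetilde Y\to\widehat X$ (finite, surjective), and let $\mathcal I_2=\mathcal O_Y(-2R)\otimes\phi_*\mathcal O_{\widetilde Y}(2\epsilon^*E)=\phi_*\mathcal O_{\widetilde Y}(2\epsilon^*K_{\widehat X}-2\phi^*K_Y)$, where $R=K_Y-\pi^*K_X$ and $E=K_{\widehat X}-\rho^*K_X$. Then: 1. $Y$ is integral, and the three monomials $$x_{11}^2x_{12}^2x_{03}^2x_{13}^2,\qquad x_{01}x_{11}x_{12}^2x_{13}^4,\qquad x_{11}^2x_{02}x_{12}x_{13}^4$$ are linearly independent, $G$-invariant elements of $H^0(Y,\mathcal O_Y(2K_Y)\otimes\mathcal I_2)$. 2. $P_2(\widehat X)=h^0(\widehat X,\mathcal O_{\widehat X}(2K_{\widehat X}))\ge 3$. 3. No minimal model $Z$ of $\widehat X$ (a projective variety birational to $\widehat X$, with at most terminal singularities and $K_Z$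 nef) is Calabi-Yau; more generally, no Calabi-Yau variety is birational to $\widehat X$. Here a projective variety $Z$ with at most terminal singularities is called Calabi-Yau if it is Gorenstein, $K_Z\sim 0$ and $h^i(Z,\mathcal O_Z)=0$ for $1\le i\le\dim Z-1$. 4. The Kodaira dimension of $\widehat X$ is at least $2$. -/

import Mathlib

open CategoryTheory AlgebraicGeometry MonoidalCategory

noncomputable section

namespace FakeCY

section QuotientGrading

variable {A : Type} [CommRing A] [Algebra ℂ A] (𝒜 : ℕ → Submodule ℂ A) [GradedAlgebra 𝒜]
  (I : Ideal A)

/-- The grading of `A ⧸ I` by the images of the graded pieces of `A`. -/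
def quotGrading (n : ℕ) : Submodule ℂ (A ⧸ I) :=
  (𝒜 n).map (Ideal.Quotient.mkₐ ℂ I).toLinearMap

instance quotGrading_gradedMonoid : SetLike.GradedMonoid (quotGrading 𝒜 I) where
  one_mem := ⟨1, SetLike.GradedOne.one_mem, map_one (Ideal.Quotient.mkₐ ℂ I)⟩
  mul_mem := by
    rintro i j _ _ ⟨a, ha, rfl⟩ ⟨b, hb, rfl⟩
    exact ⟨a * b, SetLike.GradedMul.mul_mem ha hb, map_mul (Ideal.Quotient.mkₐ ℂ I) a b⟩

/-- The quotient map on a graded piece. -/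
def toQuotPiece (n : ℕ) : 𝒜 n →ₗ[ℂ] quotGrading 𝒜 I n :=
  (Ideal.Quotient.mkₐ ℂ I).toLinearMap.restrict fun a ha ↦ ⟨a, ha, rfl⟩

/-- The map of direct sums induced by the quotient map. -/
def quotSumHom : (DirectSum ℕ fun n ↦ 𝒜 n) →ₐ[ℂ] DirectSum ℕ fun n ↦ quotGrading 𝒜 I n :=
  DirectSum.toAlgebra ℂ (fun n ↦ 𝒜 n)
    (fun n ↦ (DirectSum.lof ℂ ℕ (fun n ↦ quotGrading 𝒜 I n) n).comp (toQuotPiece 𝒜 I n))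
    rfl
    (fun {i j} a b ↦ by
      simp only [LinearMap.comp_apply, DirectSum.lof_eq_of, DirectSum.of_mul_of]
      rfl)

/-- `a ↦ (classes of the homogeneous components of a)`. -/
def preDecompose : A →ₐ[ℂ] DirectSum ℕ fun n ↦ quotGrading 𝒜 I n :=
  (quotSumHom 𝒜 I).comp (DirectSum.decomposeAlgEquiv 𝒜).toAlgHom

lemma preDecompose_of_mem {n : ℕ} {a : A} (ha : a ∈ 𝒜 n) :
    preDecompose 𝒜 I a =
      DirectSum.of (fun n ↦ quotGrading 𝒜 I n) n (toQuotPiece 𝒜 I n ⟨a, ha⟩) := by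
  have h : DirectSum.decompose 𝒜 a = DirectSum.of (fun n ↦ 𝒜 n) n ⟨a, ha⟩ :=
    DirectSum.decompose_of_mem 𝒜 ha
  change quotSumHom 𝒜 I (DirectSum.decompose 𝒜 a) = _
  rw [h]
  exact DirectSum.toAddMonoid_of _ _ _

lemma preDecompose_of_mem_ideal (hI : I.IsHomogeneous 𝒜) {a : A} (ha : a ∈ I) :
    preDecompose 𝒜 I a = 0 := by
  classical
  rw [← DirectSum.sum_support_decompose 𝒜 a, map_sum]
  refine Finset.sum_eq_zero fun n _ ↦ ?_
  rw [preDecompose_of_mem 𝒜 I (SetLike.coe_mem _)]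
  have : toQuotPiece 𝒜 I n ⟨_, SetLike.coe_mem (DirectSum.decompose 𝒜 a n)⟩ = 0 :=
    Subtype.ext (Ideal.Quotient.eq_zero_iff_mem.mpr (hI n ha))
  rw [this, map_zero]

/-- The quotient of a graded algebra by a homogeneous ideal is graded. -/
@[reducible]
def quotGradedAlgebra (hI : I.IsHomogeneous 𝒜) : GradedAlgebra (quotGrading 𝒜 I) :=
  GradedAlgebra.ofAlgHom _
    (Ideal.Quotient.liftₐ I (preDecompose 𝒜 I) fun _ ↦ preDecompose_of_mem_ideal 𝒜 I hI)
    (by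
      classical
      apply AlgHom.ext
      intro x
      obtain ⟨a, rfl⟩ := Ideal.Quotient.mk_surjective x
      change DirectSum.coeAlgHom (quotGrading 𝒜 I) (preDecompose 𝒜 I a) = Ideal.Quotient.mk I a
      conv_lhs => rw [← DirectSum.sum_support_decompose 𝒜 a]
      conv_rhs => rw [← DirectSum.sum_support_decompose 𝒜 a]
      rw [map_sum, map_sum, map_sum]
      refine Finset.sum_congr rfl fun n _ ↦ ?_
      rw [preDecompose_of_mem 𝒜 I (SetLike.coe_mem _), DirectSum.coeAlgHom_of]
      rfl)
    (by
      rintro n ⟨_, a, ha, rfl⟩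
      exact preDecompose_of_mem 𝒜 I ha)

end QuotientGrading

/-! ### The curves -/

/-- The weights of the coordinates `x₀, x₁, y` of `ℙ(1, 1, k)`. -/
def wt (k : ℕ) : Fin 3 → ℕ := ![1, 1, k]

/-- The grading of `ℂ[x₀, x₁, y]` with `deg x₀ = deg x₁ = 1`, `deg y = k`. -/
abbrev polyGrading (k : ℕ) : ℕ → Submodule ℂ (MvPolynomial (Fin 3) ℂ) :=
  MvPolynomial.weightedHomogeneousSubmodule ℂ (wt k)

instance polyGradedAlgebra (k : ℕ) : GradedAlgebra (polyGrading k) :=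
  MvPolynomial.weightedGradedAlgebra ℂ (wt k)

/-- `F` is homogeneous for the weights `(1, 1, k)`. -/
class IsWeighted (k : ℕ) (F : MvPolynomial (Fin 3) ℂ) : Prop where
  exists_degree : ∃ m, F ∈ polyGrading k m

/-- The homogeneous coordinate ring `ℂ[x₀, x₁, y] / (F)`. -/
abbrev CoordRing (F : MvPolynomial (Fin 3) ℂ) : Type :=
  MvPolynomial (Fin 3) ℂ ⧸ Ideal.span {F}

/-- The grading of the homogeneous coordinate ring. -/
abbrev coordGrading (k : ℕ) (F : MvPolynomial (Fin 3) ℂ) : ℕ → Submodule ℂ (CoordRing F) :=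
  quotGrading (polyGrading k) (Ideal.span {F})

instance coordGradedAlgebra (k : ℕ) (F : MvPolynomial (Fin 3) ℂ) [h : IsWeighted k F] :
    GradedAlgebra (coordGrading k F) :=
  quotGradedAlgebra _ _ (Ideal.homogeneous_span _ _ (by
    rintro _ rfl
    exact h.exists_degree))

/-- Spectrum of the complex numbers. -/
abbrev SpecC : Scheme.{0} := Spec (CommRingCat.of ℂ)

/-- The structure morphism of `Proj`. -/
def projToSpecC {A : Type} [CommRing A] [Algebra ℂ A] (𝒜 : ℕ → Submodule ℂ A) [GradedAlgebra 𝒜] :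
    Proj 𝒜 ⟶ SpecC :=
  Proj.toSpecZero 𝒜 ≫ Spec.map (CommRingCat.ofHom (algebraMap ℂ (𝒜 0)))

/-- The subscheme `{F = 0}` of `ℙ(1, 1, k)`, as a scheme over `ℂ`. -/
def weightedCurve (k : ℕ) (F : MvPolynomial (Fin 3) ℂ) [IsWeighted k F] : Over SpecC :=
  Over.mk (projToSpecC (coordGrading k F))

section Scaling

variable (k : ℕ) (F : MvPolynomial (Fin 3) ℂ) (c : Fin 3 → ℂ)

/-- The substitution `x₀ ↦ c₀ x₀`, `x₁ ↦ c₁ x₁`, `y ↦ c₂ y`. -/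
def scalePoly : MvPolynomial (Fin 3) ℂ →ₐ[ℂ] MvPolynomial (Fin 3) ℂ :=
  MvPolynomial.aeval fun i ↦ MvPolynomial.C (c i) * MvPolynomial.X i

/-- `F` is multiplied by a constant under the substitution. -/
def IsSemiInvariant : Prop := ∃ χ : ℂ, scalePoly c F = χ • F

lemma scalePoly_mem {n : ℕ} {p : MvPolynomial (Fin 3) ℂ} (hp : p ∈ polyGrading k n) :
    scalePoly c p ∈ polyGrading k n := by
  rw [p.as_sum, map_sum]
  refine Submodule.sum_mem _ fun m hm ↦ ?_
  have hm' : Finsupp.weight (wt k) m = n := hp (MvPolynomial.mem_support_iff.mp hm)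
  have : scalePoly c (MvPolynomial.monomial m (p.coeff m)) =
      MvPolynomial.monomial m (p.coeff m * m.prod fun i e ↦ c i ^ e) := by
    rw [scalePoly, MvPolynomial.aeval_monomial, MvPolynomial.monomial_eq, map_mul]
    simp only [mul_pow, Finsupp.prod_mul, MvPolynomial.algebraMap_eq, mul_assoc]
    simp [Finsupp.prod, map_prod]
  rw [this]
  exact MvPolynomial.isWeightedHomogeneous_monomial _ _ _ hm'

lemma scalePoly_scalePoly (c' : Fin 3 → ℂ) (h : ∀ i, c i * c' i = 1)
    (p : MvPolynomial (Fin 3) ℂ) : scalePoly c (scalePoly c' p) = p := by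
  have : (scalePoly c).comp (scalePoly c') = AlgHom.id ℂ _ := by
    ext i : 1
    simp only [scalePoly, AlgHom.comp_apply, MvPolynomial.aeval_X, map_mul, AlgHom.id_apply,
      MvPolynomial.algHom_C, MvPolynomial.algebraMap_eq]
    rw [← mul_assoc, ← MvPolynomial.C_mul, mul_comm, mul_comm (c' i), h i]
    simp
  exact DFunLike.congr_fun this p

variable {F c}

/-- The induced graded endomorphism of the homogeneous coordinate ring. -/
def scaleHom (h : IsSemiInvariant F c) : coordGrading k F →+*ᵍ coordGrading k F where
  toRingHom := Ideal.quotientMap _ (scalePoly c).toRingHom (by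
    rw [Ideal.span_le, Set.singleton_subset_iff]
    obtain ⟨χ, hχ⟩ := h
    change scalePoly c F ∈ Ideal.span {F}
    rw [hχ]
    exact Submodule.smul_of_tower_mem _ χ (Ideal.mem_span_singleton_self F))
  map_mem := by
    rintro n _ ⟨a, ha, rfl⟩
    exact ⟨scalePoly c a, scalePoly_mem k c ha, rfl⟩

variable {c' : Fin 3 → ℂ}

lemma scaleHom_comp (h : IsSemiInvariant F c) (h' : IsSemiInvariant F c')
    (hc : ∀ i, c i * c' i = 1) :
    (scaleHom k h).comp (scaleHom k h') = GradedRingHom.id (coordGrading k F) := by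
  ext x
  obtain ⟨a, rfl⟩ := Ideal.Quotient.mk_surjective x
  exact congrArg (Ideal.Quotient.mk _) (scalePoly_scalePoly c c' hc a)

variable [IsWeighted k F]

lemma irrelevant_le_map_scaleHom (h : IsSemiInvariant F c) (h' : IsSemiInvariant F c')
    (hc : ∀ i, c i * c' i = 1) :
    HomogeneousIdeal.irrelevant (coordGrading k F) ≤
      (HomogeneousIdeal.irrelevant (coordGrading k F)).map (scaleHom k h) := by
  refine le_trans (le_of_eq ?_)
    (HomogeneousIdeal.map_mono (scaleHom k h) (?_ :
      (HomogeneousIdeal.irrelevant (coordGrading k F)).map (scaleHom k h') ≤ _))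
  · rw [HomogeneousIdeal.map_map, scaleHom_comp k h h' hc, HomogeneousIdeal.map_id]
  · rw [HomogeneousIdeal.map_le_iff_le_comap]
    refine (HomogeneousIdeal.toIdeal_irrelevant_le _).mpr fun i hi x hx ↦ ?_
    exact HomogeneousIdeal.mem_irrelevant_of_mem _ hi ((scaleHom k h').map_mem hx)

lemma away_comp_projMap (h : IsSemiInvariant F c)
    (hi : HomogeneousIdeal.irrelevant (coordGrading k F) ≤
      (HomogeneousIdeal.irrelevant (coordGrading k F)).map (scaleHom k h))
    {n : ℕ} (hn : 0 < n) (s : CoordRing F) (hs : s ∈ coordGrading k F n) :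
    Proj.awayι (coordGrading k F) (scaleHom k h s) ((scaleHom k h).map_mem hs) hn ≫
        Proj.map (scaleHom k h) hi ≫ projToSpecC (coordGrading k F) =
      Proj.awayι (coordGrading k F) (scaleHom k h s) ((scaleHom k h).map_mem hs) hn ≫
        projToSpecC (coordGrading k F) := by
  have h1 := Proj.awayι_comp_map_assoc (scaleHom k h) hi hn s hs (projToSpecC (coordGrading k F))
  refine h1.trans ?_
  rw [projToSpecC, Proj.awayι_toSpecZero_assoc, Proj.awayι_toSpecZero_assoc, ← Spec.map_comp,
    ← Spec.map_comp, ← Spec.map_comp, ← CommRingCat.ofHom_comp, ← CommRingCat.ofHom_comp,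
    ← CommRingCat.ofHom_comp]
  congr 2
  ext z : 1
  apply HomogeneousLocalization.val_injective
  have e : scaleHom k h (algebraMap ℂ (CoordRing F) z) = algebraMap ℂ (CoordRing F) z :=
    congrArg (Ideal.Quotient.mk _) ((scalePoly c).commutes z)
  have e1 : scaleHom k h 1 = 1 := map_one (scaleHom k h).toRingHom
  change Localization.mk (scaleHom k h (algebraMap ℂ (CoordRing F) z)) ⟨scaleHom k h 1, _⟩ =
    Localization.mk (algebraMap ℂ (CoordRing F) z) ⟨1, _⟩
  simp only [e, e1]

lemma projMap_comp_projToSpecC (h : IsSemiInvariant F c)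
    (hi : HomogeneousIdeal.irrelevant (coordGrading k F) ≤
      (HomogeneousIdeal.irrelevant (coordGrading k F)).map (scaleHom k h)) :
    Proj.map (scaleHom k h) hi ≫ projToSpecC (coordGrading k F) =
      projToSpecC (coordGrading k F) :=
  (Proj.mapAffineOpenCover _ hi).openCover.hom_ext _ _ fun s ↦
    away_comp_projMap k h hi s.1.2 s.2.1 s.2.2

lemma projMap_comp_projMap (h : IsSemiInvariant F c) (h' : IsSemiInvariant F c')
    (hc : ∀ i, c i * c' i = 1)
    (hi : HomogeneousIdeal.irrelevant (coordGrading k F) ≤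
      (HomogeneousIdeal.irrelevant (coordGrading k F)).map (scaleHom k h))
    (hi' : HomogeneousIdeal.irrelevant (coordGrading k F) ≤
      (HomogeneousIdeal.irrelevant (coordGrading k F)).map (scaleHom k h')) :
    Proj.map (scaleHom k h) hi ≫ Proj.map (scaleHom k h') hi' = 𝟙 _ := by
  rw [← Proj.map_comp]
  simp only [scaleHom_comp k h h' hc]
  exact Proj.map_id

/-- The automorphism `(x₀ : x₁ : y) ↦ (c₀ x₀ : c₁ x₁ : c₂ y)` of the curve `{F = 0}`
(`c'` consists of the inverses of the `cᵢ`). -/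
def scaleAut (h : IsSemiInvariant F c) (h' : IsSemiInvariant F c')
    (hc : ∀ i, c i * c' i = 1) : Aut (weightedCurve k F) :=
  have hc' : ∀ i, c' i * c i = 1 := fun i ↦ (mul_comm _ _).trans (hc i)
  Over.isoMk (f := weightedCurve k F) (g := weightedCurve k F)
    { hom := Proj.map (scaleHom k h) (irrelevant_le_map_scaleHom k h h' hc)
      inv := Proj.map (scaleHom k h') (irrelevant_le_map_scaleHom k h' h hc')
      hom_inv_id := projMap_comp_projMap k h h' hc _ _
      inv_hom_id := projMap_comp_projMap k h' h hc' _ _ }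
    (projMap_comp_projToSpecC k h _)

end Scaling

/-! ### Rational pluricanonical forms -/

section Forms

open scoped TensorProduct

variable (K : Type) [CommRing K] [Algebra ℂ K] (n d : ℕ)

/-- `(Λⁿ Ω_{K/ℂ})^{⊗ d}`. -/
abbrev RatForm : Type := ⨂[K]^d (⋀[K]^n Ω[K⁄ℂ])

variable {K n d}

/-- `⨂ⱼ (d aⱼ₁ ∧ ⋯ ∧ d aⱼₙ)`. -/
def elemForm (a : Fin d → Fin n → K) : RatForm K n d :=
  PiTensorProduct.tprod K fun j ↦
    exteriorPower.ιMulti K n fun i ↦ KaehlerDifferential.D ℂ K (a j i)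

variable (n d) in
/-- For subrings `A ⊆ B` of `K`: the `B`-submodule generated by the image of
`(Λⁿ Ω_{A/ℂ})^{⊗ d}`. -/
def formsOver (A B : Subring K) : Submodule ℂ (RatForm K n d) :=
  Submodule.span ℂ {s | ∃ b ∈ B, ∃ a : Fin d → Fin n → K, (∀ j i, a j i ∈ A) ∧ s = b • elemForm a}

variable {L : Type} [CommRing L] [Algebra ℂ L]

section

variable [Algebra K L] [IsScalarTower ℂ K L]

variable (K L n) in
/-- The `K`-linear map `Λⁿ Ω_{K/ℂ} → Λⁿ Ω_{L/ℂ}` induced by `K → L`. -/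
def extMap : (⋀[K]^n Ω[K⁄ℂ]) →ₗ[K] (⋀[L]^n Ω[L⁄ℂ]) :=
  exteriorPower.alternatingMapLinearEquiv
    { ((exteriorPower.ιMulti L n (M := Ω[L⁄ℂ])).toMultilinearMap.restrictScalars K).compLinearMap
          (fun _ ↦ KaehlerDifferential.map ℂ ℂ K L) with
      map_eq_zero_of_eq' := fun _ _ _ h hij ↦
        (exteriorPower.ιMulti L n (M := Ω[L⁄ℂ])).map_eq_zero_of_eq _
          (congrArg (KaehlerDifferential.map ℂ ℂ K L) h) hij }

variable (K L n d) in
/-- The `K`-linear map `(Λⁿ Ω_{K/ℂ})^{⊗ d} → (Λⁿ Ω_{L/ℂ})^{⊗ d}` induced by `K → L`. -/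
def tensorMap : RatForm K n d →ₗ[K] RatForm L n d :=
  PiTensorProduct.lift
    (((PiTensorProduct.tprod L (s := fun _ : Fin d ↦ ⋀[L]^n Ω[L⁄ℂ])).restrictScalars
      K).compLinearMap fun _ ↦ extMap K n L)

end

variable (n d) in
/-- Pull-back of forms along a homomorphism `K → L`, i.e. the additive map with
`b • ⨂ⱼ (d aⱼ₁ ∧ ⋯ ∧ d aⱼₙ) ↦ f b • ⨂ⱼ (d (f aⱼ₁) ∧ ⋯ ∧ d (f aⱼₙ))`. -/
def formMap (f : K →ₐ[ℂ] L) : RatForm K n d →+ RatForm L n d :=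
  letI : Algebra K L := f.toRingHom.toAlgebra
  haveI : IsScalarTower ℂ K L := IsScalarTower.of_algebraMap_eq' f.comp_algebraMap.symm
  (tensorMap K n d L).toAddMonoidHom

end Forms

/-! ### Functions on schemes over `ℂ` -/

section Functions

variable (X : Over SpecC)

/-- The constants in the local ring at `x`. -/
def constants (x : X.left) : ℂ →+* X.left.presheaf.stalk x :=
  (X.left.presheaf.germ ⊤ x trivial).hom.comp
    (X.hom.appTop.hom.comp (Scheme.ΓSpecIso (CommRingCat.of ℂ)).inv.hom)

instance [IrreducibleSpace X.left] : Algebra ℂ X.left.functionField :=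
  (constants X (genericPoint X.left)).toAlgebra

/-- The local ring `𝒪_{X,x}` as a subring of the function field. -/
def localRing [IrreducibleSpace X.left] (x : X.left) : Subring X.left.functionField :=
  (algebraMap (X.left.presheaf.stalk x) X.left.functionField).range

variable {X} {W : Over SpecC}

/-- The image of `𝒪_{X,f(w)}` in the function field of `W`. -/
def pulledRing [IrreducibleSpace W.left] (f : W ⟶ X) (w : W.left) :
    Subring W.left.functionField :=
  ((algebraMap (W.left.presheaf.stalk w) W.left.functionField).comp (f.left.stalkMap w).hom).range

lemma map_genericPoint [IrreducibleSpace W.left] [IrreducibleSpace X.left] (f : W ⟶ X)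
    [IsDominant f.left] : f.left (genericPoint W.left) = genericPoint X.left := by
  apply (genericPoint_spec X.left).eq _ |>.symm
  have := (genericPoint_spec W.left).image f.left.continuous
  rwa [Set.image_univ, f.left.denseRange.closure_range] at this

lemma constants_stalkMap (f : W ⟶ X) (w : W.left) (z : ℂ) :
    f.left.stalkMap w (constants X (f.left w) z) = constants W w z := by
  have h : f.left ≫ X.hom = W.hom := Over.w f
  simp only [constants, ← h, Scheme.Hom.comp_appTop, CommRingCat.hom_comp, RingHom.comp_apply]
  exact Scheme.Hom.germ_stalkMap_apply f.left ⊤ w trivial _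

lemma constants_stalkSpecializes {x y : X.left} (h : x ⤳ y) (z : ℂ) :
    X.left.presheaf.stalkSpecializes h (constants X y z) = constants X x z := by
  simp only [constants, RingHom.comp_apply]
  exact TopCat.Presheaf.germ_stalkSpecializes_apply _ _ _ _

/-- Pull-back of rational functions along a dominant morphism. -/
def funMap [IrreducibleSpace W.left] [IrreducibleSpace X.left] (f : W ⟶ X) [IsDominant f.left] :
    X.left.functionField →ₐ[ℂ] W.left.functionField where
  __ := (X.left.presheaf.stalkSpecializes
      (specializes_of_eq (map_genericPoint f)) ≫ f.left.stalkMap (genericPoint W.left)).hom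
  commutes' z := by
    change f.left.stalkMap _ (X.left.presheaf.stalkSpecializes _ (constants X _ z)) =
      constants W _ z
    rw [constants_stalkSpecializes, constants_stalkMap]

instance isDominant_aut (γ : Aut X) : IsDominant γ.hom.left := by
  have : IsIso γ.hom.left := ((Over.forget SpecC).mapIso γ).isIso_hom
  infer_instance

end Functions

/-! ### Pluricanonical sections, plurigenera, Kodaira dimension -/

section Pluricanonical

variable (X : Over SpecC) [IsIntegral X.left]

/-- The dimension of a variety: the transcendence degree of its function field. -/
def dim : ℕ := Cardinal.toNat (Algebra.trdeg ℂ X.left.functionField)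

/-- Rational sections of the `d`-th power of the canonical sheaf. -/
abbrev RatPluri (d : ℕ) : Type := RatForm X.left.functionField (dim X) d

/-- `H⁰(X, 𝒪_X(d K_X))` for a normal variety `X`: the rational `d`-canonical forms that are regular
at every point of codimension one. -/
def pluriSections (d : ℕ) : Submodule ℂ (RatPluri X d) :=
  ⨅ (x : X.left) (_ : Order.coheight x = 1),
    formsOver (dim X) d (localRing X x) (localRing X x)

/-- The plurigenus `P_d(X) = h⁰(X, 𝒪_X(d K_X))`. -/
def plurigenus (d : ℕ) : Cardinal := Module.rank ℂ (pluriSections X d)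

/-- The quotients `s / t` of `d`-canonical sections of `X`. They generate the function field of the
image of the `d`-canonical map. -/
def sectionRatios (d : ℕ) : Set X.left.functionField :=
  {r | ∃ s ∈ pluriSections X d, ∃ t ∈ pluriSections X d, t ≠ 0 ∧ s = r • t}

/-- The Kodaira dimension: the maximal dimension of the image of a pluricanonical map, and `⊥`
(that is, `-∞`) if all plurigenera vanish. -/
def kodairaDim : WithBot ℕ∞ :=
  ⨆ (d : ℕ) (_ : 0 < d ∧ pluriSections X d ≠ ⊥),
    ((Cardinal.toENat (Algebra.trdeg ℂ (Algebra.adjoin ℂ (sectionRatios X d))) : ℕ∞) : WithBot ℕ∞)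

end Pluricanonical

/-! ### Birational morphisms, resolutions, quotients -/

section Morphisms

/-- A birational morphism. -/
def IsBirationalMor {W X : Over SpecC} (f : W ⟶ X) : Prop :=
  ∃ U : X.left.Opens, Dense (U : Set X.left) ∧ Dense (f.left ⁻¹ᵁ U : Set W.left) ∧
    IsIso (f.left ∣_ U)

/-- `X` is normal. -/
def IsNormalScheme (X : Scheme.{0}) : Prop := ∀ x : X, IsIntegrallyClosed (X.presheaf.stalk x)

/-- `ρ : X' ⟶ X` is a resolution of singularities: `X'` is smooth over `ℂ` and `ρ` is proper and
birational. -/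
structure IsResolution {X' X : Over SpecC} (ρ : X' ⟶ X) : Prop where
  smooth : Smooth X'.hom
  proper : IsProper ρ.left
  birational : IsBirationalMor ρ

/-- `π : Y ⟶ X` is the quotient of `Y` by the finite group `G` of automorphisms: `π` is finite and
surjective, its fibres are the `G`-orbits, and `𝒪_X` is the sheaf of `G`-invariant functions. -/
structure IsQuotientBy {Y X : Over SpecC} (G : Subgroup (Aut Y)) (π : Y ⟶ X) : Prop where
  invariant : ∀ γ ∈ G, γ.hom ≫ π = π
  finite : IsFinite π.left
  surjective : Surjective π.left
  orbit : ∀ y y' : Y.left, π.left y = π.left y' → ∃ γ ∈ G, γ.hom.left y = y'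
  injective : ∀ U : X.left.Opens, Function.Injective (π.left.app U)
  invariants : ∀ (U : X.left.Opens) (f : Γ(Y.left, π.left ⁻¹ᵁ U)),
    (∀ γ ∈ G, ∀ e : π.left ⁻¹ᵁ U ≤ γ.hom.left ⁻¹ᵁ π.left ⁻¹ᵁ U,
      γ.hom.left.appLE (π.left ⁻¹ᵁ U) (π.left ⁻¹ᵁ U) e f = f) →
    ∃ h : Γ(X.left, U), π.left.app U h = f

end Morphisms

/-! ### Calabi-Yau varieties and minimal models -/

section Singularities

variable (X : Over SpecC) [IsIntegral X.left]

/-- `σ` generates the stalk of `𝒪_X(r K_X)` at `x` (for `X` normal): it generates the `r`-canonical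
forms at every point of codimension one specializing to `x`. -/
def IsLocalGenerator (r : ℕ) (x : X.left) (σ : RatPluri X r) : Prop :=
  σ ≠ 0 ∧ ∀ x' : X.left, x' ⤳ x → Order.coheight x' = 1 → ∀ τ : RatPluri X r,
    τ ∈ formsOver (dim X) r (localRing X x') (localRing X x') ↔
      ∃ b ∈ localRing X x', τ = b • σ

/-- `r K_X` is a Cartier divisor. -/
def IsCartierMultiple (r : ℕ) : Prop :=
  ∀ x : X.left, ∃ σ : RatPluri X r, IsLocalGenerator X r x σ

/-- `X` has at most terminal singularities: it is normal, some positive multiple of `K_X` is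
Cartier, and every exceptional prime divisor `E` of every proper birational morphism `f : W ⟶ X`
from a normal variety has positive discrepancy, that is, the pull-back of a local generator of
`𝒪_X(r K_X)` vanishes along `E` as an `r`-canonical form of `W`. -/
structure HasTerminalSingularities : Prop where
  normal : IsNormalScheme X.left
  qGorenstein : ∃ r, 0 < r ∧ IsCartierMultiple X r
  discrepancy_pos : ∀ (W : Over SpecC) [IsIntegral W.left] (f : W ⟶ X) [IsDominant f.left],
    IsNormalScheme W.left → IsProper f.left → IsBirationalMor f →
    ∀ w : W.left, Order.coheight w = 1 → Order.coheight (f.left w) ≠ 1 →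
    ∀ (r : ℕ) (σ : RatPluri X r), 0 < r → IsLocalGenerator X r (f.left w) σ →
    ∃ b ∈ IsLocalRing.maximalIdeal (W.left.presheaf.stalk w),
      ∃ τ ∈ formsOver (dim X) r (localRing W w) (localRing W w),
        formMap (dim X) r (funMap f) σ = algebraMap _ W.left.functionField b • τ

/-- `K_X` is nef (for `X` normal and `K_X` ℚ-Cartier): whenever `r K_X` is Cartier, with local
generators `σ x`, its degree is nonnegative on every smooth projective curve `ν : C ⟶ X`. The degree
is computed with the rational section `σ (ν η)` of `ν^* 𝒪_X(r K_X)`, where `η` is the generic point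
of `C`. -/
def IsCanonicalNef : Prop :=
  ∀ (r : ℕ) (σ : X.left → RatPluri X r), 0 < r → (∀ x, IsLocalGenerator X r x (σ x)) →
  ∀ (C : Over SpecC) [IsIntegral C.left] [IsLocallyNoetherian C.left],
    Smooth C.hom → IsProper C.hom → dim C = 1 →
  ∀ (ν : C ⟶ X) (h : C.left → X.left.presheaf.stalk (ν.left (genericPoint C.left))),
    (∀ c, σ (ν.left (genericPoint C.left)) =
      algebraMap _ X.left.functionField (h c) • σ (ν.left c)) →
    0 ≤ ∑ᶠ c : C.left, C.left.ord (ν.left.stalkMap (genericPoint C.left) (h c)) c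

/-- Projective space over `ℂ`. -/
def projSpace (N : ℕ) : Over SpecC :=
  letI : GradedAlgebra (MvPolynomial.homogeneousSubmodule (Fin (N + 1)) ℂ) :=
    MvPolynomial.gradedAlgebra
  Over.mk (projToSpecC (MvPolynomial.homogeneousSubmodule (Fin (N + 1)) ℂ))

/-- `X` is projective over `ℂ`. -/
def IsProjective (X : Over SpecC) : Prop :=
  ∃ (N : ℕ) (i : X ⟶ projSpace N), IsClosedImmersion i.left

/-- The structure sheaf as a sheaf of abelian groups. -/
def structureAb (X : Scheme.{0}) : TopCat.Sheaf AddCommGrpCat.{0} X :=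
  (sheafCompose _ (forget₂ CommRingCat RingCat ⋙ forget₂ RingCat AddCommGrpCat)).obj X.sheaf

/-- Calabi-Yau varieties: projective varieties with at most terminal singularities that are
Gorenstein, with trivial canonical divisor and with `hⁱ(𝒪) = 0` for `1 ≤ i ≤ dim - 1`. -/
structure IsCalabiYau : Prop where
  projective : IsProjective X
  terminal : HasTerminalSingularities X
  gorenstein : IsCartierMultiple X 1
  canonical_trivial : ∃ σ : RatPluri X 1, ∀ x, IsLocalGenerator X 1 x σ
  irregularity : ∀ i, 1 ≤ i → i + 1 ≤ dim X → Subsingleton ((structureAb X.left).H i)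

/-- `Z` is a minimal model of `X`: a projective variety birational to `X` with at most terminal
singularities and nef canonical divisor. -/
structure IsMinimalModel (Z X : Over SpecC) [IsIntegral Z.left] : Prop where
  projective : IsProjective Z
  birational : Scheme.BirationalOver Z.hom X.hom
  terminal : HasTerminalSingularities Z
  nef : IsCanonicalNef Z

end Singularities

/-! ### The sheaves of ideals `𝓘_d` -/

section Ideals

variable {Y X' Yt : Over SpecC} [IsIntegral Y.left] [IsIntegral Yt.left]
  (φ : Yt ⟶ Y) [IsDominant φ.left] (ε : Yt ⟶ X') (n d : ℕ)

/-- `Yt`, with its morphisms to `Y` and `X'`, is the normalization of `Y ×_X X'`: it is normal, `φ` is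
proper and birational, `ε` is finite and surjective, and the square commutes. -/
structure IsNormalizedBaseChange {X Y X' Yt : Over SpecC} (π : Y ⟶ X) (ρ : X' ⟶ X) (φ : Yt ⟶ Y)
    (ε : Yt ⟶ X') : Prop where
  normal : IsNormalScheme Yt.left
  proper : IsProper φ.left
  birational : IsBirationalMor φ
  finite : IsFinite ε.left
  surjective : Surjective ε.left
  comm : ε ≫ ρ = φ ≫ π

/-- The sections over `U` of the sheaf of ideals `𝓘_d = 𝒪_Y(-d R) ⊗ φ_* 𝒪(ε^* d E)`, where
`R = K_Y - π^* K_X` and `E = K_{X'} - ρ^* K_X`. As `ε^* E - φ^* R = ε^* K_{X'} - φ^* K_Y`, this is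
`φ_* 𝒪(ε^* d K_{X'} - φ^* d K_Y)`: the rational functions `f` such that, at each
point `w` of codimension one of `Yt` over `U`, multiplication by `f` maps `φ^* ω_Y^{⊗ d}` into
`ε^* ω_{X'}^{⊗ d}`. -/
def idealSections (U : Y.left.Opens) : Set Y.left.functionField :=
  {f | ∀ w : Yt.left, Order.coheight w = 1 → φ.left w ∈ U →
    ∀ τ ∈ formsOver n d (pulledRing φ w) (localRing Yt w),
      funMap φ f • τ ∈ formsOver n d (pulledRing ε w) (localRing Yt w)}

/-- `H⁰(Y, 𝒪_Y(d K_Y) ⊗ 𝓘_d)`, for `Y` smooth of dimension `n`. -/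
def twistedSections : Set (RatForm Y.left.functionField n d) :=
  {s | ∀ y : Y.left, ∃ U : Y.left.Opens, y ∈ U ∧
    s ∈ Submodule.span ℂ {t | ∃ f ∈ idealSections φ ε n d U,
      ∃ τ ∈ formsOver n d (localRing Y y) (localRing Y y), t = f • τ}}

end Ideals

/-! ### The threefold -/

/-- The primitive eighth root of unity `exp (2πi / 8)`. -/
def ω : ℂ := Complex.exp (2 * Real.pi * Complex.I / 8)

lemma ω_pow_eight : ω ^ 8 = 1 := by
  rw [ω, ← Complex.exp_nat_mul, Complex.exp_eq_one_iff]
  exact ⟨1, by push_cast; ring⟩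

open MvPolynomial in
/-- `y² - x₀ x₁ (x₀⁴ + x₁⁴)`. -/
def F₂ : MvPolynomial (Fin 3) ℂ := X 2 ^ 2 - X 0 * X 1 * (X 0 ^ 4 + X 1 ^ 4)

open MvPolynomial in
/-- `y² - (x₀⁸ + x₁⁸)`. -/
def F₃ : MvPolynomial (Fin 3) ℂ := X 2 ^ 2 - (X 0 ^ 8 + X 1 ^ 8)

lemma X_mem (k : ℕ) (i : Fin 3) : MvPolynomial.X i ∈ polyGrading k (wt k i) :=
  MvPolynomial.isWeightedHomogeneous_X ℂ (wt k) i

instance : IsWeighted 3 F₂ where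
  exists_degree := ⟨6, Submodule.sub_mem _ (SetLike.pow_mem_graded 2 (X_mem 3 2))
    (SetLike.mul_mem_graded (SetLike.mul_mem_graded (X_mem 3 0) (X_mem 3 1))
      (Submodule.add_mem _ (SetLike.pow_mem_graded 4 (X_mem 3 0))
        (SetLike.pow_mem_graded 4 (X_mem 3 1))))⟩

instance : IsWeighted 4 F₃ where
  exists_degree := ⟨8, Submodule.sub_mem _ (SetLike.pow_mem_graded 2 (X_mem 4 2))
      (Submodule.add_mem _ (SetLike.pow_mem_graded 8 (X_mem 4 0))
        (SetLike.pow_mem_graded 8 (X_mem 4 1)))⟩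

/-- The genus two curve `{y² = x₀ x₁ (x₀⁴ + x₁⁴)} ⊂ ℙ(1, 1, 3)`. -/
def C₂ : Over SpecC := weightedCurve 3 F₂

/-- The genus three curve `{y² = x₀⁸ + x₁⁸} ⊂ ℙ(1, 1, 4)`. -/
def C₃ : Over SpecC := weightedCurve 4 F₃

lemma semiInvariant₂ (ζ : ℂ) (h : ζ ^ 8 = 1) : IsSemiInvariant F₂ ![1, ζ ^ 2, ζ] := by
  refine ⟨ζ ^ 2, ?_⟩
  have h8 : (MvPolynomial.C ζ : MvPolynomial (Fin 3) ℂ) ^ 8 = 1 := by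
    rw [← map_pow, h, map_one]
  simp only [scalePoly, F₂, map_sub, map_mul, map_pow, map_add, MvPolynomial.aeval_X,
    Matrix.cons_val, map_one, MvPolynomial.smul_eq_C_mul]
  linear_combination (-(MvPolynomial.C ζ) ^ 2 * MvPolynomial.X 0 * MvPolynomial.X 1 ^ 5) * h8

lemma semiInvariant₃ (ζ : ℂ) (h : ζ ^ 8 = 1) : IsSemiInvariant F₃ ![1, ζ, 1] := by
  refine ⟨1, ?_⟩
  have h8 : (MvPolynomial.C ζ : MvPolynomial (Fin 3) ℂ) ^ 8 = 1 := by
    rw [← map_pow, h, map_one]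
  simp only [scalePoly, F₃, map_sub, map_pow, map_add, MvPolynomial.aeval_X,
    Matrix.cons_val, map_one, MvPolynomial.smul_eq_C_mul]
  linear_combination (-MvPolynomial.X 1 ^ 8) * h8

/-- The automorphism `(x₀ : x₁ : y) ↦ (x₀ : ω² x₁ : ω y)` of `C₂`. -/
def g₂ : Aut C₂ :=
  scaleAut 3 (semiInvariant₂ ω ω_pow_eight) (semiInvariant₂ (ω ^ 7) (by
    rw [← pow_mul, mul_comm, pow_mul, ω_pow_eight, one_pow])) (by
      have := ω_pow_eight
      intro i
      fin_cases i
      · simp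
      · simp
        linear_combination (ω ^ 8 + 1) * this
      · simp
        linear_combination this)

/-- The automorphism `(x₀ : x₁ : y) ↦ (x₀ : ω x₁ : y)` of `C₃`. -/
def g₃ : Aut C₃ :=
  scaleAut 4 (semiInvariant₃ ω ω_pow_eight) (semiInvariant₃ (ω ^ 7) (by
    rw [← pow_mul, mul_comm, pow_mul, ω_pow_eight, one_pow])) (by
      have := ω_pow_eight
      intro i
      fin_cases i
      · simp
      · simp
        linear_combination this
      · simp)

/-- The product `C₂ × C₂ × C₃` over `ℂ`. -/
def Y : Over SpecC := C₂ ⊗ (C₂ ⊗ C₃)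

/-- The diagonal automorphism `(g, g, g)`. -/
def g : Aut Y := g₂ ⊗ᵢ (g₂ ⊗ᵢ g₃)

/-- The cyclic group of order eight generated by `g`. -/
def G : Subgroup (Aut Y) := Subgroup.zpowers g

/-! ### The three bicanonical sections -/

section Sections

variable (k : ℕ) (F : MvPolynomial (Fin 3) ℂ)

/-- The coordinates `x₀, x₁, y` in the homogeneous coordinate ring. -/
def coord (i : Fin 3) : CoordRing F := Ideal.Quotient.mk _ (MvPolynomial.X i)

lemma coord_mem (i : Fin 3) : coord F i ∈ coordGrading k F (wt k i) := ⟨_, X_mem k i, rfl⟩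

variable [IsWeighted k F]

/-- The chart `{x₀ ≠ 0}`. -/
def chart : (weightedCurve k F).left.Opens := Proj.basicOpen (coordGrading k F) (coord F 0)

/-- The function `u = x₁ / x₀` on the chart `{x₀ ≠ 0}`. -/
def uFun : Γ((weightedCurve k F).left, chart k F) :=
  Proj.awayToSection (coordGrading k F) (coord F 0)
    (HomogeneousLocalization.Away.mk _ (coord_mem k F 0) 1 (coord F 1) (coord_mem k F 1))

/-- The function `v = y / x₀ᵏ` on the chart `{x₀ ≠ 0}`. -/
def vFun : Γ((weightedCurve k F).left, chart k F) :=
  Proj.awayToSection (coordGrading k F) (coord F 0)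
    (HomogeneousLocalization.Away.mk _ (coord_mem k F 0) k (coord F 2)
      (by simpa [wt] using coord_mem k F 2))

open Classical in
/-- The pull-back along `f : T ⟶ C` of a function on an open subset `U` of `C`, as a rational
function on `T` (with value `0` if `f` maps the generic point outside `U`). -/
def pullFun {T C : Over SpecC} [IrreducibleSpace T.left] (f : T ⟶ C) {U : C.left.Opens}
    (s : Γ(C.left, U)) : T.left.functionField :=
  if h : genericPoint T.left ∈ f.left ⁻¹ᵁ U then
    T.left.presheaf.germ (f.left ⁻¹ᵁ U) (genericPoint T.left) h (f.left.app U s)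
  else 0

/-- The first projection of `C₂ × C₂ × C₃`. -/
def pr₁ : Y ⟶ C₂ := CartesianMonoidalCategory.fst C₂ (C₂ ⊗ C₃)

/-- The second projection of `C₂ × C₂ × C₃`. -/
def pr₂ : Y ⟶ C₂ :=
  CartesianMonoidalCategory.snd C₂ (C₂ ⊗ C₃) ≫ CartesianMonoidalCategory.fst C₂ C₃

/-- The third projection of `C₂ × C₂ × C₃`. -/
def pr₃ : Y ⟶ C₃ :=
  CartesianMonoidalCategory.snd C₂ (C₂ ⊗ C₃) ≫ CartesianMonoidalCategory.snd C₂ C₃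

variable [IsIntegral Y.left]

/-- The functions `uᵢ = x₁ᵢ / x₀ᵢ`. -/
def u : Fin 3 → Y.left.functionField :=
  ![pullFun pr₁ (uFun 3 F₂), pullFun pr₂ (uFun 3 F₂), pullFun pr₃ (uFun 4 F₃)]

/-- The functions `v₁ = y₁ / x₀₁³`, `v₂ = y₂ / x₀₂³`, `v₃ = y₃ / x₀₃⁴`. -/
def v : Fin 3 → Y.left.functionField :=
  ![pullFun pr₁ (vFun 3 F₂), pullFun pr₂ (vFun 3 F₂), pullFun pr₃ (vFun 4 F₃)]

/-- The canonical form `(du₁ / 2v₁) ∧ (du₂ / 2v₂) ∧ (du₃ / 2v₃)`. By adjunction, it corresponds to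
`x₀₁ x₀₂ x₀₃²`. -/
def θ : ⋀[Y.left.functionField]^3 Ω[Y.left.functionField⁄ℂ] :=
  exteriorPower.ιMulti Y.left.functionField 3 fun i ↦
    (2 * v i)⁻¹ • KaehlerDifferential.D ℂ Y.left.functionField (u i)

/-- The bicanonical form `u₁^b₁ u₂^b₂ u₃^b₃ θ^{⊗ 2}`. By adjunction, it corresponds to the monomial
`x₀₁^(2 - b₁) x₁₁^b₁ x₀₂^(2 - b₂) x₁₂^b₂ x₀₃^(4 - b₃) x₁₃^b₃`. -/
def bicanonicalForm (b : Fin 3 → ℕ) : RatForm Y.left.functionField 3 2 :=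
  (∏ i, u i ^ b i) • PiTensorProduct.tprod Y.left.functionField fun _ ↦ θ

/-- The bicanonical forms given by `x₁₁² x₁₂² x₀₃² x₁₃²`, `x₀₁ x₁₁ x₁₂² x₁₃⁴` and
`x₁₁² x₀₂ x₁₂ x₁₃⁴`. -/
def threeForms : Fin 3 → RatForm Y.left.functionField 3 2 :=
  ![bicanonicalForm ![2, 2, 2], bicanonicalForm ![1, 2, 4], bicanonicalForm ![2, 1, 4]]

end Sections

end FakeCY

end

/-! The argument takes place in function fields and uses no description of the singularities of X or
of their resolution. The functions r₁ = u₁/u₃², r₂ = u₂/u₃², P = u₃⁸, A = v₁/u₃, B = v₂/u₃, c = v₃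
are G-invariant, so they descend to X and, since ρ is birational, to the function field of X'
(`exists_quotCoords`). They satisfy A² = r₁(1 + r₁⁴P), B² = r₂(1 + r₂⁴P), c² = 1 + P; a field with
such elements carries a `QuotCoords`. Since du₁/u₁ = dlog r₁ + ¼ dlog P, du₂/u₂ = dlog r₂ + ¼ dlog P
and du₃/u₃ = ⅛ dlog P, every form u₁^i u₂^j u₃^k θ² with 2i + 2j + k = 10 is an expression
`QuotCoords.form i j` in the invariant coordinates (`bicanonicalForm_eq`). The three given forms
have (i, j) = (2, 2), (1, 2), (2, 1), so they are invariant and come from X'.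

The heart is `QuotCoords.form_mem`: these three forms are regular at every discrete valuation,
trivial on ℂ, of every field with such coordinates. If 8 divides ord P, then P is a unit times e⁸,
and re², Ae, e behave like u, v, u₃ up to units; regularity reduces to that of u^b (du/v)² on each
curve, for b ≤ 2 on C₂ and b ≤ 4 on C₃ (`exists_factor₂`, `exists_factor₃`). If 8 does not divide
ord P, each factor is written as a function times a logarithmic differential. A wedge of logarithmic
differentials has at most a simple pole (`smul_ιMulti_dlog_mem`), so it suffices that the
coefficient of its tensor square has order at least 2. This is an inequality between the integers
ord r₁, ord r₂, ord P and the orders of A, B, c, which the three chosen pairs (i, j) satisfy.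

The conclusions follow from this. The scheme X' is smooth, hence normal, so its points of
codimension one give discrete valuations and the forms are bicanonical sections. The forms are in
the ratio r₁r₂ : r₂ : r₁ with r₁, r₂, P a transcendence basis, so they are independent and P₂ ≥ 3;
the ratios r₁ and r₂ give Kodaira dimension at least 2. On the normalized base change, the pull-back
of a form from Y agrees with the pull-back of its descent from X', and ε, being finite and dominant
onto a normal scheme, preserves codimension one; this gives membership in the twisted sheaf.
Finally, the coordinates transport to every variety Z birational to X'. If K_Z were trivial with
generator σ, each form would be a regular function, hence a constant, times σ², and r₁ would be
constant.

The integrality of Y comes from its eight affine charts, whose coordinate rings are tensor products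
of domains over ℂ, and which share a complex point. -/

noncomputable section

namespace FakeCY

/-! ### Lattices of differential forms -/

section Lattice

variable {K : Type} [Field K] [Algebra ℂ K]
  {M N : Type} [AddCommGroup M] [Module K M] [Module ℂ M] [IsScalarTower ℂ K M]
  [AddCommGroup N] [Module K N] [Module ℂ N] [IsScalarTower ℂ K N]

/-- The `B`-submodule of `M` generated by `S`, as a complex vector space. -/
def latt (B : Subring K) (S : Set M) : Submodule ℂ M :=
  Submodule.span ℂ {x | ∃ b ∈ B, ∃ s ∈ S, x = b • s}

lemma smul_mem_latt {B : Subring K} {S : Set M} {b : K} (hb : b ∈ B) {x : M}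
    (hx : x ∈ latt B S) : b • x ∈ latt B S := by
  induction hx using Submodule.span_induction with
  | mem x hx =>
    obtain ⟨b', hb', s, hs, rfl⟩ := hx
    exact Submodule.subset_span ⟨b * b', B.mul_mem hb hb', s, hs, by rw [mul_smul]⟩
  | zero => simp
  | add x y _ _ hx hy => rw [smul_add]; exact add_mem hx hy
  | smul c x _ hx => rw [smul_comm]; exact Submodule.smul_mem _ c hx

omit [Algebra ℂ K] [IsScalarTower ℂ K M] in
lemma subset_latt {B : Subring K} {S : Set M} {s : M} (hs : s ∈ S) : s ∈ latt B S :=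
  Submodule.subset_span ⟨1, B.one_mem, s, hs, by rw [one_smul]⟩

/-- Complex scalars act through B, which contains the constants, so closure under addition and under
B is enough. -/
lemma latt_induction {B : Subring K} {S : Set M} {Q : AddSubmonoid M} (hS : S ⊆ Q)
    (hc : ∀ c : ℂ, algebraMap ℂ K c ∈ B)
    (hB : ∀ b ∈ B, ∀ x ∈ Q, b • x ∈ Q) {x : M} (hx : x ∈ latt B S) : x ∈ Q := by
  induction hx using Submodule.span_induction with
  | mem x hx => obtain ⟨b, hb, s, hs, rfl⟩ := hx; exact hB b hb s (hS hs)
  | zero => exact Q.zero_mem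
  | add x y _ _ hx hy => exact Q.add_mem hx hy
  | smul c x _ hx => rw [← algebraMap_smul K c x]; exact hB _ (hc c) x hx

/-- By multilinearity the arguments can be moved from the generators to the lattice one at a time;
the induction is on the set of slots already moved. -/
lemma map_mem_latt {ι : Type} [Finite ι] (f : MultilinearMap K (fun _ : ι ↦ M) N)
    {B : Subring K} (hc : ∀ c : ℂ, algebraMap ℂ K c ∈ B) {S : Set M} {T : Set N}
    (hST : ∀ m : ι → M, (∀ i, m i ∈ S) → f m ∈ T) {m : ι → M} (hm : ∀ i, m i ∈ latt B S) :
    f m ∈ latt B T := by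
  classical
  cases nonempty_fintype ι
  suffices H : ∀ s : Finset ι, ∀ m : ι → M, (∀ i ∈ s, m i ∈ latt B S) → (∀ i ∉ s, m i ∈ S) →
      f m ∈ latt B T from H Finset.univ m (fun i _ ↦ hm i) (by simp)
  intro s
  induction s using Finset.induction with
  | empty => exact fun m _ h ↦ subset_latt (hST m fun i ↦ h i (by simp))
  | insert i s his ih =>
    intro m h1 h2
    let Q : AddSubmonoid M := (latt B T).toAddSubmonoid.comap (f.toLinearMap m i).toAddMonoidHom
    have key : m i ∈ Q := by
      refine latt_induction (S := S) (fun x hx ↦ ?_) hc (fun b hb x hx ↦ ?_)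
        (h1 i (Finset.mem_insert_self i s))
      · change f (Function.update m i x) ∈ latt B T
        refine ih _ (fun j hj ↦ ?_) (fun j hj ↦ ?_)
        · have : j ≠ i := fun e ↦ his (e ▸ hj)
          rw [Function.update_of_ne this]
          exact h1 j (Finset.mem_insert_of_mem hj)
        · by_cases e : j = i
          · subst e; rwa [Function.update_self]
          · rw [Function.update_of_ne e]
            exact h2 j (by simp [e, hj])
      · change f.toLinearMap m i (b • x) ∈ latt B T
        rw [map_smul]
        exact smul_mem_latt hb hx
    have := key
    change f (Function.update m i (m i)) ∈ latt B T at this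
    rwa [Function.update_eq_self] at this

end Lattice

/-! ### Regular pluricanonical forms and their pull-back -/

section RatForms

variable {K : Type} [Field K] [Algebra ℂ K] {n d : ℕ}

lemma formsOver_eq_latt (A B : Subring K) :
    formsOver n d A B = latt B {s | ∃ a : Fin d → Fin n → K, (∀ j i, a j i ∈ A) ∧
      s = elemForm a} := by
  unfold formsOver latt
  congr 1
  ext s
  constructor
  · rintro ⟨b, hb, a, ha, rfl⟩; exact ⟨b, hb, _, ⟨a, ha, rfl⟩, rfl⟩
  · rintro ⟨b, hb, _, ⟨a, ha, rfl⟩, rfl⟩; exact ⟨b, hb, a, ha, rfl⟩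

lemma smul_mem_formsOver {A B : Subring K} {b : K} (hb : b ∈ B) {x : RatForm K n d}
    (hx : x ∈ formsOver n d A B) : b • x ∈ formsOver n d A B := by
  rw [formsOver_eq_latt] at *
  exact smul_mem_latt hb hx

/-- The `B`-module generated by the `n`-forms `d a₁ ∧ ⋯ ∧ d aₙ` with `aᵢ ∈ A`. -/
def regForms (n : ℕ) (A B : Subring K) : Submodule ℂ (⋀[K]^n Ω[K⁄ℂ]) :=
  latt B {s | ∃ a : Fin n → K, (∀ i, a i ∈ A) ∧
    s = exteriorPower.ιMulti K n fun i ↦ KaehlerDifferential.D ℂ K (a i)}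

/-- The `B`-module generated by the differentials `d a` with `a ∈ A`. -/
def regDiff (A B : Subring K) : Submodule ℂ Ω[K⁄ℂ] :=
  latt B (KaehlerDifferential.D ℂ K '' A)

lemma D_mem_regDiff {A B : Subring K} {a : K} (ha : a ∈ A) :
    KaehlerDifferential.D ℂ K a ∈ regDiff A B := subset_latt ⟨a, ha, rfl⟩

lemma ιMulti_mem_regForms {A B : Subring K} (hc : ∀ c : ℂ, algebraMap ℂ K c ∈ B)
    {η : Fin n → Ω[K⁄ℂ]} (h : ∀ i, η i ∈ regDiff A B) :
    exteriorPower.ιMulti K n η ∈ regForms n A B := by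
  refine map_mem_latt (exteriorPower.ιMulti K n (M := Ω[K⁄ℂ])).toMultilinearMap hc
    (fun m hm ↦ ?_) h
  choose a ha hm using hm
  exact ⟨a, ha, congrArg _ (funext fun i ↦ (hm i).symm)⟩

lemma tprod_mem_formsOver {A B : Subring K} (hc : ∀ c : ℂ, algebraMap ℂ K c ∈ B)
    {ξ : Fin d → ⋀[K]^n Ω[K⁄ℂ]} (h : ∀ i, ξ i ∈ regForms n A B) :
    PiTensorProduct.tprod K ξ ∈ formsOver n d A B := by
  rw [formsOver_eq_latt]
  refine map_mem_latt (PiTensorProduct.tprod K) hc (fun m hm ↦ ?_) h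
  choose a ha hm using hm
  exact ⟨a, ha, congrArg _ (funext fun i ↦ hm i)⟩

section FormMap

variable {L : Type} [Field L] [Algebra ℂ L]

/-- The map of differentials induced by a homomorphism of fields. -/
def diffMap (f : K →ₐ[ℂ] L) : Ω[K⁄ℂ] →+ Ω[L⁄ℂ] :=
  let : Algebra K L := f.toRingHom.toAlgebra
  have : IsScalarTower ℂ K L := IsScalarTower.of_algebraMap_eq' f.comp_algebraMap.symm
  (KaehlerDifferential.map ℂ ℂ K L).toAddMonoidHom

lemma diffMap_D (f : K →ₐ[ℂ] L) (a : K) :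
    diffMap f (KaehlerDifferential.D ℂ K a) = KaehlerDifferential.D ℂ L (f a) := by
  let : Algebra K L := f.toRingHom.toAlgebra
  have : IsScalarTower ℂ K L := IsScalarTower.of_algebraMap_eq' f.comp_algebraMap.symm
  exact KaehlerDifferential.map_D ℂ ℂ K L a

lemma diffMap_smul (f : K →ₐ[ℂ] L) (a : K) (x : Ω[K⁄ℂ]) :
    diffMap f (a • x) = f a • diffMap f x := by
  let : Algebra K L := f.toRingHom.toAlgebra
  have : IsScalarTower ℂ K L := IsScalarTower.of_algebraMap_eq' f.comp_algebraMap.symm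
  exact (map_smul (KaehlerDifferential.map ℂ ℂ K L) a x).trans (algebraMap_smul L a _).symm

lemma formMap_smul (f : K →ₐ[ℂ] L) (a : K) (x : RatForm K n d) :
    formMap n d f (a • x) = f a • formMap n d f x := by
  let : Algebra K L := f.toRingHom.toAlgebra
  have : IsScalarTower ℂ K L := IsScalarTower.of_algebraMap_eq' f.comp_algebraMap.symm
  exact (map_smul (tensorMap K n d L) a x).trans (algebraMap_smul L a _).symm

lemma formMap_tprod (f : K →ₐ[ℂ] L) (η : Fin d → Fin n → Ω[K⁄ℂ]) :
    formMap n d f (PiTensorProduct.tprod K fun j ↦ exteriorPower.ιMulti K n (η j)) =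
      PiTensorProduct.tprod L fun j ↦ exteriorPower.ιMulti L n fun i ↦ diffMap f (η j i) := by
  let : Algebra K L := f.toRingHom.toAlgebra
  have : IsScalarTower ℂ K L := IsScalarTower.of_algebraMap_eq' f.comp_algebraMap.symm
  refine (PiTensorProduct.lift.tprod _).trans ?_
  refine congrArg (PiTensorProduct.tprod L) (funext fun j ↦ ?_)
  exact exteriorPower.alternatingMapLinearEquiv_apply_ιMulti _ _

lemma formMap_elemForm (f : K →ₐ[ℂ] L) (a : Fin d → Fin n → K) :
    formMap n d f (elemForm a) = elemForm fun j i ↦ f (a j i) := by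
  unfold elemForm
  rw [formMap_tprod]
  simp only [diffMap_D]

lemma formMap_mem_formsOver (f : K →ₐ[ℂ] L) {A B : Subring K} {A' B' : Subring L}
    (hA : ∀ a ∈ A, f a ∈ A') (hB : ∀ b ∈ B, f b ∈ B') {x : RatForm K n d}
    (hx : x ∈ formsOver n d A B) : formMap n d f x ∈ formsOver n d A' B' := by
  induction hx using Submodule.span_induction with
  | mem x hx =>
    obtain ⟨b, hb, a, ha, rfl⟩ := hx
    rw [formMap_smul, formMap_elemForm]
    exact Submodule.subset_span ⟨_, hB b hb, _, fun j i ↦ hA _ (ha j i), rfl⟩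
  | zero => simp
  | add x y _ _ hx hy => rw [map_add]; exact add_mem hx hy
  | smul c x _ hx =>
    rw [← algebraMap_smul K c x, formMap_smul, AlgHom.commutes, algebraMap_smul]
    exact Submodule.smul_mem _ c hx

end FormMap

section Basis

variable (e : Module.Basis (Fin n) K Ω[K⁄ℂ])

/-- The linear form on `RatForm K n d` defined by a basis of the differentials. -/
def basisForm (d : ℕ) : RatForm K n d →ₗ[K] K :=
  PiTensorProduct.lift ((MultilinearMap.mkPiAlgebra K (Fin d) K).compLinearMap
    fun _ ↦ exteriorPower.alternatingMapLinearEquiv e.det)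

lemma basisForm_tprod (η : Fin d → Fin n → Ω[K⁄ℂ]) :
    basisForm e d (PiTensorProduct.tprod K fun j ↦ exteriorPower.ιMulti K n (η j)) =
      ∏ j, e.det (η j) := by
  simp [basisForm]

/-- The top exterior power of an n-dimensional space is a line, and so are its tensor powers;
`basisForm` is the coordinate on that line. Comparing forms thus becomes comparing elements of K. -/
lemma eq_basisForm_smul (x : RatForm K n d) :
    x = basisForm e d x • PiTensorProduct.tprod K fun _ ↦ exteriorPower.ιMulti K n e := by
  set x₀ : RatForm K n d := PiTensorProduct.tprod K fun _ ↦ exteriorPower.ιMulti K n e with hx₀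
  have h1 : ∀ ξ : ⋀[K]^n Ω[K⁄ℂ],
      ξ = exteriorPower.alternatingMapLinearEquiv e.det ξ • exteriorPower.ιMulti K n e := by
    intro ξ
    have : (LinearMap.id : (⋀[K]^n Ω[K⁄ℂ]) →ₗ[K] _) =
        (exteriorPower.alternatingMapLinearEquiv e.det).smulRight
          (exteriorPower.ιMulti K n e) := by
      apply exteriorPower.linearMap_ext
      ext v : 1
      simp only [LinearMap.compAlternatingMap_apply, LinearMap.id_apply, LinearMap.smulRight_apply,
        exteriorPower.alternatingMapLinearEquiv_apply_ιMulti]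
      have := congrArg (fun f : Ω[K⁄ℂ] [⋀^Fin n]→ₗ[K] (⋀[K]^n Ω[K⁄ℂ]) ↦ f)
        (Module.Basis.ext_alternating (f := exteriorPower.ιMulti K n (M := Ω[K⁄ℂ]))
          (g := (LinearMap.toSpanSingleton K _ (exteriorPower.ιMulti K n e)).compAlternatingMap
            e.det) e (fun w hw ↦ by
            obtain ⟨σ, rfl⟩ : ∃ σ : Equiv.Perm (Fin n), (σ : Fin n → Fin n) = w :=
              ⟨Equiv.ofBijective w (Finite.injective_iff_bijective.mp hw), rfl⟩
            have e1 := (exteriorPower.ιMulti K n (M := Ω[K⁄ℂ])).map_perm e σ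
            have e2 := e.det.map_perm e σ
            simp only [Function.comp_def] at e1 e2
            simp only [LinearMap.compAlternatingMap_apply, LinearMap.toSpanSingleton_apply]
            rw [e1, e2, e.det_self]
            simp only [Units.smul_def, zsmul_eq_mul, mul_one, Int.cast_smul_eq_zsmul]))
      exact DFunLike.congr_fun this v
    exact DFunLike.congr_fun this ξ
  have h2 : (LinearMap.id : RatForm K n d →ₗ[K] _) = (basisForm e d).smulRight x₀ := by
    apply PiTensorProduct.ext
    ext ξ : 1
    simp only [LinearMap.compMultilinearMap_apply, LinearMap.id_apply, LinearMap.smulRight_apply]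
    conv_lhs => rw [show ξ = fun j ↦ exteriorPower.alternatingMapLinearEquiv e.det (ξ j) •
      exteriorPower.ιMulti K n e from funext fun j ↦ h1 (ξ j)]
    rw [MultilinearMap.map_smul_univ, basisForm, PiTensorProduct.lift.tprod]
    simp [hx₀]
  exact DFunLike.congr_fun h2 x

lemma basisForm_injective : Function.Injective (basisForm e d) := fun x y h ↦ by
  rw [eq_basisForm_smul e x, eq_basisForm_smul e y, h]

end Basis

end RatForms

/-! ### Differentials of a transcendence basis -/

section DifferentialBasis

variable {K : Type} [Field K] [Algebra ℂ K] {ι : Type} {x : ι → K}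

open scoped IntermediateField.algebraAdjoinAdjoin in
/-- The differentials of a transcendence basis form a basis. -/
lemma exists_basis_D (hx : IsTranscendenceBasis ℂ x) :
    ∃ e : Module.Basis ι K Ω[K⁄ℂ], ∀ i, e i = KaehlerDifferential.D ℂ K (x i) := by
  let S := Algebra.adjoin ℂ (Set.range x)
  let F := IntermediateField.adjoin ℂ (Set.range x)
  have : Algebra.IsAlgebraic F K := hx.isAlgebraic_field
  -- In characteristic zero the algebraic extension K/F is separable. Hence K is formally étale over
  -- the polynomial ring, and its differentials are the base change of the free module on the dXᵢ.
  have : Algebra.FormallyEtale F K := Algebra.FormallyEtale.of_isSeparable _ K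
  have : Algebra.FormallyEtale S F := .of_isLocalization (nonZeroDivisors _)
  have : Algebra.FormallyEtale S K := .comp _ F _
  let : Algebra (MvPolynomial ι ℂ) S := hx.1.aevalEquiv.toRingEquiv.toRingHom.toAlgebra
  let : Algebra (MvPolynomial ι ℂ) K := (MvPolynomial.aeval x).toRingHom.toAlgebra
  have : IsScalarTower (MvPolynomial ι ℂ) S K := IsScalarTower.of_algebraMap_eq fun p ↦
    (hx.1.algebraMap_aevalEquiv p).symm
  have : IsScalarTower ℂ (MvPolynomial ι ℂ) K := IsScalarTower.of_algebraMap_eq fun p ↦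
    ((MvPolynomial.aeval x).commutes p).symm
  let e₀ : MvPolynomial ι ℂ ≃ₐ[MvPolynomial ι ℂ] S :=
    { hx.1.aevalEquiv.toRingEquiv with commutes' := fun _ ↦ rfl }
  have : Algebra.FormallyEtale (MvPolynomial ι ℂ) S := .of_equiv e₀
  have : Algebra.FormallyEtale (MvPolynomial ι ℂ) K := .comp _ S _
  refine ⟨((KaehlerDifferential.mvPolynomialBasis ℂ ι).baseChange K).map
    (KaehlerDifferential.tensorKaehlerEquivOfFormallyEtale ℂ (MvPolynomial ι ℂ) K), fun i ↦ ?_⟩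
  rw [Module.Basis.map_apply, Module.Basis.baseChange_apply,
    KaehlerDifferential.tensorKaehlerEquivOfFormallyEtale_apply,
    KaehlerDifferential.mapBaseChange_tmul, one_smul, KaehlerDifferential.mvPolynomialBasis_apply,
    KaehlerDifferential.map_D]
  congr 1
  exact MvPolynomial.aeval_X x i

end DifferentialBasis

/-! ### Discrete valuation subrings -/

section Discrete

variable {L : Type} [Field L] [Algebra ℂ L]

/-- `R` is the valuation ring of the discrete valuation `ord` of `L`, and contains `ℂ`. -/
structure IsDiscrete (R : Subring L) (ord : L → ℤ) : Prop where
  const_mem : ∀ c : ℂ, algebraMap ℂ L c ∈ R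
  ord_mul : ∀ x y, x ≠ 0 → y ≠ 0 → ord (x * y) = ord x + ord y
  mem_iff : ∀ x, x ≠ 0 → (x ∈ R ↔ 0 ≤ ord x)
  exists_one : ∃ t, t ≠ 0 ∧ ord t = 1

namespace IsDiscrete

variable {R : Subring L} {ord : L → ℤ} (h : IsDiscrete R ord)
include h

lemma ord_one : ord 1 = 0 := by
  have := h.ord_mul 1 1 one_ne_zero one_ne_zero
  rw [mul_one] at this
  omega

lemma ord_inv {x : L} (hx : x ≠ 0) : ord x⁻¹ = -ord x := by
  have := h.ord_mul x x⁻¹ hx (inv_ne_zero hx)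
  rw [mul_inv_cancel₀ hx, h.ord_one] at this
  omega

lemma ord_div {x y : L} (hx : x ≠ 0) (hy : y ≠ 0) : ord (x / y) = ord x - ord y := by
  rw [div_eq_mul_inv, h.ord_mul _ _ hx (inv_ne_zero hy), h.ord_inv hy]
  ring

lemma ord_pow {x : L} (hx : x ≠ 0) (n : ℕ) : ord (x ^ n) = n * ord x := by
  induction n with
  | zero => simp [h.ord_one]
  | succ n ih =>
    rw [pow_succ, h.ord_mul _ _ (pow_ne_zero _ hx) hx, ih]
    push_cast
    ring

lemma ord_zpow {x : L} (hx : x ≠ 0) (n : ℤ) : ord (x ^ n) = n * ord x := by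
  cases n with
  | ofNat n => simpa using h.ord_pow hx n
  | negSucc n =>
    rw [zpow_negSucc, h.ord_inv (pow_ne_zero _ hx), h.ord_pow hx]
    push_cast [Int.negSucc_eq]
    ring

lemma ord_algebraMap {c : ℂ} (hc : c ≠ 0) : ord (algebraMap ℂ L c) = 0 := by
  have h0 : algebraMap ℂ L c ≠ 0 := (map_ne_zero _).mpr hc
  have h1 := (h.mem_iff _ h0).mp (h.const_mem c)
  have h2 := (h.mem_iff _ (inv_ne_zero h0)).mp (by rw [← map_inv₀]; exact h.const_mem _)
  rw [h.ord_inv h0] at h2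
  omega

lemma ord_natCast {n : ℕ} [NeZero n] : ord (n : L) = 0 := by
  have := h.ord_algebraMap (c := (n : ℂ)) (NeZero.ne _)
  rwa [map_natCast] at this

lemma ord_ofNat {n : ℕ} [n.AtLeastTwo] : ord (OfNat.ofNat n : L) = 0 := h.ord_natCast

lemma ord_neg (x : L) : ord (-x) = ord x := by
  by_cases hx : x = 0
  · simp [hx]
  · have := h.ord_mul (algebraMap ℂ L (-1)) x (by simp) hx
    rw [h.ord_algebraMap (by simp)] at this
    simpa using this

lemma ord_add_nonneg {x y : L} (hx : x ∈ R) (hy : y ∈ R) (hxy : x + y ≠ 0) : 0 ≤ ord (x + y) :=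
  (h.mem_iff _ hxy).mp (R.add_mem hx hy)

/-- The ultrametric inequality is not among the axioms; it comes from R being a ring. If 1 + x and x
both had positive order, 1/t = (1 + x)/t − x/t would lie in R for a uniformizer t. -/
lemma ord_one_add {x : L} (hx : x ≠ 0) (hpos : 0 < ord x) : 1 + x ≠ 0 ∧ ord (1 + x) = 0 := by
  have hxR : x ∈ R := (h.mem_iff x hx).mpr hpos.le
  have hne : 1 + x ≠ 0 := fun e ↦ by
    have : x = -1 := by linear_combination e
    rw [this, h.ord_neg, h.ord_one] at hpos
    omega
  refine ⟨hne, ?_⟩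
  have h0 := h.ord_add_nonneg R.one_mem hxR hne
  by_contra hcon
  obtain ⟨t, ht, ht1⟩ := h.exists_one
  have e : (1 : L) / t = (1 + x) / t + -x / t := by ring
  have hm : (1 : L) / t ∈ R := by
    rw [e]
    refine R.add_mem ((h.mem_iff _ (div_ne_zero hne ht)).mpr ?_)
      ((h.mem_iff _ (div_ne_zero (neg_ne_zero.mpr hx) ht)).mpr ?_)
    · rw [h.ord_div hne ht]; omega
    · rw [h.ord_div (neg_ne_zero.mpr hx) ht, h.ord_neg]; omega
  have := (h.mem_iff _ (div_ne_zero one_ne_zero ht)).mp hm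
  rw [h.ord_div one_ne_zero ht, h.ord_one] at this
  omega

lemma ord_add_of_lt {x y : L} (hx : x ≠ 0) (hy : y ≠ 0) (hlt : ord x < ord y) :
    x + y ≠ 0 ∧ ord (x + y) = ord x := by
  obtain ⟨h1, h2⟩ := h.ord_one_add (div_ne_zero hy hx) (by rw [h.ord_div hy hx]; omega)
  have e : x + y = x * (1 + y / x) := by field_simp
  rw [e]
  exact ⟨mul_ne_zero hx h1, by rw [h.ord_mul _ _ hx h1, h2, add_zero]⟩

end IsDiscrete

end Discrete

/-! ### Logarithmic differentials -/

section LogDiff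

variable {L : Type} [Field L] [Algebra ℂ L]

/-- The logarithmic differential `dm / m`. -/
def dlog (m : L) : Ω[L⁄ℂ] := m⁻¹ • KaehlerDifferential.D ℂ L m

lemma D_eq_smul_dlog {m : L} (hm : m ≠ 0) : KaehlerDifferential.D ℂ L m = m • dlog m := by
  rw [dlog, smul_smul, mul_inv_cancel₀ hm, one_smul]

lemma dlog_mul {x y : L} (hx : x ≠ 0) (hy : y ≠ 0) : dlog (x * y) = dlog x + dlog y := by
  simp only [dlog, Derivation.leibniz]
  match_scalars <;> field_simp

lemma dlog_one : dlog (1 : L) = 0 := by simp [dlog]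

lemma dlog_inv {x : L} (hx : x ≠ 0) : dlog x⁻¹ = -dlog x := by
  have := dlog_mul hx (inv_ne_zero hx)
  rw [mul_inv_cancel₀ hx, dlog_one] at this
  exact (neg_eq_of_add_eq_zero_right this.symm).symm

lemma dlog_pow {x : L} (hx : x ≠ 0) (n : ℕ) : dlog (x ^ n) = (n : L) • dlog x := by
  induction n with
  | zero => simp [dlog_one]
  | succ n ih =>
    rw [pow_succ, dlog_mul (pow_ne_zero _ hx) hx, ih]
    push_cast
    module

lemma dlog_zpow {x : L} (hx : x ≠ 0) (n : ℤ) : dlog (x ^ n) = (n : L) • dlog x := by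
  cases n with
  | ofNat n => simpa using dlog_pow hx n
  | negSucc n =>
    rw [zpow_negSucc, dlog_inv (pow_ne_zero _ hx), dlog_pow hx]
    push_cast
    module

variable {R : Subring L} {ord : L → ℤ} (h : IsDiscrete R ord)
include h

lemma IsDiscrete.dlog_mem {m : L} (hm : m ≠ 0) (ho : ord m = 0) : dlog m ∈ regDiff R R := by
  refine smul_mem_latt ?_ (D_mem_regDiff ?_)
  · rw [h.mem_iff _ (inv_ne_zero hm), h.ord_inv hm]; omega
  · rw [h.mem_iff _ hm]; omega

/-- Each γᵢ leaves the wedge once and the tensor square twice, so the coefficient to be tested is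
F(∏ γᵢ)². -/
lemma IsDiscrete.smul_tprod_mem {n : ℕ} {F : L} {U η : Fin n → Ω[L⁄ℂ]} {γ : Fin n → L}
    (hU : ∀ i, U i = γ i • η i) (hη : ∀ i, η i ∈ regDiff R R) (hF : F * (∏ i, γ i) ^ 2 ∈ R) :
    F • PiTensorProduct.tprod L (fun _ : Fin 2 ↦ exteriorPower.ιMulti L n U) ∈
      formsOver n 2 R R := by
  have e : exteriorPower.ιMulti L n U = (∏ i, γ i) • exteriorPower.ιMulti L n η := by
    rw [funext hU]
    exact MultilinearMap.map_smul_univ (exteriorPower.ιMulti L n).toMultilinearMap γ η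
  rw [e, MultilinearMap.map_smul_univ (PiTensorProduct.tprod L) (fun _ ↦ ∏ i, γ i)
    (fun _ : Fin 2 ↦ exteriorPower.ιMulti L n η), smul_smul]
  refine smul_mem_formsOver (by simpa using hF) ?_
  exact tprod_mem_formsOver h.const_mem fun _ ↦ ιMulti_mem_regForms h.const_mem hη

omit [Algebra ℂ L] h in
lemma alternating_eq_zero {M N ι : Type} [DecidableEq ι] [AddCommGroup M] [Module L M]
    [AddCommGroup N] [Module L N]
    (f : M [⋀^ι]→ₗ[L] N) {z : ι → M} {τ : M} {i j : ι} {a b : L} (hij : i ≠ j)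
    (hi : z i = a • τ) (hj : z j = b • τ) : f z = 0 := by
  rw [← Function.update_eq_self i z, hi, f.map_update_smul]
  set w := Function.update z i τ with hw
  have hwj : w j = b • τ := by rw [hw, Function.update_of_ne hij.symm, hj]
  rw [← Function.update_eq_self j w, hwj, f.map_update_smul,
    f.map_eq_zero_of_eq _ (i := i) (j := j) _ hij, smul_zero, smul_zero]
  rw [Function.update_self, Function.update_of_ne hij, hw, Function.update_self]

/-- Writing mᵢ as a power of t times a unit gives dlog mᵢ = ord(mᵢ) dlog t plus a regular
differential. In the expanded wedge, terms with two factors dlog t vanish, and t cancels the pole of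
a single one because t dlog t = dt. -/
lemma IsDiscrete.smul_ιMulti_dlog_mem {n : ℕ} {m : Fin n → L} (hm : ∀ i, m i ≠ 0) {t : L}
    (ht : t ≠ 0) (ht1 : ord t = 1) :
    t • exteriorPower.ιMulti L n (fun i ↦ dlog (m i)) ∈ regForms n R R := by
  classical
  have htR : t ∈ R := by rw [h.mem_iff _ ht]; omega
  let y : Fin n → Ω[L⁄ℂ] := fun i ↦ dlog (m i / t ^ ord (m i))
  let x : Fin n → Ω[L⁄ℂ] := fun i ↦ (ord (m i) : L) • dlog t
  have hy : ∀ i, y i ∈ regDiff R R := fun i ↦ by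
    refine h.dlog_mem (div_ne_zero (hm i) (zpow_ne_zero _ ht)) ?_
    rw [h.ord_div (hm i) (zpow_ne_zero _ ht), h.ord_zpow ht, ht1]
    ring
  have hxy : (fun i ↦ dlog (m i)) = x + y := funext fun i ↦ by
    have := dlog_mul (zpow_ne_zero (ord (m i)) ht) (div_ne_zero (hm i) (zpow_ne_zero (ord (m i)) ht))
    rw [mul_div_cancel₀ _ (zpow_ne_zero _ ht), dlog_zpow ht] at this
    exact this
  have hint : ∀ k : ℤ, (k : L) ∈ R := fun k ↦ intCast_mem R k
  have key := (exteriorPower.ιMulti L n (M := Ω[L⁄ℂ])).toMultilinearMap.map_add_univ x y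
  rw [hxy]
  change t • (exteriorPower.ιMulti L n (M := Ω[L⁄ℂ])).toMultilinearMap (x + y) ∈ _
  rw [key, Finset.smul_sum]
  refine Submodule.sum_mem _ fun s _ ↦ ?_
  change t • exteriorPower.ιMulti L n (s.piecewise x y) ∈ _
  by_cases hs : s = ∅
  · rw [hs, Finset.piecewise_empty]
    exact smul_mem_latt htR (ιMulti_mem_regForms h.const_mem hy)
  obtain ⟨i, hi⟩ := Finset.nonempty_iff_ne_empty.mpr hs
  by_cases hs2 : s = {i}
  -- Exactly one factor dlog t: the scalar t is moved into that slot.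
  · rw [hs2, Finset.piecewise_singleton, ← (exteriorPower.ιMulti L n).map_update_smul]
    refine ιMulti_mem_regForms h.const_mem fun j ↦ ?_
    by_cases hj : j = i
    · subst hj
      rw [Function.update_self, smul_comm, ← D_eq_smul_dlog ht]
      exact smul_mem_latt (hint _) (D_mem_regDiff htR)
    · rw [Function.update_of_ne hj]; exact hy j
  · obtain ⟨j, hj, hij⟩ : ∃ j ∈ s, j ≠ i := by
      by_contra! hcon
      exact hs2 (Finset.eq_singleton_iff_unique_mem.mpr ⟨hi, hcon⟩)
    rw [alternating_eq_zero (exteriorPower.ιMulti L n) hij (τ := dlog t) (a := (ord (m j) : L))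
      (b := (ord (m i) : L)) (by simp [x, hj]) (by simp [x, hi]), smul_zero]
    exact zero_mem _

/-- Each of the two tensor factors needs one uniformizer to become regular, hence the bound 2 on the
order. -/
lemma IsDiscrete.smul_tprod_dlog_mem {n : ℕ} {F : L} {U : Fin n → Ω[L⁄ℂ]} {γ m : Fin n → L}
    (hU : ∀ i, U i = γ i • dlog (m i)) (hm : ∀ i, m i ≠ 0)
    (hF : 2 ≤ ord (F * (∏ i, γ i) ^ 2)) :
    F • PiTensorProduct.tprod L (fun _ : Fin 2 ↦ exteriorPower.ιMulti L n U) ∈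
      formsOver n 2 R R := by
  obtain ⟨t, ht, ht1⟩ := h.exists_one
  have e : exteriorPower.ιMulti L n U = ((∏ i, γ i) * t⁻¹) •
      t • exteriorPower.ιMulti L n (fun i ↦ dlog (m i)) := by
    rw [funext hU, smul_smul, mul_assoc, inv_mul_cancel₀ ht, mul_one]
    exact MultilinearMap.map_smul_univ (exteriorPower.ιMulti L n).toMultilinearMap γ _
  rw [e, MultilinearMap.map_smul_univ (PiTensorProduct.tprod L) (fun _ ↦ (∏ i, γ i) * t⁻¹)
    (fun _ : Fin 2 ↦ t • exteriorPower.ιMulti L n fun i ↦ dlog (m i)), smul_smul]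
  refine smul_mem_formsOver ?_
    (tprod_mem_formsOver h.const_mem fun _ ↦ h.smul_ιMulti_dlog_mem hm ht ht1)
  have e2 : F * ∏ _i : Fin 2, (∏ i, γ i) * t⁻¹ = F * (∏ i, γ i) ^ 2 / t ^ 2 := by
    rw [Finset.prod_const, Finset.card_univ, Fintype.card_fin]
    field_simp
  rw [e2]
  by_cases h0 : F * (∏ i, γ i) ^ 2 = 0
  · rw [h0, zero_div]; exact R.zero_mem
  · rw [h.mem_iff _ (div_ne_zero h0 (pow_ne_zero _ ht)), h.ord_div h0 (pow_ne_zero _ ht),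
      h.ord_pow ht, ht1]
    push_cast
    omega

end LogDiff

/-! ### The invariant bicanonical forms are regular at every discrete valuation -/

section Factors

variable {L : Type} [Field L] [Algebra ℂ L]

lemma relation_D {r P A : L} (hA : A ^ 2 = r * (1 + r ^ 4 * P)) :
    (2 * A) • KaehlerDifferential.D ℂ L A =
      (1 + 5 * (r ^ 4 * P)) • KaehlerDifferential.D ℂ L r +
        r ^ 5 • KaehlerDifferential.D ℂ L P := by
  have := congrArg (KaehlerDifferential.D ℂ L) hA
  simp only [Derivation.leibniz, Derivation.leibniz_pow, map_add, Derivation.map_one_eq_zero] at this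
  simp only [← Nat.cast_smul_eq_nsmul L] at this
  linear_combination (norm := module) this

/-- The relation between the logarithmic differentials of the two coordinates of `C₂`. -/
lemma relation_dlog {r P A : L} (hA : A ^ 2 = r * (1 + r ^ 4 * P)) (hA0 : A ≠ 0) (hP : P ≠ 0) :
    (1 + r ^ 4 * P) • (dlog A + (1 / 8 : L) • dlog P) =
      -- Formally, with P = e⁸, x = re² and y = Ae, this is the relation y² = x + x⁵ in logarithmic
      -- form: dlog x and dlog y are the two combinations with dlog P.
      ((1 + 5 * (r ^ 4 * P)) / 2) • (dlog r + (1 / 4 : L) • dlog P) := by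
  have := charZero_of_injective_algebraMap (algebraMap ℂ L).injective
  have hr : r ≠ 0 := by rintro rfl; simp [hA0] at hA
  have h1 : 1 + r ^ 4 * P ≠ 0 := by intro h; simp [hA0, h] at hA
  have h2 := relation_D hA
  rw [D_eq_smul_dlog hA0, D_eq_smul_dlog hP, D_eq_smul_dlog hr] at h2
  have h3 : (2 * (r * (1 + r ^ 4 * P))) • dlog A =
      ((1 + 5 * (r ^ 4 * P)) * r) • dlog r + (r ^ 5 * P) • dlog P := by
    rw [← hA]
    linear_combination (norm := module) h2
  have h4 : (1 + r ^ 4 * P) • dlog A = (2 * r)⁻¹ • ((2 * (r * (1 + r ^ 4 * P))) • dlog A) := by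
    match_scalars; field_simp
  rw [smul_add, h4, h3]
  match_scalars <;> field_simp
  ring

variable {R : Subring L} {ord : L → ℤ} (h : IsDiscrete R ord)
include h

/-- The factor `C₂` at a discrete valuation where `P` is a unit. -/
lemma IsDiscrete.exists_factor₂ {r P A : L} (hA : A ^ 2 = r * (1 + r ^ 4 * P)) (hA0 : A ≠ 0)
    (hP : P ≠ 0) (hP0 : ord P = 0) :
    ∃ γ : L, ∃ η ∈ regDiff R R, dlog r + (1 / 4 : L) • dlog P = γ • η ∧
      ∀ b ≤ 2, r ^ (b + 2) / A ^ 2 * γ ^ 2 ∈ R := by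
  have := charZero_of_injective_algebraMap (algebraMap ℂ L).injective
  have hr : r ≠ 0 := by rintro rfl; simp [hA0] at hA
  have h1 : 1 + r ^ 4 * P ≠ 0 := by intro h; simp [hA0, h] at hA
  have hrel := relation_dlog hA hA0 hP
  have hc : ∀ c : ℚ, (c : L) ∈ R := fun c ↦ by
    have := h.const_mem c
    rwa [map_ratCast] at this
  have hn : ∀ n : ℕ, (n : L) ∈ R := fun n ↦ natCast_mem R n
  have hPR : P ∈ R := by rw [h.mem_iff _ hP]; omega
  have h4R : (1 / 4 : L) ∈ R := by simpa using hc (1 / 4)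
  have h8R : (1 / 8 : L) ∈ R := by simpa using hc (1 / 8)
  have hdP : dlog P ∈ regDiff R R := h.dlog_mem hP hP0
  have hordA : 2 * ord A = ord r + ord (1 + r ^ 4 * P) := by
    have := congrArg ord hA
    rw [h.ord_pow hA0, h.ord_mul _ _ hr h1] at this
    exact_mod_cast this
  have hordq : ord (r ^ 4 * P) = 4 * ord r := by
    rw [h.ord_mul _ _ (pow_ne_zero _ hr) hP, h.ord_pow hr, hP0]; push_cast; ring
  have hq0 : r ^ 4 * P ≠ 0 := mul_ne_zero (pow_ne_zero _ hr) hP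
  rcases le_or_gt 0 (ord r) with hr0 | hr0
  · have hrR : r ∈ R := (h.mem_iff _ hr).mpr hr0
    have h1R : 0 ≤ ord (1 + r ^ 4 * P) :=
      h.ord_add_nonneg R.one_mem ((h.mem_iff _ hq0).mpr (by omega)) h1
    have hAR : A ∈ R := (h.mem_iff _ hA0).mpr (by omega)
    rcases eq_or_ne (ord A) 0 with hA1 | hA1
    -- Away from the branch points, r itself is the local parameter of the curve, corrected by a
    -- multiple of dlog P.
    · refine ⟨r⁻¹, KaehlerDifferential.D ℂ L r + (r * (1 / 4)) • dlog P,
        add_mem (D_mem_regDiff hrR) (smul_mem_latt (R.mul_mem hrR h4R) hdP), ?_, fun b _ ↦ ?_⟩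
      · rw [dlog]
        match_scalars <;> field_simp
      · have : r ^ (b + 2) / A ^ 2 * r⁻¹ ^ 2 = r ^ b * (A⁻¹) ^ 2 := by
          rw [pow_add]; field_simp
        rw [this]
        refine R.mul_mem (R.pow_mem hrR _) (R.pow_mem ?_ _)
        rw [h.mem_iff _ (inv_ne_zero hA0), h.ord_inv hA0]; omega
    -- At a finite branch point A is the parameter. The factor 1 + 5r⁴P is the derivative of x + x⁵
    -- and is a unit there: if r is a unit, then 1 + r⁴P has positive order and 1 + 5r⁴P ≡ −4.
    · have h5 : 1 + 5 * (r ^ 4 * P) ≠ 0 ∧ ord (1 + 5 * (r ^ 4 * P)) = 0 := by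
        rcases eq_or_ne (ord r) 0 with hr1 | hr1
        · have e : 1 + 5 * (r ^ 4 * P) = -4 + 5 * (1 + r ^ 4 * P) := by ring
          rw [e]
          have o4 : ord (-4 : L) = 0 := by rw [h.ord_neg, h.ord_ofNat]
          have o5 : ord (5 * (1 + r ^ 4 * P)) = ord (1 + r ^ 4 * P) := by
            rw [h.ord_mul _ _ (by norm_num) h1, h.ord_ofNat, zero_add]
          have := h.ord_add_of_lt (x := -4) (y := 5 * (1 + r ^ 4 * P)) (by norm_num)
            (mul_ne_zero (by norm_num) h1) (by rw [o4, o5]; omega)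
          rwa [o4] at this
        · refine h.ord_one_add (mul_ne_zero (by norm_num) hq0) ?_
          rw [h.ord_mul _ _ (by norm_num) hq0, h.ord_ofNat]
          omega
      refine ⟨2 * A / (r * (1 + 5 * (r ^ 4 * P))),
        KaehlerDifferential.D ℂ L A + (A * (1 / 8)) • dlog P,
        add_mem (D_mem_regDiff hAR) (smul_mem_latt (R.mul_mem hAR h8R) hdP), ?_, fun b _ ↦ ?_⟩
      · have h50 := h5.1
        have e1 : dlog r + (1 / 4 : L) • dlog P = (2 / (1 + 5 * (r ^ 4 * P))) •
            (((1 + 5 * (r ^ 4 * P)) / 2) • (dlog r + (1 / 4 : L) • dlog P)) := by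
          rw [smul_smul, div_mul_div_comm, mul_comm, div_self (mul_ne_zero h50 two_ne_zero), one_smul]
        rw [e1, ← hrel, D_eq_smul_dlog hA0]
        have e2 : 1 + r ^ 4 * P = A ^ 2 / r := by rw [hA]; field_simp
        rw [e2]
        match_scalars <;> field_simp
      · have h50 := h5.1
        have : r ^ (b + 2) / A ^ 2 * (2 * A / (r * (1 + 5 * (r ^ 4 * P)))) ^ 2 =
            r ^ b * (2 * (1 + 5 * (r ^ 4 * P))⁻¹) ^ 2 := by rw [pow_add]; field_simp
        rw [this]
        refine R.mul_mem (R.pow_mem hrR _) (R.pow_mem (R.mul_mem (hn 2) ?_) _)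
        rw [h.mem_iff _ (inv_ne_zero h50), h.ord_inv h50]; omega
  -- At infinity y/x³ is the parameter. As Ae/(re²)³ = (A/r³)e⁻⁵, the correction is −⅝ dlog P. The
  -- final coefficient has order (b − 2) ord r, which is nonnegative for b ≤ 2 because ord r < 0.
  · have hq1 : ord (1 + r ^ 4 * P) = 4 * ord r := by
      rw [add_comm]
      have := h.ord_add_of_lt (x := r ^ 4 * P) (y := 1) hq0 one_ne_zero
        (by rw [h.ord_one]; omega)
      omega
    have hq5 : 5 + r ^ 4 * P ≠ 0 ∧ ord (5 + r ^ 4 * P) = 4 * ord r := by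
      rw [add_comm]
      have := h.ord_add_of_lt (x := r ^ 4 * P) (y := 5) hq0 (by norm_num)
        (by rw [h.ord_ofNat]; omega)
      exact ⟨this.1, by omega⟩
    have hq50 := hq5.1
    have hA'0 : A / r ^ 3 ≠ 0 := div_ne_zero hA0 (pow_ne_zero _ hr)
    have hA'R : A / r ^ 3 ∈ R := by
      rw [h.mem_iff _ hA'0, h.ord_div hA0 (pow_ne_zero _ hr), h.ord_pow hr]
      push_cast
      omega
    refine ⟨-2 * (1 + r ^ 4 * P) / ((5 + r ^ 4 * P) * (A / r ^ 3)),
      KaehlerDifferential.D ℂ L (A / r ^ 3) + (-5 * ((A / r ^ 3) * (1 / 8))) • dlog P,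
      add_mem (D_mem_regDiff hA'R) (smul_mem_latt (R.mul_mem (R.neg_mem (hn 5))
        (R.mul_mem hA'R h8R)) hdP), ?_, fun b hb ↦ ?_⟩
    · have ed : dlog (A / r ^ 3) = dlog A - (3 : L) • dlog r := by
        rw [div_eq_mul_inv, dlog_mul hA0 (inv_ne_zero (pow_ne_zero _ hr)),
          dlog_inv (pow_ne_zero _ hr), dlog_pow hr]
        push_cast
        module
      rw [D_eq_smul_dlog hA'0, ed]
      have hrel' : dlog A = ((1 + 5 * (r ^ 4 * P)) / 2 / (1 + r ^ 4 * P)) •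
          (dlog r + (1 / 4 : L) • dlog P) - (1 / 8 : L) • dlog P := by
        rw [div_eq_inv_mul _ (1 + r ^ 4 * P), mul_smul, ← hrel, smul_smul, inv_mul_cancel₀ h1,
          one_smul, add_sub_cancel_right]
      rw [hrel']
      match_scalars <;> field_simp <;> ring
    · have e : r ^ (b + 2) / A ^ 2 * (-2 * (1 + r ^ 4 * P) / ((5 + r ^ 4 * P) * (A / r ^ 3))) ^ 2
          = r ^ (b + 2) / A ^ 4 * (r ^ 3) ^ 2 * (2 * ((1 + r ^ 4 * P) / (5 + r ^ 4 * P))) ^ 2 := by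
        field_simp
      rw [e]
      have hd0 := div_ne_zero h1 hq50
      refine R.mul_mem ?_ (R.pow_mem (R.mul_mem (hn 2) ?_) _)
      · have hrb := pow_ne_zero (b + 2) hr
        have hA4 := pow_ne_zero 4 hA0
        have hr3 := pow_ne_zero 2 (pow_ne_zero 3 hr)
        rw [h.mem_iff _ (mul_ne_zero (div_ne_zero hrb hA4) hr3),
          h.ord_mul _ _ (div_ne_zero hrb hA4) hr3, h.ord_div hrb hA4, h.ord_pow hr, h.ord_pow hA0,
          h.ord_pow (pow_ne_zero 3 hr), h.ord_pow hr]
        push_cast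
        interval_cases b <;> norm_num <;> omega
      · rw [h.mem_iff _ hd0, h.ord_div h1 hq50]
        omega

/-- The factor `C₃` at a discrete valuation where `P` is a unit. -/
lemma IsDiscrete.exists_factor₃ {e P c : L} (hc : c ^ 2 = 1 + P * e ^ 8) (hc0 : c ≠ 0)
    (he : e ≠ 0) (hP : P ≠ 0) (hP0 : ord P = 0) :
    ∃ γ : L, ∃ η ∈ regDiff R R, dlog e + (1 / 8 : L) • dlog P = γ • η ∧
      ∀ b ≤ 4, e ^ (b + 2) / c ^ 2 * γ ^ 2 ∈ R := by
  have := charZero_of_injective_algebraMap (algebraMap ℂ L).injective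
  have hq : ∀ c : ℚ, (c : L) ∈ R := fun c ↦ by
    have := h.const_mem c
    rwa [map_ratCast] at this
  have h8R : (1 / 8 : L) ∈ R := by simpa using hq (1 / 8)
  have hdP : dlog P ∈ regDiff R R := h.dlog_mem hP hP0
  have hPR : P ∈ R := by rw [h.mem_iff _ hP]; omega
  have hPe0 : P * e ^ 8 ≠ 0 := mul_ne_zero hP (pow_ne_zero _ he)
  have hordPe : ord (P * e ^ 8) = 8 * ord e := by
    rw [h.ord_mul _ _ hP (pow_ne_zero _ he), h.ord_pow he, hP0]; push_cast; ring
  have h10 : 1 + P * e ^ 8 ≠ 0 := by rw [← hc]; exact pow_ne_zero _ hc0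
  have hordc : 2 * ord c = ord (1 + P * e ^ 8) := by
    rw [← hc, h.ord_pow hc0]; norm_num
  rcases le_or_gt 0 (ord e) with he0 | he0
  · have heR : e ∈ R := (h.mem_iff _ he).mpr he0
    have hcn : 0 ≤ ord (1 + P * e ^ 8) := h.ord_add_nonneg R.one_mem
      (R.mul_mem hPR (R.pow_mem heR 8)) h10
    have hcR : c ∈ R := (h.mem_iff _ hc0).mpr (by omega)
    rcases eq_or_ne (ord c) 0 with hc1 | hc1
    · refine ⟨e⁻¹, KaehlerDifferential.D ℂ L e + (e * (1 / 8)) • dlog P,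
        add_mem (D_mem_regDiff heR) (smul_mem_latt (R.mul_mem heR h8R) hdP), ?_, fun b _ ↦ ?_⟩
      · rw [dlog]
        match_scalars <;> field_simp
      · have : e ^ (b + 2) / c ^ 2 * e⁻¹ ^ 2 = e ^ b * (c⁻¹) ^ 2 := by
          rw [pow_add]; field_simp
        rw [this]
        refine R.mul_mem (R.pow_mem heR _) (R.pow_mem ?_ _)
        rw [h.mem_iff _ (inv_ne_zero hc0), h.ord_inv hc0]; omega
    -- At a branch point 1 + Pe⁸ is not a unit, so e is one; c is the parameter, with c dc =
    -- 4Pe⁸(dlog e + ⅛ dlog P).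
    · have he1 : ord e = 0 := by
        by_contra hcon
        have := (h.ord_one_add hPe0 (by omega)).2
        omega
      refine ⟨c / (4 * (P * e ^ 8)), KaehlerDifferential.D ℂ L c, D_mem_regDiff hcR, ?_,
        fun b _ ↦ ?_⟩
      · have h2 := congrArg (KaehlerDifferential.D ℂ L) hc
        simp only [Derivation.leibniz, Derivation.leibniz_pow, map_add,
          Derivation.map_one_eq_zero] at h2
        simp only [← Nat.cast_smul_eq_nsmul L] at h2
        rw [D_eq_smul_dlog he, D_eq_smul_dlog hP] at h2
        have h3 : c • KaehlerDifferential.D ℂ L c =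
            (4 * (P * e ^ 8)) • (dlog e + (1 / 8 : L) • dlog P) := by
          have h4 : c • KaehlerDifferential.D ℂ L c = (2 : L)⁻¹ •
            ((2 : ℕ) : L) • c ^ (2 - 1) • KaehlerDifferential.D ℂ L c := by
            match_scalars; norm_num; ring
          rw [h4, h2]
          match_scalars <;> ring
        rw [div_eq_inv_mul c, mul_smul, h3, smul_smul, inv_mul_cancel₀
          (mul_ne_zero (by norm_num) hPe0), one_smul]
      · have : e ^ (b + 2) / c ^ 2 * (c / (4 * (P * e ^ 8))) ^ 2 =
            e ^ (b + 2) * ((1 / 8 : L) * 2 * (P⁻¹ * e⁻¹ ^ 8)) ^ 2 := by field_simp; norm_num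
        rw [this]
        refine R.mul_mem (R.pow_mem heR _) (R.pow_mem (R.mul_mem (R.mul_mem h8R
          (natCast_mem R 2)) (R.mul_mem ?_ (R.pow_mem ?_ _))) _)
        · rw [h.mem_iff _ (inv_ne_zero hP), h.ord_inv hP]; omega
        · rw [h.mem_iff _ (inv_ne_zero he), h.ord_inv he]; omega
  -- At infinity e⁻¹ is the parameter. Since ord c = 4 ord e, the coefficient has order (b − 4) ord
  -- e, which is nonnegative for b ≤ 4.
  · have heR : e⁻¹ ∈ R := by
      rw [h.mem_iff _ (inv_ne_zero he), h.ord_inv he]; omega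
    refine ⟨e, -KaehlerDifferential.D ℂ L e⁻¹ + (e⁻¹ * (1 / 8)) • dlog P,
      add_mem (neg_mem (D_mem_regDiff heR)) (smul_mem_latt (R.mul_mem heR h8R) hdP), ?_,
      fun b hb ↦ ?_⟩
    · rw [D_eq_smul_dlog (inv_ne_zero he), dlog_inv he]
      match_scalars <;> field_simp
    · have hx := pow_ne_zero (b + 2) he
      have hy := pow_ne_zero 2 hc0
      have hz := pow_ne_zero 2 he
      rw [h.mem_iff _ (mul_ne_zero (div_ne_zero hx hy) hz), h.ord_mul _ _ (div_ne_zero hx hy) hz,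
        h.ord_div hx hy, h.ord_pow he, h.ord_pow he, h.ord_pow hc0]
      have : ord (1 + P * e ^ 8) = 8 * ord e := by
        rw [add_comm]
        have := h.ord_add_of_lt (x := P * e ^ 8) (y := 1) hPe0 one_ne_zero
          (by rw [h.ord_one]; omega)
        omega
      push_cast
      interval_cases b <;> norm_num <;> omega

/-- The factor `C₂` at a discrete valuation where the order of `P` is not divisible by `8`. -/
lemma IsDiscrete.exists_logFactor₂ {r P A : L} (hA : A ^ 2 = r * (1 + r ^ 4 * P)) (hA0 : A ≠ 0)
    (hP : P ≠ 0) (hP8 : ¬ 8 ∣ ord P) :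
    ∃ γ m : L, γ ≠ 0 ∧ m ≠ 0 ∧ dlog r + (1 / 4 : L) • dlog P = γ • dlog m ∧
      ((0 < 4 * ord r + ord P ∧ 2 * ord A = ord r ∧ ord γ = 0) ∨
       (4 * ord r + ord P < 0 ∧ 2 * ord A = 5 * ord r + ord P ∧ ord γ = 0) ∨
       (4 * ord r + ord P = 0 ∧ ord r < 2 * ord A ∧ ord γ = 2 * ord A - ord r)) := by
  have := charZero_of_injective_algebraMap (algebraMap ℂ L).injective
  have hr : r ≠ 0 := by rintro rfl; simp [hA0] at hA
  have h1 : 1 + r ^ 4 * P ≠ 0 := by intro h; simp [hA0, h] at hA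
  have hordA : 2 * ord A = ord r + ord (1 + r ^ 4 * P) := by
    have := congrArg ord hA
    rw [h.ord_pow hA0, h.ord_mul _ _ hr h1] at this
    exact_mod_cast this
  have hq0 : r ^ 4 * P ≠ 0 := mul_ne_zero (pow_ne_zero _ hr) hP
  have hordq : ord (r ^ 4 * P) = 4 * ord r + ord P := by
    rw [h.ord_mul _ _ (pow_ne_zero _ hr) hP, h.ord_pow hr]; push_cast; ring
  by_cases hT : 4 * ord r + ord P = 0
  · have h1q : 0 ≤ ord (1 + r ^ 4 * P) :=
      h.ord_add_nonneg R.one_mem ((h.mem_iff _ hq0).mpr (by omega)) h1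
    -- If 1 + r⁴P were a unit, then ord r = 2 ord A and ord P = −4 ord r = −8 ord A, which is
    -- excluded.
    have h1q' : ord (1 + r ^ 4 * P) ≠ 0 := by omega
    have h5 : 1 + 5 * (r ^ 4 * P) ≠ 0 ∧ ord (1 + 5 * (r ^ 4 * P)) = 0 := by
      have e : 1 + 5 * (r ^ 4 * P) = -4 + 5 * (1 + r ^ 4 * P) := by ring
      rw [e]
      have o4 : ord (-4 : L) = 0 := by rw [h.ord_neg, h.ord_ofNat]
      have o5 : ord (5 * (1 + r ^ 4 * P)) = ord (1 + r ^ 4 * P) := by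
        rw [h.ord_mul _ _ (by norm_num) h1, h.ord_ofNat, zero_add]
      have := h.ord_add_of_lt (x := -4) (y := 5 * (1 + r ^ 4 * P)) (by norm_num)
        (mul_ne_zero (by norm_num) h1) (by rw [o4, o5]; omega)
      rwa [o4] at this
    have h50 := h5.1
    have h450 := mul_ne_zero (show (4 : L) ≠ 0 by norm_num) h50
    -- The witness A⁸P comes from dlog A + ⅛ dlog P = ⅛ dlog(A⁸P); γ is what `relation_dlog` then
    -- prescribes, the other factor 1 + 5r⁴P being a unit.
    refine ⟨(1 + r ^ 4 * P) / (4 * (1 + 5 * (r ^ 4 * P))), A ^ 8 * P, div_ne_zero h1 h450,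
      mul_ne_zero (pow_ne_zero _ hA0) hP, ?_, Or.inr (Or.inr ⟨hT, by omega, ?_⟩)⟩
    · have hrel := relation_dlog hA hA0 hP
      have e1 : dlog r + (1 / 4 : L) • dlog P = (2 / (1 + 5 * (r ^ 4 * P))) •
          (((1 + 5 * (r ^ 4 * P)) / 2) • (dlog r + (1 / 4 : L) • dlog P)) := by
        rw [smul_smul, div_mul_div_comm, mul_comm, div_self (mul_ne_zero h50 two_ne_zero), one_smul]
      rw [e1, ← hrel, dlog_mul (pow_ne_zero _ hA0) hP, dlog_pow hA0]
      push_cast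
      match_scalars <;> field_simp <;> norm_num
    · rw [h.ord_div h1 h450, h.ord_mul _ _ (by norm_num) h50, h.ord_ofNat]
      omega
  -- Here 1 and r⁴P have different orders, so ord A is determined, and dlog r + ¼ dlog P = ¼
  -- dlog(r⁴P).
  · refine ⟨1 / 4, r ^ 4 * P, by norm_num, hq0, ?_, ?_⟩
    · rw [dlog_mul (pow_ne_zero _ hr) hP, dlog_pow hr]
      push_cast
      match_scalars <;> field_simp
    · have o4 : ord (1 / 4 : L) = 0 := by
        rw [h.ord_div one_ne_zero (by norm_num), h.ord_one, h.ord_ofNat, sub_zero]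
      rcases lt_or_gt_of_ne hT with hneg | hpos
      · refine Or.inr (Or.inl ⟨hneg, ?_, o4⟩)
        have := h.ord_add_of_lt (x := r ^ 4 * P) (y := 1) hq0 one_ne_zero
          (by rw [h.ord_one]; omega)
        rw [add_comm] at this
        omega
      · refine Or.inl ⟨hpos, ?_, o4⟩
        have := h.ord_one_add hq0 (by omega)
        omega

end Factors

/-! ### Invariant coordinates -/

/-- The invariant functions `u₁ / u₃²`, `u₂ / u₃²`, `u₃⁸`, `v₁ / u₃`, `v₂ / u₃`, `v₃`, and the
relations between them. -/
structure QuotCoords (L : Type) [Field L] where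
  /-- `u₁ / u₃²` -/
  r₁ : L
  /-- `u₂ / u₃²` -/
  r₂ : L
  /-- `u₃⁸` -/
  P : L
  /-- `v₁ / u₃` -/
  A : L
  /-- `v₂ / u₃` -/
  B : L
  /-- `v₃` -/
  c : L
  P_ne : P ≠ 0
  A_ne : A ≠ 0
  B_ne : B ≠ 0
  c_ne : c ≠ 0
  rel₁ : A ^ 2 = r₁ * (1 + r₁ ^ 4 * P)
  rel₂ : B ^ 2 = r₂ * (1 + r₂ ^ 4 * P)
  rel₃ : c ^ 2 = 1 + P

namespace QuotCoords

variable {L : Type} [Field L] (q : QuotCoords L)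

lemma r₁_ne : q.r₁ ≠ 0 := fun h ↦ by simpa [h, q.A_ne] using q.rel₁

lemma r₂_ne : q.r₂ ≠ 0 := fun h ↦ by simpa [h, q.B_ne] using q.rel₂

/-- The image of invariant coordinates under a homomorphism of fields. -/
@[simps]
def map {M : Type} [Field M] (f : L →+* M) : QuotCoords M where
  r₁ := f q.r₁
  r₂ := f q.r₂
  P := f q.P
  A := f q.A
  B := f q.B
  c := f q.c
  P_ne := (map_ne_zero f).mpr q.P_ne
  A_ne := (map_ne_zero f).mpr q.A_ne
  B_ne := (map_ne_zero f).mpr q.B_ne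
  c_ne := (map_ne_zero f).mpr q.c_ne
  rel₁ := by simpa using congrArg f q.rel₁
  rel₂ := by simpa using congrArg f q.rel₂
  rel₃ := by simpa using congrArg f q.rel₃

/-- The coefficient of the form `form q i j`. -/
def coeff (i j : ℕ) : L :=
  64⁻¹ * (q.r₁ ^ (i + 2) * q.r₂ ^ (j + 2) * q.P ^ 2 / (q.A ^ 2 * q.B ^ 2 * q.c ^ 2))

variable [Algebra ℂ L]

/-- The differentials corresponding to `du₁ / u₁`, `du₂ / u₂`, `du₃ / u₃`. -/
def diff : Fin 3 → Ω[L⁄ℂ] :=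
  ![dlog q.r₁ + (1 / 4 : L) • dlog q.P, dlog q.r₂ + (1 / 4 : L) • dlog q.P,
    (1 / 8 : L) • dlog q.P]

/-- The bicanonical form corresponding to `u₁^i u₂^j u₃^(10 - 2i - 2j) θ^{⊗ 2}`. -/
def form (i j : ℕ) : RatForm L 3 2 :=
  q.coeff i j • PiTensorProduct.tprod L fun _ ↦ exteriorPower.ιMulti L 3 q.diff

/-- With P replaced by its unit part, re², Ae and e stand for u₁, v₁, u₃ (likewise for the second
factor), and the valuation looks unramified under Y → X. The form is then a product of three
factors, each regular on its curve. -/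
lemma mem_of_dvd {R : Subring L} {ord : L → ℤ} (h : IsDiscrete R ord) (hP8 : 8 ∣ ord q.P)
    {i j k : ℕ} (hi : i ≤ 2) (hj : j ≤ 2) (hk : k ≤ 4) (hijk : 2 * i + 2 * j + k = 10) :
    q.form i j ∈ formsOver 3 2 R R := by
  have := charZero_of_injective_algebraMap (algebraMap ℂ L).injective
  obtain ⟨t, ht, ht1⟩ := h.exists_one
  obtain ⟨l, hl⟩ := hP8
  set e := t ^ l with he
  have he0 : e ≠ 0 := zpow_ne_zero _ ht
  have heo : ord e = l := by rw [he, h.ord_zpow ht, ht1, mul_one]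
  set P := q.P / e ^ 8 with hP
  have hP0 : P ≠ 0 := div_ne_zero q.P_ne (pow_ne_zero _ he0)
  have hPo : ord P = 0 := by
    rw [hP, h.ord_div q.P_ne (pow_ne_zero _ he0), h.ord_pow he0, heo, hl]; push_cast; ring
  have hqP : q.P = P * e ^ 8 := by rw [hP]; field_simp
  have hdP : dlog q.P = dlog P + (8 : L) • dlog e := by
    rw [hqP, dlog_mul hP0 (pow_ne_zero _ he0), dlog_pow he0]; norm_num
  have hdr : ∀ r : L, r ≠ 0 → dlog (r * e ^ 2) = dlog r + (2 : L) • dlog e := fun r hr ↦ by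
    rw [dlog_mul hr (pow_ne_zero _ he0), dlog_pow he0]; norm_num
  obtain ⟨γ₁, η₁, hη₁, hU₁, hγ₁⟩ := h.exists_factor₂ (r := q.r₁ * e ^ 2) (P := P) (A := q.A * e)
    (by rw [mul_pow, q.rel₁, hqP]; ring) (mul_ne_zero q.A_ne he0) hP0 hPo
  obtain ⟨γ₂, η₂, hη₂, hU₂, hγ₂⟩ := h.exists_factor₂ (r := q.r₂ * e ^ 2) (P := P) (A := q.B * e)
    (by rw [mul_pow, q.rel₂, hqP]; ring) (mul_ne_zero q.B_ne he0) hP0 hPo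
  obtain ⟨γ₃, η₃, hη₃, hU₃, hγ₃⟩ := h.exists_factor₃ (e := e) (P := P) (c := q.c)
    (by rw [q.rel₃, hqP]) q.c_ne he0 hP0 hPo
  rw [hdr _ q.r₁_ne] at hU₁
  rw [hdr _ q.r₂_ne] at hU₂
  refine h.smul_tprod_mem (γ := ![γ₁, γ₂, γ₃]) (η := ![η₁, η₂, η₃]) ?_ ?_ ?_
  · intro i
    fin_cases i
    · change dlog q.r₁ + (1 / 4 : L) • dlog q.P = γ₁ • η₁
      rw [← hU₁, hdP]
      match_scalars <;> norm_num
    · change dlog q.r₂ + (1 / 4 : L) • dlog q.P = γ₂ • η₂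
      rw [← hU₂, hdP]
      match_scalars <;> norm_num
    · change (1 / 8 : L) • dlog q.P = γ₃ • η₃
      rw [← hU₃, hdP]
      match_scalars <;> norm_num
  · intro i
    fin_cases i
    exacts [hη₁, hη₂, hη₃]
  · have hA := q.A_ne
    have hB := q.B_ne
    have hc := q.c_ne
    have key : q.coeff i j * (∏ i, (![γ₁, γ₂, γ₃] : Fin 3 → L) i) ^ 2 = 64⁻¹ * P ^ 2 *
        ((q.r₁ * e ^ 2) ^ (i + 2) / (q.A * e) ^ 2 * γ₁ ^ 2) *
        ((q.r₂ * e ^ 2) ^ (j + 2) / (q.B * e) ^ 2 * γ₂ ^ 2) *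
        (e ^ (k + 2) / q.c ^ 2 * γ₃ ^ 2) := by
      -- The exponent is 2(i + 2) + 2(j + 2) + (k + 2) = 20; the factor P² of the coefficient
      -- accounts for e¹⁶ and the denominator A²B² for e⁴.
      have hexp : (e ^ 2) ^ (i + 2) * (e ^ 2) ^ (j + 2) * e ^ (k + 2) = e ^ 16 * e ^ 4 := by
        rw [← pow_mul, ← pow_mul, ← pow_add, ← pow_add, ← pow_add]
        congr 1
        omega
      rw [coeff, hqP]
      simp only [Fin.prod_univ_three, Matrix.cons_val]
      rw [mul_pow q.r₁, mul_pow q.r₂]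
      have e1 : 64⁻¹ * P ^ 2 * (q.r₁ ^ (i + 2) * (e ^ 2) ^ (i + 2) / (q.A * e) ^ 2 * γ₁ ^ 2) *
          (q.r₂ ^ (j + 2) * (e ^ 2) ^ (j + 2) / (q.B * e) ^ 2 * γ₂ ^ 2) *
          (e ^ (k + 2) / q.c ^ 2 * γ₃ ^ 2) =
          64⁻¹ * P ^ 2 * q.r₁ ^ (i + 2) * q.r₂ ^ (j + 2) * (γ₁ * γ₂ * γ₃) ^ 2 *
          ((e ^ 2) ^ (i + 2) * (e ^ 2) ^ (j + 2) * e ^ (k + 2)) /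
          ((q.A * e) ^ 2 * (q.B * e) ^ 2 * q.c ^ 2) := by
        ring
      rw [e1, hexp]
      field_simp
    rw [key]
    refine R.mul_mem (R.mul_mem (R.mul_mem (R.mul_mem ?_ (R.pow_mem ?_ _)) (hγ₁ i hi))
      (hγ₂ j hj)) (hγ₃ k hk)
    · have := h.const_mem (64⁻¹ : ℂ)
      rwa [map_inv₀, map_ofNat] at this
    · rw [h.mem_iff _ hP0]; omega

/-- Logarithmic poles are allowed, so only the order of the coefficient matters. Each factor C₂ has
three regimes, according to the sign of 4 ord r + ord P, and in all nine combinations the order is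
at least 2. -/
lemma mem_of_not_dvd {R : Subring L} {ord : L → ℤ} (h : IsDiscrete R ord) (hP8 : ¬ 8 ∣ ord q.P)
    {i j : ℕ} (hij : (i = 2 ∧ j = 2) ∨ (i = 1 ∧ j = 2) ∨ (i = 2 ∧ j = 1)) :
    q.form i j ∈ formsOver 3 2 R R := by
  have := charZero_of_injective_algebraMap (algebraMap ℂ L).injective
  obtain ⟨γ₁, m₁, hγ₁, hm₁, hU₁, H₁⟩ := h.exists_logFactor₂ q.rel₁ q.A_ne q.P_ne hP8
  obtain ⟨γ₂, m₂, hγ₂, hm₂, hU₂, H₂⟩ := h.exists_logFactor₂ q.rel₂ q.B_ne q.P_ne hP8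
  refine h.smul_tprod_dlog_mem (γ := ![γ₁, γ₂, 1 / 8]) (m := ![m₁, m₂, q.P]) ?_ ?_ ?_
  · intro i
    fin_cases i
    exacts [hU₁, hU₂, rfl]
  · intro i
    fin_cases i
    exacts [hm₁, hm₂, q.P_ne]
  · have hA := q.A_ne
    have hB := q.B_ne
    have hc := q.c_ne
    have hP := q.P_ne
    have hr₁ := q.r₁_ne
    have hr₂ := q.r₂_ne
    have hordc : 2 * ord q.c = min 0 (ord q.P) := by
      have e1 : 2 * ord q.c = ord (1 + q.P) := by
        rw [← q.rel₃, h.ord_pow hc]; norm_num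
      rcases lt_trichotomy (ord q.P) 0 with h0 | h0 | h0
      · have := h.ord_add_of_lt (x := q.P) (y := 1) hP one_ne_zero (by rw [h.ord_one]; omega)
        rw [add_comm] at this
        omega
      · omega
      · have := h.ord_one_add hP h0
        omega
    have o8 : ord (1 / 8 : L) = 0 := by
      rw [h.ord_div one_ne_zero (by norm_num), h.ord_one, h.ord_ofNat, sub_zero]
    have o64 : ord (64⁻¹ : L) = 0 := by
      rw [h.ord_inv (by norm_num), h.ord_ofNat, neg_zero]
    have hord : ord (q.coeff i j * (∏ i, (![γ₁, γ₂, 1 / 8] : Fin 3 → L) i) ^ 2) =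
        (i + 2 : ℤ) * ord q.r₁ + (j + 2 : ℤ) * ord q.r₂ + 2 * ord q.P - 2 * ord q.A - 2 * ord q.B
          - 2 * ord q.c + 2 * ord γ₁ + 2 * ord γ₂ := by
      have n1 := pow_ne_zero (i + 2) hr₁
      have n2 := pow_ne_zero (j + 2) hr₂
      have n3 := pow_ne_zero 2 hP
      have n4 := pow_ne_zero 2 hA
      have n5 := pow_ne_zero 2 hB
      have n6 := pow_ne_zero 2 hc
      have n7 : (1 / 8 : L) ≠ 0 := by norm_num
      have n8 : (64⁻¹ : L) ≠ 0 := by norm_num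
      simp only [coeff, Fin.prod_univ_three, Matrix.cons_val]
      rw [h.ord_mul _ _ (mul_ne_zero n8 (div_ne_zero (mul_ne_zero (mul_ne_zero n1 n2) n3)
          (mul_ne_zero (mul_ne_zero n4 n5) n6))) (pow_ne_zero _ (mul_ne_zero (mul_ne_zero hγ₁ hγ₂)
          n7)), h.ord_mul _ _ n8 (div_ne_zero (mul_ne_zero (mul_ne_zero n1 n2) n3)
          (mul_ne_zero (mul_ne_zero n4 n5) n6)), h.ord_div (mul_ne_zero (mul_ne_zero n1 n2) n3)
          (mul_ne_zero (mul_ne_zero n4 n5) n6), h.ord_mul _ _ (mul_ne_zero n1 n2) n3,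
        h.ord_mul _ _ n1 n2, h.ord_mul _ _ (mul_ne_zero n4 n5) n6, h.ord_mul _ _ n4 n5,
        h.ord_pow hr₁, h.ord_pow hr₂, h.ord_pow hP, h.ord_pow hA, h.ord_pow hB, h.ord_pow hc,
        h.ord_pow (mul_ne_zero (mul_ne_zero hγ₁ hγ₂) n7), h.ord_mul _ _ (mul_ne_zero hγ₁ hγ₂) n7,
        h.ord_mul _ _ hγ₁ hγ₂, o8, o64]
      push_cast
      ring
    rw [hord]
    rcases hij with ⟨rfl, rfl⟩ | ⟨rfl, rfl⟩ | ⟨rfl, rfl⟩ <;>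
    rcases H₁ with ⟨a1, a2, a3⟩ | ⟨a1, a2, a3⟩ | ⟨a1, a2, a3⟩ <;>
    rcases H₂ with ⟨b1, b2, b3⟩ | ⟨b1, b2, b3⟩ | ⟨b1, b2, b3⟩ <;>
    push_cast <;>
    first
    | omega
    -- Separating the small negative values of ord P and the signs of ord r₁ and ord r₂ brings the
    -- remaining integer inequalities within reach of linear arithmetic.
    | have hcases : ord q.P ≤ -5 ∨ ord q.P = -4 ∨ ord q.P = -3 ∨ ord q.P = -2 ∨ ord q.P = -1 ∨
        0 ≤ ord q.P := by omega
      have h₁ : ord q.r₁ ≤ -1 ∨ 0 ≤ ord q.r₁ := by omega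
      have h₂ : ord q.r₂ ≤ -1 ∨ 0 ≤ ord q.r₂ := by omega
      rcases hcases with hp | hp | hp | hp | hp | hp <;> rcases h₁ with h₁ | h₁ <;>
        rcases h₂ with h₂ | h₂ <;> omega

/-- The invariant bicanonical forms are regular at every discrete valuation. -/
theorem form_mem {R : Subring L} {ord : L → ℤ} (h : IsDiscrete R ord)
    {i j : ℕ} (hij : (i = 2 ∧ j = 2) ∨ (i = 1 ∧ j = 2) ∨ (i = 2 ∧ j = 1)) :
    q.form i j ∈ formsOver 3 2 R R := by
  by_cases hP8 : 8 ∣ ord q.P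
  · rcases hij with ⟨rfl, rfl⟩ | ⟨rfl, rfl⟩ | ⟨rfl, rfl⟩
    · exact q.mem_of_dvd h hP8 (k := 2) (by norm_num) (by norm_num) (by norm_num) (by norm_num)
    · exact q.mem_of_dvd h hP8 (k := 4) (by norm_num) (by norm_num) (by norm_num) (by norm_num)
    · exact q.mem_of_dvd h hP8 (k := 4) (by norm_num) (by norm_num) (by norm_num) (by norm_num)
  · exact q.mem_of_not_dvd h hP8 hij

end QuotCoords

/-! ### Commutative algebra -/

section CommAlg

/-- The discrete valuation of a discrete valuation ring. -/
lemma exists_isDiscrete {O K : Type} [CommRing O] [IsDomain O] [IsDiscreteValuationRing O]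
    [Field K] [Algebra O K] [IsFractionRing O K] [Algebra ℂ K]
    (hc : ∀ c : ℂ, algebraMap ℂ K c ∈ (algebraMap O K).range) :
    ∃ ord : K → ℤ, IsDiscrete (algebraMap O K).range ord := by
  let v := (IsDiscreteValuationRing.maximalIdeal O).valuation K
  -- The sign turns the multiplicative valuation, which is at most 1 on the ring, into an order with
  -- value 1 on a uniformizer.
  refine ⟨fun x ↦ -WithZero.log (v x), hc, fun x y hx hy ↦ ?_, fun x hx ↦ ?_, ?_⟩
  · rw [map_mul, WithZero.log_mul ((map_ne_zero v).mpr hx) ((map_ne_zero v).mpr hy)]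
    ring
  · have h0 : v x ≠ 0 := (map_ne_zero v).mpr hx
    have e : 0 ≤ -WithZero.log (v x) ↔ v x ≤ 1 := by
      rw [← WithZero.log_le_log h0 one_ne_zero, WithZero.log_one]
      omega
    rw [e]
    constructor
    · rintro ⟨a, rfl⟩
      exact IsDedekindDomain.HeightOneSpectrum.valuation_le_one _ a
    · intro h
      exact IsDiscreteValuationRing.exists_lift_of_le_one h
  · obtain ⟨t, ht⟩ := (IsDiscreteValuationRing.maximalIdeal O).valuation_exists_uniformizer K
    refine ⟨t, ?_, ?_⟩
    · rintro rfl
      rw [map_zero] at ht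
      exact WithZero.exp_ne_zero ht.symm
    · rw [show v t = _ from ht, WithZero.log_exp]
      norm_num

lemma isDiscreteValuationRing_of_krullDim {O : Type} [CommRing O] [IsDomain O] [IsLocalRing O]
    [IsNoetherianRing O] [IsIntegrallyClosed O] (hd : ringKrullDim O = 1) :
    IsDiscreteValuationRing O := by
  have hf : ¬ IsField O := fun h ↦ by
    rw [ringKrullDim_eq_zero_of_isField h] at hd
    exact zero_ne_one hd
  refine ((IsDiscreteValuationRing.TFAE O hf).out 2 0).mp ?_
  have : Ring.KrullDimLE 1 O := by
    rw [Ring.krullDimLE_iff, hd]; rfl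
  have : Ring.DimensionLEOne O :=
    ⟨fun {p} hp hpp ↦
      Ring.krullDimLE_one_iff_of_noZeroDivisors.mp inferInstance p hp hpp⟩
  exact { (inferInstance : IsDomain O), (inferInstance : IsNoetherianRing O), this,
    (inferInstance : IsIntegrallyClosed O) with }

/-- An element of the fraction field of a noetherian normal domain that is integral at all primes
of height one belongs to the domain. -/
lemma mem_range_of_height_one {A K : Type} [CommRing A] [IsDomain A] [IsNoetherianRing A]
    [IsIntegrallyClosed A] [Field K] [Algebra A K] [IsFractionRing A K] {f : K}
    (hf : ∀ p : Ideal A, p.IsPrime → p.height = 1 →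
      ∃ s, s ∉ p ∧ algebraMap A K s * f ∈ (algebraMap A K).range) :
    f ∈ (algebraMap A K).range := by
  by_contra hfA
  let N : Submodule A K := LinearMap.range (Algebra.linearMap A K)
  have hN : ∀ x : K, x ∈ N ↔ x ∈ (algebraMap A K).range := fun x ↦ Iff.rfl
  let M : Submodule A (K ⧸ N) := Submodule.span A {N.mkQ f}
  have hMf : N.mkQ f ≠ 0 := fun h ↦ hfA ((hN f).mp ((Submodule.Quotient.mk_eq_zero N).mp h))
  have : Nontrivial M := ⟨⟨⟨N.mkQ f, Submodule.mem_span_singleton_self _⟩, 0,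
    fun h ↦ hMf (congrArg Subtype.val h)⟩⟩
  -- An associated prime of the submodule generated by f in K/A is the ideal of denominators p = (A
  -- : g) of some multiple g = df that is not in A.
  obtain ⟨p, hp⟩ := associatedPrimes.nonempty A M
  obtain ⟨hp, ⟨y, hy⟩, hpy⟩ := isAssociatedPrime_iff.mp hp
  obtain ⟨d, rfl⟩ := Submodule.mem_span_singleton.mp hy
  have hmem : ∀ a : A, a ∈ p ↔ algebraMap A K a * (algebraMap A K d * f) ∈
      (algebraMap A K).range := by
    intro a
    rw [hpy, ← hN, ← Submodule.Quotient.mk_eq_zero N]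
    have e : (Submodule.Quotient.mk (algebraMap A K a * (algebraMap A K d * f)) : K ⧸ N) =
        a • d • N.mkQ f := by
      rw [← Algebra.smul_def, ← Algebra.smul_def]; rfl
    rw [e]
    have : a ∈ (⊥ : Submodule A M).colon {(⟨d • N.mkQ f, hy⟩ : M)} ↔ a • d • N.mkQ f = 0 := by
      rw [Submodule.mem_colon_singleton, Submodule.mem_bot, Subtype.ext_iff]
      rfl
    exact this
  set g := algebraMap A K d * f with hg
  have hgA : g ∉ (algebraMap A K).range := fun h ↦ hp.ne_top
    ((Ideal.eq_top_iff_one p).mpr ((hmem 1).mpr (by simpa using h)))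
  have hp0 : p ≠ ⊥ := by
    obtain ⟨⟨a, s⟩, hs⟩ := IsLocalization.surj (nonZeroDivisors A) g
    intro h0
    have : (s : A) ∈ p := (hmem s).mpr ⟨a, by rw [← hs, mul_comm]⟩
    rw [h0] at this
    exact nonZeroDivisors.coe_ne_zero s this
  -- If gp ⊆ p, then g is integral because p is a finitely generated nonzero module, and normality
  -- puts g in A. So xg = s ∉ p for some x ∈ p.
  have hex : ∃ x ∈ p, ∃ s : A, s ∉ p ∧ algebraMap A K s = algebraMap A K x * g := by
    by_contra! hcon
    refine hgA (IsIntegrallyClosed.isIntegral_iff.mp ?_)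
    let I : Submodule A K := Submodule.map (Algebra.linearMap A K) p
    refine isIntegral_of_smul_mem_submodule I ?_ ((IsNoetherian.noetherian p).map _) g ?_
    · obtain ⟨a, ha, ha0⟩ := Submodule.exists_mem_ne_zero_of_ne_bot hp0
      refine (Submodule.ne_bot_iff _).mpr ⟨algebraMap A K a, ⟨a, ha, rfl⟩, ?_⟩
      simpa using ha0
    · rintro _ ⟨x, hx, rfl⟩
      obtain ⟨s, hs⟩ := (hmem x).mp hx
      refine ⟨s, ?_, ?_⟩
      · by_contra hsp
        exact hcon x hx s hsp hs
      · rw [smul_eq_mul, mul_comm]; exact hs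
  obtain ⟨x, hx, s, hs, hsx⟩ := hex
  -- For y ∈ p with yg = b in A, ys = bx lies in (x); as s ∉ p, every prime between (x) and p
  -- contains y. Krull's theorem then gives height one.
  have hmin : p ∈ (Ideal.span {x}).minimalPrimes := by
    refine ⟨⟨hp, (Ideal.span_singleton_le_iff_mem p).mpr hx⟩, fun q hq hqp y hy ↦ ?_⟩
    obtain ⟨b, hb⟩ := (hmem y).mp hy
    have : y * s = b * x := by
      apply IsFractionRing.injective A K
      rw [map_mul, map_mul, hsx, hb]
      ring
    have hmul : y * s ∈ q := by
      rw [this]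
      exact q.mul_mem_left _ (hq.2 (Ideal.mem_span_singleton_self x))
    exact (hq.1.mem_or_mem hmul).resolve_right fun h ↦ hs (hqp h)
  have hle := Ideal.height_le_one_of_isPrincipal_of_mem_minimalPrimes _ p hmin
  have hne : p.height ≠ 0 := fun h ↦ hp0 (by
    rwa [Ideal.height_eq_zero_iff, IsDomain.minimalPrimes_eq_singleton_bot,
      Set.mem_singleton_iff] at h)
  have hone : p.height = 1 := le_antisymm hle (Order.one_le_iff_ne_zero.mpr hne)
  obtain ⟨s', hs', b, hb⟩ := hf p hp hone
  refine hs' ((hmem s').mpr ⟨d * b, ?_⟩)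
  rw [map_mul, hb, hg]
  ring

end CommAlg

/-! ### Products of domains over ℂ -/

section Tensor

open scoped TensorProduct

/-- A finitely generated domain over `ℂ` has enough complex points. -/
lemma exists_algHom_ne_zero {A : Type} [CommRing A] [IsDomain A] [Algebra ℂ A]
    [Algebra.FiniteType ℂ A] {a : A} (ha : a ≠ 0) : ∃ φ : A →ₐ[ℂ] ℂ, φ a ≠ 0 := by
  let B := Localization.Away a
  have : IsDomain B := IsLocalization.Away.isDomain B ha
  have : Algebra.FiniteType A B := IsLocalization.finiteType_of_monoid_fg (Submonoid.powers a) B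
  have : Algebra.FiniteType ℂ B := Algebra.FiniteType.trans (S := A) inferInstance inferInstance
  obtain ⟨m, hm⟩ := Ideal.exists_maximal B
  let : Field (B ⧸ m) := Ideal.Quotient.field m
  have : Algebra.FiniteType ℂ (B ⧸ m) :=
    Algebra.FiniteType.of_surjective (Ideal.Quotient.mkₐ ℂ m) (Ideal.Quotient.mkₐ_surjective ℂ m)
  -- By the Nullstellensatz the residue field of a maximal ideal of A[1/a] is ℂ; at that point a is
  -- invertible.
  have : Module.Finite ℂ (B ⧸ m) := finite_of_finite_type_of_isJacobsonRing ℂ (B ⧸ m)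
  have hbij : Function.Bijective (algebraMap ℂ (B ⧸ m)) :=
    IsAlgClosed.algebraMap_bijective_of_isIntegral
  let e : ℂ ≃ₐ[ℂ] (B ⧸ m) := AlgEquiv.ofBijective (Algebra.ofId ℂ (B ⧸ m)) hbij
  let ψ : B →ₐ[ℂ] ℂ := e.symm.toAlgHom.comp (Ideal.Quotient.mkₐ ℂ m)
  refine ⟨ψ.comp (IsScalarTower.toAlgHom ℂ A B), ?_⟩
  have : IsUnit (algebraMap A B a) := IsLocalization.Away.algebraMap_isUnit a
  exact (this.map ψ).ne_zero

/-- The tensor product of domains over `ℂ` is a domain. -/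
lemma isDomain_tensorProduct (A B : Type) [CommRing A] [IsDomain A] [Algebra ℂ A]
    [Algebra.FiniteType ℂ A] [CommRing B] [IsDomain B] [Algebra ℂ B] : IsDomain (A ⊗[ℂ] B) := by
  have : Nontrivial (A ⊗[ℂ] B) := by
    obtain ⟨φ, -⟩ := exists_algHom_ne_zero (one_ne_zero (α := A))
    exact (Algebra.TensorProduct.lmul' ℂ (S := B)).toRingHom.comp
      (Algebra.TensorProduct.map ((Algebra.ofId ℂ B).comp φ) (AlgHom.id ℂ B)).toRingHom |>.domain_nontrivial
  let b := Module.Basis.ofVectorSpace ℂ B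
  let bA := b.baseChange A
  -- Specializing A at a complex point maps A ⊗ B to B and evaluates the coefficients in a basis of
  -- B. A point where a coefficient of x and one of y are both nonzero sends xy = 0 to a product of
  -- two nonzero elements of B.
  have key : ∀ (φ : A →ₐ[ℂ] ℂ) (x : A ⊗[ℂ] B) (i),
      φ (bA.repr x i) = b.repr (Algebra.TensorProduct.lift ((Algebra.ofId ℂ B).comp φ)
        (AlgHom.id ℂ B) (fun _ _ ↦ Commute.all _ _) x) i := by
    intro φ x i
    induction x with
    | zero => simp
    | add x y hx hy => simp only [map_add, Finsupp.add_apply, hx, hy]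
    | tmul x y =>
      simp only [bA, Module.Basis.baseChange_repr_tmul, Algebra.TensorProduct.lift_tmul,
        AlgHom.comp_apply, AlgHom.id_apply, Algebra.ofId_apply, ← Algebra.smul_def, map_smul,
        Finsupp.smul_apply, smul_eq_mul]
      rw [mul_comm]
  have : NoZeroDivisors (A ⊗[ℂ] B) := by
    refine ⟨fun {x y} hxy ↦ ?_⟩
    by_contra! hcon
    obtain ⟨i, hi⟩ : ∃ i, bA.repr x i ≠ 0 := by
      by_contra! h
      exact hcon.1 (bA.repr.map_eq_zero_iff.mp (Finsupp.ext h))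
    obtain ⟨j, hj⟩ : ∃ j, bA.repr y j ≠ 0 := by
      by_contra! h
      exact hcon.2 (bA.repr.map_eq_zero_iff.mp (Finsupp.ext h))
    obtain ⟨φ, hφ⟩ := exists_algHom_ne_zero (mul_ne_zero hi hj)
    rw [map_mul, key, key] at hφ
    have h0 := congrArg (Algebra.TensorProduct.lift ((Algebra.ofId ℂ B).comp φ)
        (AlgHom.id ℂ B) (fun _ _ ↦ Commute.all _ _)) hxy
    rw [map_mul, map_zero] at h0
    rcases mul_eq_zero.mp h0 with h | h <;> rw [h] at hφ <;> simp at hφ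
  exact NoZeroDivisors.to_isDomain _

end Tensor

/-! ### Normality of étale extensions -/

section Smooth

open scoped TensorProduct

/-- An étale domain over a normal domain is normal. -/
lemma isIntegrallyClosed_of_etale {P S : Type} [CommRing P] [IsDomain P] [IsIntegrallyClosed P]
    [CommRing S] [IsDomain S] [Algebra P S] [Algebra.Etale P S] : IsIntegrallyClosed S := by
  let Q := FractionRing P
  have hinj : Function.Injective (algebraMap P S) := by
    have : Module.Flat P S := inferInstance
    exact FaithfulSMul.algebraMap_injective P S
  have hM : Algebra.algebraMapSubmonoid S (nonZeroDivisors P) ≤ nonZeroDivisors S := by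
    rintro _ ⟨x, hx, rfl⟩
    exact mem_nonZeroDivisors_of_ne_zero ((map_ne_zero_iff _ hinj).mpr
      (nonZeroDivisors.ne_zero hx))
  have hloc : IsLocalization (Algebra.algebraMapSubmonoid S (nonZeroDivisors P)) (S ⊗[P] Q) :=
    IsLocalization.tensor Q (nonZeroDivisors P)
  have hdom : IsDomain (S ⊗[P] Q) := IsLocalization.isDomain_of_le_nonZeroDivisors _ hM
  have hdom' : IsDomain (Q ⊗[P] S) := (Algebra.TensorProduct.comm P Q S).toMulEquiv.isDomain _
  -- The generic fibre is a domain, finite over the field Q, hence a field; so it is the fraction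
  -- field of S.
  have : Module.Finite Q (Q ⊗[P] S) := Algebra.FormallyUnramified.finite_of_free Q (Q ⊗[P] S)
  have hfield : IsField (Q ⊗[P] S) := isField_of_isIntegral_of_isField' (Field.toIsField Q)
  have hfield' : IsField (S ⊗[P] Q) :=
    MulEquiv.isField hfield (Algebra.TensorProduct.comm P S Q).toMulEquiv
  let : Field (S ⊗[P] Q) := hfield'.toField
  have hfrac : IsFractionRing S (S ⊗[P] Q) := by
    refine IsFractionRing.of_field _ _ fun z ↦ ?_
    obtain ⟨⟨a, s⟩, hs⟩ := IsLocalization.surj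
      (Algebra.algebraMapSubmonoid S (nonZeroDivisors P)) z
    have hs0 : algebraMap S (S ⊗[P] Q) s ≠ 0 :=
      (IsLocalization.map_units (S ⊗[P] Q) s).ne_zero
    exact ⟨a, s, eq_div_of_mul_eq hs0 hs⟩
  rw [isIntegrallyClosed_iff_isIntegrallyClosedIn (S ⊗[P] Q)]
  -- Integral closure commutes with smooth base change: the integral closure of S in S ⊗ Q is S
  -- tensored with the integral closure of P in Q, which is P.
  have hb := TensorProduct.toIntegralClosure_bijective_of_smooth (R := P) (S := S) (B := Q)
  rw [isIntegrallyClosedIn_iff]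
  refine ⟨IsLocalization.injective _ hM, fun {x} hx ↦ ?_⟩
  obtain ⟨y, hy⟩ := hb.2 ⟨x, hx⟩
  have hx' : x = Algebra.TensorProduct.map (AlgHom.id P S) (integralClosure P Q).val y :=
    (congrArg Subtype.val hy).symm
  rw [hx']
  clear hx' hy hx x
  induction y with
  | zero => exact ⟨0, by simp⟩
  | add a b ha hb =>
    obtain ⟨x, hx⟩ := ha
    obtain ⟨y, hy⟩ := hb
    exact ⟨x + y, by rw [map_add, map_add, hx, hy]⟩
  | tmul s q =>
    obtain ⟨p, hp⟩ := IsIntegrallyClosed.isIntegral_iff.mp q.2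
    refine ⟨s * algebraMap P S p, ?_⟩
    rw [Algebra.TensorProduct.map_tmul, AlgHom.id_apply, Subalgebra.coe_val, ← hp,
      ← mul_one (algebraMap P Q p), ← Algebra.smul_def, TensorProduct.tmul_smul,
      TensorProduct.smul_tmul', Algebra.smul_def, mul_comm]
    rfl

end Smooth

/-! ### Normal schemes -/

section CommAlgGoingDown

/-- Going down holds for an integral extension of a normal domain, so the contracted height is at
most that of P; it is positive because a nonzero prime of an integral extension of domains contracts
to a nonzero prime. -/
lemma height_comap_eq_one {A B : Type} [CommRing A] [IsDomain A] [IsIntegrallyClosed A]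
    [CommRing B] [IsDomain B] [IsNoetherianRing A] {f : A →+* B} (hf : f.Finite)
    (hinj : Function.Injective f) (P : Ideal B) [P.IsPrime] (hP : P.height = 1) :
    (P.comap f).height = 1 := by
  algebraize [f]
  have : FaithfulSMul A B := (faithfulSMul_iff_algebraMap_injective A B).mpr hinj
  have : Module.Finite A B := hf
  have : IsNoetherianRing B := IsNoetherianRing.of_finite A B
  have : P.LiesOver (P.comap f) := ⟨rfl⟩
  have h := Ideal.height_eq_height_add_of_liesOver_of_hasGoingDown (P.comap f) P
  rw [hP] at h
  refine le_antisymm (h ▸ le_self_add) (Order.one_le_iff_ne_zero.mpr fun h0 ↦ ?_)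
  rw [Ideal.height_eq_zero_iff, IsDomain.minimalPrimes_eq_singleton_bot,
    Set.mem_singleton_iff] at h0
  have : P = ⊥ := Ideal.eq_bot_of_comap_eq_bot (R := A) h0
  rw [this, Ideal.height_bot] at hP
  exact zero_ne_one hP

end CommAlgGoingDown

lemma height_primeIdealOf {X : Scheme.{0}} {U : X.Opens} (hU : IsAffineOpen U) (x : U) :
    (hU.primeIdealOf x).asIdeal.height = Order.coheight (x : X) := by
  refine (idealHeight_eq_coheight Γ(X, U) _).trans
    ((coheight_eq_of_isOpenImmersion hU.fromSpec).symm.trans ?_)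
  exact congrArg Order.coheight (hU.fromSpec_primeIdealOf x)

lemma exists_isAffineOpen_mem {X : Scheme.{0}} {V : X.Opens} {x : X} (hx : x ∈ V) :
    ∃ U : X.Opens, IsAffineOpen U ∧ x ∈ U ∧ U ≤ V := by
  obtain ⟨_, ⟨U, hU, rfl⟩, hxU, hle⟩ :=
    X.isBasis_affineOpens.exists_subset_of_mem_open hx V.isOpen
  exact ⟨U, hU, hxU, hle⟩

/-- The localizations at maximal ideals are stalks, and being integrally closed can be checked on
them. -/
lemma IsNormalScheme.isIntegrallyClosed {X : Scheme.{0}} [IsIntegral X] (h : IsNormalScheme X)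
    {U : X.Opens} (hU : IsAffineOpen U) [Nonempty U] : IsIntegrallyClosed Γ(X, U) := by
  refine IsIntegrallyClosed.of_localization_maximal fun P _ hP ↦ ?_
  have hx : hU.fromSpec ⟨P, inferInstance⟩ ∈ U :=
    hU.range_fromSpec.subset (Set.mem_range_self _)
  let x : U := ⟨_, hx⟩
  have hxP : hU.primeIdealOf x = ⟨P, inferInstance⟩ :=
    hU.fromSpec.isOpenEmbedding.injective (hU.fromSpec_primeIdealOf x)
  let := X.presheaf.algebra_section_stalk x
  have hloc : IsLocalization P.primeCompl (X.presheaf.stalk (x : X)) := by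
    have := hU.isLocalization_stalk x
    rwa [hxP] at this
  have := h x
  exact IsIntegrallyClosed.of_equiv
    (IsLocalization.algEquiv P.primeCompl (X.presheaf.stalk (x : X))
      (Localization.AtPrime P)).toRingEquiv

lemma isNormalScheme_of_forall {X : Scheme.{0}} [IsIntegral X]
    (h : ∀ x : X, ∃ U : X.Opens, IsAffineOpen U ∧ x ∈ U ∧ IsIntegrallyClosed Γ(X, U)) :
    IsNormalScheme X := by
  intro x
  obtain ⟨U, hU, hxU, hc⟩ := h x
  have : Nonempty U := ⟨⟨x, hxU⟩⟩
  let := X.presheaf.algebra_section_stalk ⟨x, hxU⟩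
  have := hU.isLocalization_stalk ⟨x, hxU⟩
  exact isIntegrallyClosed_of_isLocalization _
    (hU.primeIdealOf ⟨x, hxU⟩).asIdeal.primeCompl (Ideal.primeCompl_le_nonZeroDivisors _)

lemma isLocallyNoetherian_of_locallyOfFiniteType {X : Scheme.{0}} (f : X ⟶ SpecC)
    [LocallyOfFiniteType f] : IsLocallyNoetherian X :=
  LocallyOfFiniteType.isLocallyNoetherian f

/-- Locally a smooth scheme over ℂ is étale over a polynomial ring over a field, and étale domains
over a normal domain are normal. -/
lemma isNormalScheme_of_smooth {X : Scheme.{0}} [IsIntegral X] (f : X ⟶ SpecC) [Smooth f] :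
    IsNormalScheme X := by
  refine isNormalScheme_of_forall fun x ↦ ?_
  obtain ⟨U, hU, V, hV, hxV, e, hs⟩ := Smooth.exists_isStandardSmooth f x
  refine ⟨V, hV, hxV, ?_⟩
  have : Nonempty V := ⟨⟨x, hxV⟩⟩
  -- The spectrum of ℂ is a single point, so the nonempty open set U is everything and its ring of
  -- functions is a field.
  have hUtop : U = ⊤ := by
    ext y
    simpa [Subsingleton.elim y (f x)] using e hxV
  have hfield : IsField Γ(SpecC, U) := by
    rw [hUtop]; exact isField_of_isIntegral_of_subsingleton _
  let : Field Γ(SpecC, U) := hfield.toField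
  obtain ⟨n, g, -, hg⟩ := hs.exists_etale_mvPolynomial
  algebraize [g]
  exact isIntegrallyClosed_of_etale (P := MvPolynomial (Fin n) Γ(SpecC, U))

/-- The local rings of a normal variety at points of codimension one are discrete valuation
rings. -/
lemma exists_isDiscrete_localRing {X : Over SpecC} [IsIntegral X.left]
    [IsLocallyNoetherian X.left] (hX : IsNormalScheme X.left) {x : X.left}
    (hx : Order.coheight x = 1) : ∃ ord, IsDiscrete (localRing X x) ord := by
  have := hX x
  have := isDiscreteValuationRing_of_krullDim (O := X.left.presheaf.stalk x)
    (by rw [ringKrullDim_stalk_eq_coheight, hx]; rfl)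
  refine exists_isDiscrete fun c ↦ ⟨constants X x c, ?_⟩
  exact constants_stalkSpecializes _ c

/-- This reduces to going down on an affine open set. It makes valuations of the normalized base
change lie over valuations of X'. -/
lemma coheight_map_eq_one {W X : Scheme.{0}} [IsIntegral W] [IsIntegral X] [IsLocallyNoetherian X]
    (hX : IsNormalScheme X) (f : W ⟶ X) [IsFinite f] [IsDominant f] {w : W}
    (hw : Order.coheight w = 1) : Order.coheight (f w) = 1 := by
  obtain ⟨U, hU, hwU, -⟩ := exists_isAffineOpen_mem (V := ⊤) (x := f w) trivial
  have : Nonempty U := ⟨⟨f w, hwU⟩⟩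
  have : Nonempty (f ⁻¹ᵁ U) := ⟨⟨w, hwU⟩⟩
  have hV : IsAffineOpen (f ⁻¹ᵁ U) := hU.preimage f
  have hfin : (f.app U).hom.Finite := IsFinite.finite_app f U hU
  have hinj : Function.Injective (f.app U).hom := by
    have := IsSchemeTheoreticallyDominant.of_isDominant f
    exact f.app_injective U
  have := hX.isIntegrallyClosed hU
  have : IsNoetherianRing Γ(X, U) := IsLocallyNoetherian.component_noetherian ⟨U, hU⟩
  have h := height_comap_eq_one hfin hinj (hV.primeIdealOf ⟨w, hwU⟩).asIdeal
    ((height_primeIdealOf hV ⟨w, hwU⟩).trans hw)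
  have e := IsAffineOpen.comap_primeIdealOf_appLE U hU (f ⁻¹ᵁ U) hV le_rfl (x := w) hwU
  rw [← height_primeIdealOf hU ⟨f w, hwU⟩, ← e]
  rw [← h, Scheme.Hom.app_eq_appLE]
  rfl

/-! ### Regular functions -/

section Regular

variable {X : Over SpecC} [IsIntegral X.left]

lemma genericPoint_mem {T : Scheme.{0}} [IrreducibleSpace T] {U : T.Opens} {x : T} (hx : x ∈ U) :
    genericPoint T ∈ U :=
  ((genericPoint_spec T).mem_open_set_iff U.isOpen).mpr ⟨x, trivial, hx⟩

lemma germ_mem_localRing {U : X.left.Opens} {x : X.left} (hx : x ∈ U) (s : Γ(X.left, U)) :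
    X.left.presheaf.germ U (genericPoint X.left) (genericPoint_mem hx) s ∈ localRing X x := by
  have : Nonempty U := ⟨⟨x, hx⟩⟩
  exact ⟨X.left.presheaf.germ U x hx s, Scheme.algebraMap_germ_eq_germToFunctionField X.left hx s⟩

lemma exists_germ_eq_of_mem_localRing {x : X.left} {f : X.left.functionField}
    (hf : f ∈ localRing X x) : ∃ (U : X.left.Opens) (hx : x ∈ U) (s : Γ(X.left, U)),
      X.left.presheaf.germ U (genericPoint X.left) (genericPoint_mem hx) s = f := by
  obtain ⟨a, rfl⟩ := hf
  obtain ⟨U, hx, s, rfl⟩ := X.left.presheaf.exists_germ_eq a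
  have : Nonempty U := ⟨⟨x, hx⟩⟩
  exact ⟨U, hx, s, (Scheme.algebraMap_germ_eq_germToFunctionField X.left hx s).symm⟩

/-- A rational function that is regular at every point is a global section. -/
lemma exists_section_eq {f : X.left.functionField} (hf : ∀ x, f ∈ localRing X x) :
    ∃ s : Γ(X.left, ⊤), X.left.presheaf.germ ⊤ (genericPoint X.left) trivial s = f := by
  choose U hxU s hs using fun x ↦ exists_germ_eq_of_mem_localRing (hf x)
  have hcov : (⊤ : X.left.Opens) ≤ iSup U := fun x _ ↦
    TopologicalSpace.Opens.mem_iSup.mpr ⟨x, hxU x⟩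
  obtain ⟨t, ht, -⟩ := X.left.sheaf.existsUnique_gluing' U ⊤ (fun x ↦ homOfLE le_top) hcov s (by
    intro x y
    -- All overlaps contain the generic point, and sections of an integral scheme are determined by
    -- their germ there, so the local sections glue.
    have hη : genericPoint X.left ∈ U x ⊓ U y := ⟨genericPoint_mem (hxU x), genericPoint_mem (hxU y)⟩
    apply germ_injective_of_isIntegral X.left _ hη
    refine (TopCat.Presheaf.germ_res_apply _ _ _ _ _).trans
      (Eq.trans ?_ (TopCat.Presheaf.germ_res_apply _ _ _ _ _).symm)
    exact (hs x).trans (hs y).symm)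
  refine ⟨t, ?_⟩
  let x := genericPoint X.left
  rw [← hs x, ← ht x]
  exact (TopCat.Presheaf.germ_res_apply _ _ _ _ _).symm

/-- A rational function on a normal variety that is regular in codimension one is regular. -/
lemma mem_localRing_of_codim_one [IsLocallyNoetherian X.left] (hX : IsNormalScheme X.left)
    {f : X.left.functionField} (hf : ∀ x, Order.coheight x = 1 → f ∈ localRing X x)
    (x : X.left) : f ∈ localRing X x := by
  obtain ⟨U, hU, hxU, -⟩ := exists_isAffineOpen_mem (V := ⊤) (x := x) trivial
  have : Nonempty U := ⟨⟨x, hxU⟩⟩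
  have := hX.isIntegrallyClosed hU
  have : IsNoetherianRing Γ(X.left, U) := IsLocallyNoetherian.component_noetherian ⟨U, hU⟩
  have := functionField_isFractionRing_of_isAffineOpen X.left U hU
  suffices h : f ∈ (algebraMap Γ(X.left, U) X.left.functionField).range by
    obtain ⟨s, rfl⟩ := h
    exact germ_mem_localRing hxU s
  -- A prime of height one is a point of codimension one, whose stalk is the localization;
  -- regularity there supplies a denominator outside P.
  refine mem_range_of_height_one fun P hP hP1 ↦ ?_
  have hy : hU.fromSpec ⟨P, inferInstance⟩ ∈ U := hU.range_fromSpec.subset (Set.mem_range_self _)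
  let y : U := ⟨_, hy⟩
  have hyP : hU.primeIdealOf y = ⟨P, inferInstance⟩ :=
    hU.fromSpec.isOpenEmbedding.injective (hU.fromSpec_primeIdealOf y)
  let := X.left.presheaf.algebra_section_stalk y
  have hloc : IsLocalization P.primeCompl (X.left.presheaf.stalk (y : X.left)) := by
    have := hU.isLocalization_stalk y
    rwa [hyP] at this
  have hy1 : Order.coheight (y : X.left) = 1 := by
    rw [← height_primeIdealOf hU y, hyP, hP1]
  obtain ⟨a, rfl⟩ := hf y hy1
  obtain ⟨⟨b, s⟩, hs⟩ := IsLocalization.surj P.primeCompl a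
  have := functionField_isScalarTower X.left U y
  refine ⟨s, s.2, b, ?_⟩
  rw [IsScalarTower.algebraMap_apply Γ(X.left, U) (X.left.presheaf.stalk (y : X.left)) _ b, ← hs,
    map_mul, ← IsScalarTower.algebraMap_apply, mul_comm]

/-- Global functions on a universally closed variety are constant. -/
lemma exists_algebraMap_eq_of_universallyClosed [UniversallyClosed X.hom]
    (s : Γ(X.left, ⊤)) : ∃ c : ℂ, algebraMap ℂ X.left.functionField c =
      X.left.presheaf.germ ⊤ (genericPoint X.left) trivial s := by
  let F : ℂ →+* Γ(X.left, ⊤) :=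
    X.hom.appTop.hom.comp (Scheme.ΓSpecIso (CommRingCat.of ℂ)).inv.hom
  -- Global functions on a universally closed scheme are integral over ℂ, and ℂ is algebraically
  -- closed.
  have hF : F.IsIntegral :=
    RingHom.isIntegral_respectsIso.2 X.hom.appTop.hom
      (Scheme.ΓSpecIso (CommRingCat.of ℂ)).symm.commRingCatIsoToRingEquiv
      (isIntegral_appTop_of_universallyClosed X.hom)
  algebraize [F]
  obtain ⟨c, hc⟩ := (IsAlgClosed.algebraMap_bijective_of_isIntegral
    (k := ℂ) (K := Γ(X.left, ⊤))).2 s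
  exact ⟨c, by rw [← hc]; rfl⟩

/-- Proj is proper over the spectrum of the degree zero part, and this spectrum is a closed
subscheme of Spec ℂ when degree zero consists of constants. -/
lemma isProper_projToSpecC {A : Type} [CommRing A] [Algebra ℂ A] (𝒜 : ℕ → Submodule ℂ A)
    [GradedAlgebra 𝒜] [Algebra.FiniteType ℂ A]
    (h0 : ∀ a ∈ 𝒜 0, ∃ c : ℂ, algebraMap ℂ A c = a) : IsProper (projToSpecC 𝒜) := by
  have : IsScalarTower ℂ (𝒜 0) A := ⟨fun a b c ↦ smul_mul_assoc a (b : A) c⟩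
  have : Algebra.FiniteType (𝒜 0) A := Algebra.FiniteType.of_restrictScalars_finiteType ℂ (𝒜 0) A
  have : IsClosedImmersion (Spec.map (CommRingCat.ofHom (algebraMap ℂ (𝒜 0)))) := by
    refine IsClosedImmersion.spec_of_surjective _ fun a ↦ ?_
    obtain ⟨c, hc⟩ := h0 a a.2
    exact ⟨c, Subtype.ext hc⟩
  rw [projToSpecC]
  infer_instance

lemma exists_algebraMap_eq_of_isWeightedHomogeneous {σ : Type} {w : σ → ℕ} (hw : ∀ i, w i ≠ 0)
    {p : MvPolynomial σ ℂ} (hp : MvPolynomial.IsWeightedHomogeneous w p 0) :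
    ∃ c : ℂ, algebraMap ℂ (MvPolynomial σ ℂ) c = p := by
  classical
  refine ⟨p.coeff 0, ?_⟩
  ext m
  rw [MvPolynomial.algebraMap_eq, MvPolynomial.coeff_C]
  split_ifs with h
  · rw [h]
  · by_contra hne
    have := hp (Ne.symm hne)
    rw [Finsupp.weight_apply, Finsupp.sum, Finset.sum_eq_zero_iff] at this
    refine h (Finsupp.ext fun i ↦ ?_)
    by_contra hi
    have := this i (Finsupp.mem_support_iff.mpr (Ne.symm hi))
    simp [hw] at this
    exact hi this.symm

lemma IsProjective.universallyClosed {X : Over SpecC} (h : IsProjective X) :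
    UniversallyClosed X.hom ∧ LocallyOfFiniteType X.hom := by
  obtain ⟨N, i, hi⟩ := h
  let : GradedAlgebra (MvPolynomial.homogeneousSubmodule (Fin (N + 1)) ℂ) :=
    MvPolynomial.gradedAlgebra
  have : IsProper (projSpace N).hom := isProper_projToSpecC _ fun a ha ↦
    exists_algebraMap_eq_of_isWeightedHomogeneous (w := 1) (fun _ ↦ one_ne_zero) ha
  rw [← Over.w i]
  exact ⟨inferInstance, inferInstance⟩

end Regular

/-! ### Pull-back of rational functions -/

section FunMap

variable {W X T : Over SpecC} [IrreducibleSpace W.left] [IrreducibleSpace X.left]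
  [IrreducibleSpace T.left]

lemma genericPoint_mem_preimage (f : W ⟶ X) [IsDominant f.left] {U : X.left.Opens}
    (h : genericPoint X.left ∈ U) : genericPoint W.left ∈ f.left ⁻¹ᵁ U := by
  change f.left (genericPoint W.left) ∈ U
  rwa [map_genericPoint f]

lemma funMap_germ (f : W ⟶ X) [IsDominant f.left] {U : X.left.Opens}
    (h : genericPoint X.left ∈ U) (s : Γ(X.left, U)) :
    funMap f (X.left.presheaf.germ U _ h s) =
      W.left.presheaf.germ (f.left ⁻¹ᵁ U) _ (genericPoint_mem_preimage f h)
        (f.left.app U s) := by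
  change f.left.stalkMap _ (X.left.presheaf.stalkSpecializes _ _) = _
  rw [TopCat.Presheaf.germ_stalkSpecializes_apply, Scheme.Hom.germ_stalkMap_apply]

lemma funMap_germ_appLE (f : W ⟶ X) [IsDominant f.left] {U : X.left.Opens} {V : W.left.Opens}
    (h : genericPoint X.left ∈ U) (hV : genericPoint W.left ∈ V) (e : V ≤ f.left ⁻¹ᵁ U)
    (s : Γ(X.left, U)) : funMap f (X.left.presheaf.germ U _ h s) =
      W.left.presheaf.germ V _ hV (f.left.appLE U V e s) := by
  rw [funMap_germ, Scheme.Hom.appLE]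
  exact (TopCat.Presheaf.germ_res_apply _ (homOfLE e) _ hV _).symm

lemma funMap_comp (f : W ⟶ X) (g : X ⟶ T) [IsDominant f.left] [IsDominant g.left]
    [IsDominant (f ≫ g).left] : funMap (f ≫ g) = (funMap f).comp (funMap g) := by
  ext x
  obtain ⟨U, h, s, rfl⟩ := T.left.presheaf.exists_germ_eq x
  rw [AlgHom.comp_apply, funMap_germ, funMap_germ, funMap_germ]
  rfl

lemma funMap_id [IsDominant (𝟙 X : X ⟶ X).left] : funMap (𝟙 X) = AlgHom.id ℂ _ := by
  ext x
  obtain ⟨U, h, s, rfl⟩ := X.left.presheaf.exists_germ_eq x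
  exact funMap_germ (𝟙 X) h s

/-- The stalk map at w and the pull-back of rational functions agree on germs. This turns regularity
of pulled-back forms into a statement about subrings of function fields. -/
lemma pulledRing_eq_map (f : W ⟶ X) [IsDominant f.left] (w : W.left) :
    pulledRing f w = (localRing X (f.left w)).map (funMap f).toRingHom := by
  have key : ∀ a : X.left.presheaf.stalk (f.left w),
      algebraMap (W.left.presheaf.stalk w) W.left.functionField (f.left.stalkMap w a) =
      funMap f (algebraMap (X.left.presheaf.stalk (f.left w)) X.left.functionField a) := by
    intro a
    obtain ⟨U, h, s, rfl⟩ := X.left.presheaf.exists_germ_eq a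
    have : Nonempty U := ⟨⟨_, h⟩⟩
    have : Nonempty (f.left ⁻¹ᵁ U) := ⟨⟨w, h⟩⟩
    rw [Scheme.Hom.germ_stalkMap_apply, Scheme.algebraMap_germ_eq_germToFunctionField, funMap_germ]
    exact Scheme.algebraMap_germ_eq_germToFunctionField W.left (U := f.left ⁻¹ᵁ U) h _
  ext x
  constructor
  · rintro ⟨a, rfl⟩
    exact ⟨_, ⟨a, rfl⟩, (key a).symm⟩
  · rintro ⟨_, ⟨a, rfl⟩, rfl⟩
    exact ⟨a, key a⟩

omit [IrreducibleSpace X.left] in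
lemma pulledRing_le (f : W ⟶ X) (w : W.left) : pulledRing f w ≤ localRing W w := by
  rintro _ ⟨a, rfl⟩
  exact ⟨_, rfl⟩

lemma funMap_bijective_of_isIso_stalkMap (f : W ⟶ X) [IsDominant f.left]
    (h : IsIso (f.left.stalkMap (genericPoint W.left))) : Function.Bijective (funMap f) := by
  have h1 : IsIso (X.left.presheaf.stalkSpecializes (specializes_of_eq (map_genericPoint f))) :=
    (X.left.presheaf.stalkCongr (.of_eq (map_genericPoint f).symm)).isIso_hom
  exact ConcreteCategory.bijective_of_isIso (X.left.presheaf.stalkSpecializes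
      (specializes_of_eq (map_genericPoint f)) ≫ f.left.stalkMap (genericPoint W.left))

lemma isDominant_of_isOpenImmersion {S T : Scheme.{0}} [IrreducibleSpace T] [Nonempty S] (f : S ⟶ T)
    [IsOpenImmersion f] : IsDominant f :=
  ⟨IsOpen.dense f.isOpenEmbedding.isOpen_range (Set.range_nonempty _)⟩

lemma funMap_bijective_of_isOpenImmersion (f : W ⟶ X) [IsDominant f.left]
    [IsOpenImmersion f.left] : Function.Bijective (funMap f) :=
  funMap_bijective_of_isIso_stalkMap f inferInstance

omit [IrreducibleSpace W.left] [IrreducibleSpace X.left] in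
lemma IsBirationalMor.isDominant {f : W ⟶ X} (h : IsBirationalMor f) : IsDominant f.left := by
  obtain ⟨U, hU, -, hiso⟩ := h
  refine ⟨hU.mono fun x hx ↦ ?_⟩
  obtain ⟨y, hy⟩ := (f.left ∣_ U).surjective ⟨x, hx⟩
  refine ⟨y.1, ?_⟩
  rw [← morphismRestrict_base_coe, hy]

/-- The generic point lies over the open set where f is an isomorphism, so the stalk map there is an
isomorphism. -/
lemma IsBirationalMor.funMap_bijective {f : W ⟶ X} (h : IsBirationalMor f) [IsDominant f.left] :
    Function.Bijective (funMap f) := by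
  refine funMap_bijective_of_isIso_stalkMap f ?_
  obtain ⟨U, hU, hfU, hiso⟩ := h
  obtain ⟨x, hx⟩ := hfU.nonempty
  have hη := genericPoint_mem (U := f.left ⁻¹ᵁ U) hx
  have : IsOpenImmersion (f.left ∣_ U) := IsOpenImmersion.of_isIso _
  let η : (f.left ⁻¹ᵁ U).toScheme := ⟨_, hη⟩
  have h1 : IsIso ((f.left ∣_ U).stalkMap η) := inferInstance
  exact ((MorphismProperty.isomorphisms CommRingCat).arrow_mk_iso_iff
    (morphismRestrictStalkMap f.left U ⟨_, hη⟩)).mp h1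

end FunMap

/-- The isomorphism of function fields given by a birational equivalence. -/
lemma exists_algEquiv_of_birationalOver {Z X : Over SpecC} [IsIntegral Z.left] [IsIntegral X.left]
    (h : Scheme.BirationalOver Z.hom X.hom) :
    Nonempty (X.left.functionField ≃ₐ[ℂ] Z.left.functionField) := by
  obtain ⟨e, he⟩ := h
  let S : Over SpecC := Over.mk (e.source.ι ≫ Z.hom)
  let T : Over SpecC := Over.mk (e.target.ι ≫ X.hom)
  let i : S ⟶ Z := Over.homMk e.source.ι
  let j : T ⟶ X := Over.homMk e.target.ι
  let k : S ⟶ T := Over.homMk e.iso.hom he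
  have : Nonempty e.source := e.dense_source.nonempty.to_subtype
  have : Nonempty e.target := e.dense_target.nonempty.to_subtype
  have : IsIntegral S.left := inferInstanceAs (IsIntegral e.source)
  have : IsIntegral T.left := inferInstanceAs (IsIntegral e.target)
  have : IsOpenImmersion i.left := inferInstanceAs (IsOpenImmersion e.source.ι)
  have : IsOpenImmersion j.left := inferInstanceAs (IsOpenImmersion e.target.ι)
  have : IsOpenImmersion k.left := inferInstanceAs (IsOpenImmersion e.iso.hom)
  have : IsDominant i.left := isDominant_of_isOpenImmersion _
  have : IsDominant j.left := isDominant_of_isOpenImmersion _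
  have : IsDominant k.left := isDominant_of_isOpenImmersion _
  exact ⟨((AlgEquiv.ofBijective _ (funMap_bijective_of_isOpenImmersion j)).trans
    (AlgEquiv.ofBijective _ (funMap_bijective_of_isOpenImmersion k))).trans
    (AlgEquiv.ofBijective _ (funMap_bijective_of_isOpenImmersion i)).symm⟩

/-! ### The affine charts of the curves -/

/-- Dehomogenization: each monomial of a weighted homogeneous polynomial contributes the same power
of s. -/
lemma aeval_eq_pow_mul_aeval {σ R : Type} [CommRing R] [Algebra ℂ R] {w : σ → ℕ} {n : ℕ}
    {p : MvPolynomial σ ℂ} (hp : MvPolynomial.IsWeightedHomogeneous w p n) {x t : σ → R} {s : R}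
    (h : ∀ i, x i = s ^ w i * t i) :
    MvPolynomial.aeval x p = s ^ n * MvPolynomial.aeval t p := by
  conv_lhs => rw [p.as_sum]
  conv_rhs => rw [p.as_sum]
  rw [map_sum, map_sum, Finset.mul_sum]
  refine Finset.sum_congr rfl fun m hm ↦ ?_
  have hm' : Finsupp.weight w m = n := hp (MvPolynomial.mem_support_iff.mp hm)
  rw [MvPolynomial.aeval_monomial, MvPolynomial.aeval_monomial, ← hm', Finsupp.weight_apply,
    Finsupp.sum, ← Finset.prod_pow_eq_pow_sum, Finsupp.prod, Finsupp.prod]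
  simp only [h, mul_pow, Finset.prod_mul_distrib, smul_eq_mul, ← pow_mul, mul_comm (m _)]
  ring

section Chart

variable (k : ℕ) (F : MvPolynomial (Fin 3) ℂ) [IsWeighted k F] (c : Fin 3)

/-- The coordinate ring of the chart `{x_c ≠ 0}`. -/
def ChartRing : Type := HomogeneousLocalization.Away (coordGrading k F) (coord F c)

instance : CommRing (ChartRing k F c) :=
  inferInstanceAs (CommRing (HomogeneousLocalization.Away (coordGrading k F) (coord F c)))

instance : Algebra ℂ (ChartRing k F c) :=
  ((algebraMap (coordGrading k F 0)
    (HomogeneousLocalization.Away (coordGrading k F) (coord F c))).comp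
      (algebraMap ℂ (coordGrading k F 0))).toAlgebra

/-- The coordinate ring of the chart as a subring of the localization. -/
def chartVal : ChartRing k F c →ₐ[ℂ] Localization.Away (coord F c) where
  __ := algebraMap (HomogeneousLocalization.Away (coordGrading k F) (coord F c))
    (Localization.Away (coord F c))
  commutes' z := by
    change Localization.mk (algebraMap ℂ (CoordRing F) z) 1 = _
    rw [Localization.mk_one_eq_algebraMap, ← IsScalarTower.algebraMap_apply]

lemma chartVal_injective : Function.Injective (chartVal k F c) :=
  HomogeneousLocalization.val_injective _

variable {k c} (hc : wt k c = 1)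

/-- The functions `xᵢ / x_c ^ deg xᵢ`. -/
def chartCoord (i : Fin 3) : ChartRing k F c :=
  HomogeneousLocalization.Away.mk _ (coord_mem k F c) (wt k i) (coord F i)
    (by rw [hc, smul_eq_mul, mul_one]; exact coord_mem k F i)

lemma algebraMap_coord_eq (i : Fin 3) :
    algebraMap (CoordRing F) (Localization.Away (coord F c)) (coord F i) =
      algebraMap (CoordRing F) (Localization.Away (coord F c)) (coord F c) ^ wt k i *
        chartVal k F c (chartCoord F hc i) := by
  change _ = _ * Localization.mk _ _
  rw [← Localization.mk_one_eq_algebraMap, ← Localization.mk_one_eq_algebraMap, Localization.mk_pow,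
    Localization.mk_mul, Localization.mk_eq_mk_iff, Localization.r_iff_exists]
  refine ⟨1, ?_⟩
  simp

lemma aeval_coord (p : MvPolynomial (Fin 3) ℂ) :
    MvPolynomial.aeval (coord F) p = Ideal.Quotient.mk (Ideal.span {F}) p := by
  have : MvPolynomial.aeval (coord F) = Ideal.Quotient.mkₐ ℂ (Ideal.span {F}) := by
    ext i
    simp [coord]
  rw [this]; rfl

lemma mk_eq_pow_mul_aeval {n : ℕ} {p : MvPolynomial (Fin 3) ℂ} (hp : p ∈ polyGrading k n) :
    algebraMap (CoordRing F) (Localization.Away (coord F c)) (Ideal.Quotient.mk _ p) =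
      algebraMap (CoordRing F) (Localization.Away (coord F c)) (coord F c) ^ n *
        chartVal k F c (MvPolynomial.aeval (chartCoord F hc) p) := by
  have := aeval_eq_pow_mul_aeval (R := Localization.Away (coord F c)) hp (algebraMap_coord_eq F hc)
  rw [← aeval_coord, MvPolynomial.comp_aeval_apply, ← this]
  exact (MvPolynomial.aeval_algebraMap_apply (Localization.Away (coord F c)) (coord F) p).symm

/-- A degree zero fraction p/x_cⁿ is p evaluated at the xᵢ/x_c^(deg xᵢ). -/
lemma aeval_chartCoord_surjective :
    Function.Surjective (MvPolynomial.aeval (R := ℂ) (chartCoord F hc)) := by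
  intro z
  obtain ⟨n, a, ha, rfl⟩ := HomogeneousLocalization.Away.mk_surjective _ (coord_mem k F c) z
  obtain ⟨p, hp, rfl⟩ := ha
  rw [hc, smul_eq_mul, mul_one] at hp
  refine ⟨p, chartVal_injective k F c ?_⟩
  have hu : IsUnit (algebraMap (CoordRing F) (Localization.Away (coord F c)) (coord F c) ^ n) :=
    (IsLocalization.Away.algebraMap_isUnit _).pow n
  rw [← hu.mul_right_inj, ← mk_eq_pow_mul_aeval F hc hp]
  change _ = _ * Localization.mk _ _
  rw [← Localization.mk_one_eq_algebraMap, ← Localization.mk_one_eq_algebraMap, Localization.mk_pow,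
    Localization.mk_mul, Localization.mk_eq_mk_iff, Localization.r_iff_exists]
  refine ⟨1, ?_⟩
  simp

lemma chartCoord_self : chartCoord F hc c = 1 := by
  apply chartVal_injective k F c
  have hu := IsLocalization.Away.algebraMap_isUnit (S := Localization.Away (coord F c)) (coord F c)
  have := algebraMap_coord_eq F hc c
  rw [hc, pow_one] at this
  rw [map_one, ← hu.mul_right_inj, ← this, mul_one]

lemma aeval_chartCoord_eq_zero : MvPolynomial.aeval (chartCoord F hc) F = 0 := by
  obtain ⟨m, hm⟩ := IsWeighted.exists_degree (k := k) (F := F)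
  apply chartVal_injective k F c
  have hu : IsUnit (algebraMap (CoordRing F) (Localization.Away (coord F c)) (coord F c) ^ m) :=
    (IsLocalization.Away.algebraMap_isUnit _).pow m
  rw [← hu.mul_right_inj, ← mk_eq_pow_mul_aeval F hc hm, map_zero, mul_zero,
    Ideal.Quotient.eq_zero_iff_mem.mpr (Ideal.mem_span_singleton_self F), map_zero]

include hc in
lemma chartRing_finiteType : Algebra.FiniteType ℂ (ChartRing k F c) :=
  Algebra.FiniteType.of_surjective _ (aeval_chartCoord_surjective F hc)

/-- Solutions of F = 0 normalized by a_c = 1 give complex points of the chart. They serve to test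
nonvanishing, common points of charts and algebraic independence. -/
lemma exists_algHom_chartRing {a : Fin 3 → ℂ} (ha : a c = 1) (hF : MvPolynomial.aeval a F = 0) :
    ∃ ψ : ChartRing k F c →ₐ[ℂ] ℂ, ∀ i, ψ (chartCoord F hc i) = a i := by
  let φ : CoordRing F →ₐ[ℂ] ℂ := Ideal.Quotient.liftₐ _ (MvPolynomial.aeval a) fun p hp ↦ by
    obtain ⟨q, rfl⟩ := Ideal.mem_span_singleton.mp hp
    rw [map_mul, hF, zero_mul]
  have hφ : ∀ i, φ (coord F i) = a i := fun i ↦ by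
    change MvPolynomial.aeval a (MvPolynomial.X i) = a i
    simp
  let ψ : Localization.Away (coord F c) →ₐ[ℂ] ℂ :=
    IsLocalization.liftAlgHom (M := Submonoid.powers (coord F c)) (f := φ) (by
      rintro ⟨_, n, rfl⟩
      change IsUnit (φ (coord F c ^ n))
      rw [map_pow, hφ, ha, one_pow]
      exact isUnit_one)
  have hψ : ∀ x, ψ (algebraMap (CoordRing F) _ x) = φ x := fun x ↦ IsLocalization.lift_eq _ x
  refine ⟨ψ.comp (chartVal k F c), fun i ↦ ?_⟩
  have := congrArg ψ (algebraMap_coord_eq F hc i)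
  rw [map_mul, map_pow, hψ, hψ, hφ, hφ, ha, one_pow, one_mul] at this
  exact this.symm

variable (k c) in
lemma isDomain_chartRing [IsDomain (CoordRing F)] (h : coord F c ≠ 0) :
    IsDomain (ChartRing k F c) := by
  have : IsDomain (Localization.Away (coord F c)) := IsLocalization.Away.isDomain _ h
  exact (chartVal_injective k F c).isDomain (chartVal k F c).toRingHom

variable (k c) in
/-- The spectrum of a `ℂ`-algebra as a scheme over `ℂ`. -/
def specOver (R : Type) [CommRing R] [Algebra ℂ R] : Over SpecC :=
  Over.mk (Spec.map (CommRingCat.ofHom (algebraMap ℂ R)))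

/-- The morphism of spectra given by a homomorphism of `ℂ`-algebras. -/
def specMap {R S : Type} [CommRing R] [Algebra ℂ R] [CommRing S] [Algebra ℂ S] (f : R →ₐ[ℂ] S) :
    specOver S ⟶ specOver R :=
  Over.homMk (Spec.map (CommRingCat.ofHom f.toRingHom)) (by
    change Spec.map _ ≫ Spec.map _ = Spec.map _
    rw [← Spec.map_comp, ← CommRingCat.ofHom_comp]
    congr 2
    exact f.comp_algebraMap)

include hc in
lemma wt_pos : 0 < wt k c := hc ▸ one_pos

/-- The inclusion of the chart `{x_c ≠ 0}`. -/
def chartMap : specOver (ChartRing k F c) ⟶ weightedCurve k F :=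
  Over.homMk (Proj.awayι (coordGrading k F) (coord F c) (coord_mem k F c) (wt_pos hc)) (by
    change _ ≫ projToSpecC _ = Spec.map _
    rw [projToSpecC, Proj.awayι_toSpecZero_assoc, ← Spec.map_comp, ← CommRingCat.ofHom_comp]
    rfl)

instance : IsOpenImmersion (chartMap F hc).left :=
  inferInstanceAs (IsOpenImmersion
    (Proj.awayι (coordGrading k F) (coord F c) (coord_mem k F c) (wt_pos hc)))

lemma mem_range_chartMap (x : (weightedCurve k F).left) :
    x ∈ Set.range (chartMap F hc).left ↔ x ∈ Proj.basicOpen (coordGrading k F) (coord F c) := by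
  rw [← Proj.opensRange_awayι _ _ (coord_mem k F c) (wt_pos hc)]
  rfl

end Chart

lemma adjoin_coord (k : ℕ) (F : MvPolynomial (Fin 3) ℂ) [IsWeighted k F] :
    Algebra.adjoin (coordGrading k F 0) (Set.range (coord F)) = ⊤ := by
  refine top_le_iff.mp fun x _ ↦ ?_
  obtain ⟨p, rfl⟩ := Ideal.Quotient.mk_surjective x
  rw [← aeval_coord]
  induction p using MvPolynomial.induction_on with
  | C z =>
    rw [MvPolynomial.algHom_C]
    exact Subalgebra.algebraMap_mem _ (algebraMap ℂ (coordGrading k F 0) z)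
  | add p q hp hq => rw [map_add]; exact add_mem (hp trivial) (hq trivial)
  | mul_X p i hp =>
    rw [map_mul, MvPolynomial.aeval_X]
    exact mul_mem (hp trivial) (Algebra.subset_adjoin ⟨i, rfl⟩)

lemma wt_castSucc (k : ℕ) (c : Fin 2) : wt k c.castSucc = 1 := by
  fin_cases c <;> rfl

/-- Where x₀ and x₁ both vanish, y² ∈ (x₀, x₁) forces y to vanish too, and no point of Proj has all
coordinates zero. -/
lemma exists_mem_basicOpen {k : ℕ} {F : MvPolynomial (Fin 3) ℂ} [IsWeighted k F]
    (hF : coord F 2 ^ 2 ∈ Ideal.span {coord F 0, coord F 1}) (x : Proj (coordGrading k F)) :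
    ∃ c : Fin 2, x ∈ Proj.basicOpen (coordGrading k F) (coord F c.castSucc) := by
  have hx : x ∈ (⊤ : (Proj (coordGrading k F)).Opens) := trivial
  rw [← Proj.iSup_basicOpen_eq_top' (coordGrading k F) (coord F) (fun i ↦ ⟨_, coord_mem k F i⟩)
    (adjoin_coord k F), TopologicalSpace.Opens.mem_iSup] at hx
  obtain ⟨i, hi⟩ := hx
  by_contra! hcon
  have h0 := hcon 0
  have h1 := hcon 1
  rw [Proj.mem_basicOpen, not_not] at h0 h1
  rw [Proj.mem_basicOpen] at hi
  fin_cases i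
  · exact hi h0
  · exact hi h1
  · refine hi (Ideal.IsPrime.mem_of_pow_mem
      (I := (x : ProjectiveSpectrum _).asHomogeneousIdeal.toIdeal) x.isPrime 2 ?_)
    refine (Ideal.span_le.mpr ?_ : Ideal.span {coord F 0, coord F 1} ≤ _) hF
    rintro _ (rfl | rfl)
    · exact h0
    · exact h1

/-- The charts `{x₀ ≠ 0}` and `{x₁ ≠ 0}` cover the curve if `y ^ 2 ∈ (x₀, x₁)`. -/
lemma exists_mem_range_chartMap {k : ℕ} {F : MvPolynomial (Fin 3) ℂ} [IsWeighted k F]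
    (hF : coord F 2 ^ 2 ∈ Ideal.span {coord F 0, coord F 1})
    (x : (weightedCurve k F).left) :
    ∃ c : Fin 2, x ∈ Set.range (chartMap F (wt_castSucc k c)).left := by
  simp only [mem_range_chartMap]
  exact exists_mem_basicOpen hF x

/-! ### Products of charts -/

section Products

open scoped TensorProduct
open CartesianMonoidalCategory

variable {A B : Type} [CommRing A] [Algebra ℂ A] [CommRing B] [Algebra ℂ B] {S T : Over SpecC}

variable (A B) in
/-- The spectrum of a tensor product is the product of the spectra. -/
def specProd : specOver (A ⊗[ℂ] B) ⟶ specOver A ⊗ specOver B :=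
  lift (specMap Algebra.TensorProduct.includeLeft) (specMap Algebra.TensorProduct.includeRight)

instance : IsIso (specProd A B).left := by
  have h : (specProd A B).left = (pullbackSpecIso ℂ A B).inv := by
    apply Limits.pullback.hom_ext
    · exact (congrArg CommaMorphism.left (lift_fst (specMap (Algebra.TensorProduct.includeLeft
        (R := ℂ) (A := A) (B := B))) (specMap Algebra.TensorProduct.includeRight))).trans
          (pullbackSpecIso_inv_fst ℂ A B).symm
    · exact (congrArg CommaMorphism.left (lift_snd (specMap (Algebra.TensorProduct.includeLeft
        (R := ℂ) (A := A) (B := B))) (specMap Algebra.TensorProduct.includeRight))).trans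
          (pullbackSpecIso_inv_snd ℂ A B).symm
  exact h ▸ (pullbackSpecIso ℂ A B).isIso_inv

/-- The product of two affine charts. -/
def prodChart (f : specOver A ⟶ S) (g : specOver B ⟶ T) : specOver (A ⊗[ℂ] B) ⟶ S ⊗ T :=
  specProd A B ≫ (f ⊗ₘ g)

lemma prodChart_fst (f : specOver A ⟶ S) (g : specOver B ⟶ T) :
    prodChart f g ≫ fst S T = specMap Algebra.TensorProduct.includeLeft ≫ f := by
  rw [prodChart, Category.assoc, tensorHom_fst, specProd, lift_fst_assoc]

lemma prodChart_snd (f : specOver A ⟶ S) (g : specOver B ⟶ T) :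
    prodChart f g ≫ snd S T = specMap Algebra.TensorProduct.includeRight ≫ g := by
  rw [prodChart, Category.assoc, tensorHom_snd, specProd, lift_snd_assoc]

instance (f : specOver A ⟶ S) (g : specOver B ⟶ T) [IsOpenImmersion f.left]
    [IsOpenImmersion g.left] : IsOpenImmersion (prodChart f g).left := by
  have : IsOpenImmersion (f ⊗ₘ g).left := by
    rw [Over.tensorHom_left]
    exact Scheme.pullback_map_isOpenImmersion ..
  rw [prodChart, Over.comp_left]
  infer_instance

lemma mem_range_prodChart (f : specOver A ⟶ S) (g : specOver B ⟶ T) (x : (S ⊗ T).left)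
    (h₁ : (fst S T).left x ∈ Set.range f.left) (h₂ : (snd S T).left x ∈ Set.range g.left) :
    x ∈ Set.range (prodChart f g).left := by
  have hx : x ∈ Set.range (f ⊗ₘ g).left := by
    rw [Over.tensorHom_left]
    exact (Scheme.Pullback.range_map _ _ _ _ _ _ _ _ _).superset ⟨h₁, h₂⟩
  obtain ⟨z, rfl⟩ := hx
  obtain ⟨t, rfl⟩ := (specProd A B).left.surjective z
  exact ⟨t, by rw [prodChart, Over.comp_left, Scheme.Hom.comp_apply]⟩

end Products

/-- A scheme covered by integral open subschemes with a common point is integral. -/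
lemma isIntegral_of_charts {X : Scheme.{0}} {ι : Type} {U : ι → Scheme.{0}} (j : ∀ i, U i ⟶ X)
    [∀ i, IsOpenImmersion (j i)] [∀ i, IsIntegral (U i)] (h : ∀ x, ∃ i, x ∈ Set.range (j i))
    {x₀ : X} (h₀ : ∀ i, x₀ ∈ Set.range (j i)) : IsIntegral X := by
  have hr : IsReduced X := by
    refine @isReduced_of_isReduced_stalk _ fun x ↦ ?_
    obtain ⟨i, y, rfl⟩ := h x
    exact isReduced_of_injective ((j i).stalkMap y).hom
      (ConcreteCategory.bijective_of_isIso ((j i).stalkMap y)).1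
  have hp : PreirreducibleSpace X := by
    refine ⟨fun V W hV hW ⟨x, _, hx⟩ ⟨y, _, hy⟩ ↦ ?_⟩
    obtain ⟨a, x, rfl⟩ := h x
    obtain ⟨b, y, rfl⟩ := h y
    -- Any two nonempty open sets of one chart meet. Since every two charts share x₀, an open set
    -- meeting chart a also meets chart b inside a, and then meets any open set met by b.
    have key : ∀ (i : ι) (V W : Set X), IsOpen V → IsOpen W → (∃ x, j i x ∈ V) →
        (∃ x, j i x ∈ W) → ∃ x, j i x ∈ V ∩ W := fun i V W hV hW hV' hW' ↦
      nonempty_preirreducible_inter (hV.preimage (j i).continuous)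
        (hW.preimage (j i).continuous) hV' hW'
    have hoa : IsOpen (Set.range (j a)) := (j a).isOpenEmbedding.isOpen_range
    have hob : IsOpen (Set.range (j b)) := (j b).isOpenEmbedding.isOpen_range
    obtain ⟨z, hz⟩ := h₀ a
    obtain ⟨z', hz'⟩ := h₀ b
    obtain ⟨t, ht⟩ := key a V (Set.range (j b)) hV hob ⟨x, hx⟩ ⟨z, hz ▸ h₀ b⟩
    obtain ⟨t', ht'⟩ := ht.2
    obtain ⟨q, hq⟩ := key b V W hV hW ⟨t', ht' ▸ ht.1⟩ ⟨y, hy⟩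
    exact ⟨_, trivial, hq⟩
  have : IrreducibleSpace X := { hp with toNonempty := ⟨x₀⟩ }
  exact isIntegral_of_irreducibleSpace_of_isReduced X

/-! ### Functions on affine charts -/

section Affine

variable {R : Type} [CommRing R] [Algebra ℂ R]

instance [IsDomain R] : IsIntegral (specOver R).left :=
  inferInstanceAs (IsIntegral (Spec (CommRingCat.of R)))

/-- An element of `R` as a function on its spectrum. -/
def specSection (a : R) : Γ((specOver R).left, ⊤) := (Scheme.ΓSpecIso (CommRingCat.of R)).inv a

variable [IsDomain R]

variable (R) in
/-- The elements of `R` as rational functions on its spectrum. -/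
def specFun : R →ₐ[ℂ] (specOver R).left.functionField where
  __ := ((specOver R).left.presheaf.germ ⊤ (genericPoint _) trivial).hom.comp
    (Scheme.ΓSpecIso (CommRingCat.of R)).inv.hom
  commutes' z := by
    change (specOver R).left.presheaf.germ ⊤ _ _ ((Scheme.ΓSpecIso (CommRingCat.of R)).inv
      (algebraMap ℂ R z)) = (specOver R).left.presheaf.germ ⊤ _ _ ((specOver R).hom.appTop
        ((Scheme.ΓSpecIso (CommRingCat.of ℂ)).inv z))
    congr 1
    exact congr($(Scheme.ΓSpecIso_inv_naturality (CommRingCat.ofHom (algebraMap ℂ R))) z)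

lemma specFun_apply (a : R) : specFun R a =
    (specOver R).left.presheaf.germ ⊤ (genericPoint _) trivial (specSection a) := rfl

lemma specFun_injective : Function.Injective (specFun R) := by
  have h1 := germ_injective_of_isIntegral (specOver R).left (U := ⊤) (genericPoint _) trivial
  exact h1.comp (ConcreteCategory.bijective_of_isIso
    (Scheme.ΓSpecIso (CommRingCat.of R)).inv).1

/-- The stalk is a localization of R, so a regular germ is a quotient whose denominator is
invertible in the local ring. -/
lemma exists_eq_specFun_div {x : (specOver R).left} {f : (specOver R).left.functionField}
    (hf : f ∈ localRing (specOver R) x) : ∃ a b : R, b ≠ 0 ∧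
      (specFun R b)⁻¹ ∈ localRing (specOver R) x ∧ f = specFun R a * (specFun R b)⁻¹ := by
  have hU : IsAffineOpen (⊤ : (specOver R).left.Opens) :=
    (isAffineOpen_top (Spec (CommRingCat.of R)))
  let := (specOver R).left.presheaf.algebra_section_stalk (U := ⊤) ⟨x, trivial⟩
  have := hU.isLocalization_stalk ⟨x, trivial⟩
  obtain ⟨g, rfl⟩ := hf
  obtain ⟨⟨a, s⟩, hs⟩ := IsLocalization.surj
    (hU.primeIdealOf ⟨x, trivial⟩).asIdeal.primeCompl g
  have hu := IsLocalization.map_units ((specOver R).left.presheaf.stalk x) s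
  have hsurj := (ConcreteCategory.bijective_of_isIso
    (Scheme.ΓSpecIso (CommRingCat.of R)).inv).2
  obtain ⟨a, rfl⟩ := hsurj a
  obtain ⟨s, hs'⟩ := s
  obtain ⟨b, rfl⟩ := hsurj s
  have hne : Nonempty (⊤ : (specOver R).left.Opens) := ⟨⟨x, trivial⟩⟩
  have key : ∀ c : R, specFun R c = algebraMap ((specOver R).left.presheaf.stalk x)
      (specOver R).left.functionField
        (algebraMap Γ((specOver R).left, ⊤) ((specOver R).left.presheaf.stalk x)
          ((Scheme.ΓSpecIso (CommRingCat.of R)).inv c)) := fun c ↦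
    (Scheme.algebraMap_germ_eq_germToFunctionField (specOver R).left (U := ⊤) (x := x) trivial _).symm
  obtain ⟨w, hw⟩ := hu
  have hinv : specFun R b * algebraMap _ (specOver R).left.functionField
      (↑w⁻¹ : (specOver R).left.presheaf.stalk x) = 1 := by
    rw [key]
    erw [← hw]
    rw [← map_mul, Units.mul_inv, map_one]
  have hb : specFun R b ≠ 0 := left_ne_zero_of_mul_eq_one hinv
  refine ⟨a, b, fun h ↦ hb (by rw [h, map_zero]), ⟨_, eq_inv_of_mul_eq_one_right hinv⟩, ?_⟩
  rw [eq_mul_inv_iff_mul_eq₀ hb, key, key, ← map_mul]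
  exact congrArg _ hs

lemma specFun_mem_localRing (a : R) (x : (specOver R).left) :
    specFun R a ∈ localRing (specOver R) x :=
  germ_mem_localRing (X := specOver R) (U := ⊤) trivial _

variable {X : Over SpecC} [IsIntegral X.left] (j : specOver R ⟶ X) [IsOpenImmersion j.left]

instance : IsDominant j.left := isDominant_of_isOpenImmersion _

/-- The functions on an affine chart as rational functions. -/
def chartFun : R →ₐ[ℂ] X.left.functionField :=
  (AlgEquiv.ofBijective _ (funMap_bijective_of_isOpenImmersion j)).symm.toAlgHom.comp (specFun R)

lemma funMap_chartFun (a : R) : funMap j (chartFun j a) = specFun R a :=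
  AlgEquiv.apply_symm_apply (AlgEquiv.ofBijective _ (funMap_bijective_of_isOpenImmersion j)) _

lemma chartFun_injective : Function.Injective (chartFun j) :=
  (AlgEquiv.ofBijective _ (funMap_bijective_of_isOpenImmersion j)).symm.injective.comp
    specFun_injective

lemma mem_localRing_iff_funMap (x : (specOver R).left) (f : X.left.functionField) :
    f ∈ localRing X (j.left x) ↔ funMap j f ∈ localRing (specOver R) x := by
  have h1 : pulledRing j x = localRing (specOver R) x := by
    refine le_antisymm (pulledRing_le j x) ?_
    rintro _ ⟨a, rfl⟩
    obtain ⟨b, rfl⟩ := (ConcreteCategory.bijective_of_isIso (j.left.stalkMap x)).2 a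
    exact ⟨b, rfl⟩
  rw [← h1, pulledRing_eq_map]
  constructor
  · intro h
    exact ⟨f, h, rfl⟩
  · rintro ⟨g, hg, hgf⟩
    rwa [← (funMap_bijective_of_isOpenImmersion j).1 hgf]

lemma chartFun_mem_localRing (a : R) (x : (specOver R).left) :
    chartFun j a ∈ localRing X (j.left x) := by
  rw [mem_localRing_iff_funMap, funMap_chartFun]
  exact specFun_mem_localRing a x

lemma exists_eq_chartFun_div {x : (specOver R).left} {f : X.left.functionField}
    (hf : f ∈ localRing X (j.left x)) : ∃ a b : R, b ≠ 0 ∧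
      (chartFun j b)⁻¹ ∈ localRing X (j.left x) ∧ f = chartFun j a * (chartFun j b)⁻¹ := by
  obtain ⟨a, b, hb, hb', h⟩ := exists_eq_specFun_div ((mem_localRing_iff_funMap j x f).mp hf)
  refine ⟨a, b, hb, ?_, (funMap_bijective_of_isOpenImmersion j).1 ?_⟩
  · rwa [mem_localRing_iff_funMap, map_inv₀, funMap_chartFun]
  · rw [h, map_mul, map_inv₀, funMap_chartFun, funMap_chartFun]

lemma exists_eq_chartFun_div' (f : X.left.functionField) : ∃ a b : R, b ≠ 0 ∧
    f = chartFun j a * (chartFun j b)⁻¹ := by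
  have hf : f ∈ localRing X (j.left (genericPoint _)) := by
    rw [map_genericPoint j]
    refine ⟨f, ?_⟩
    change X.left.presheaf.stalkSpecializes _ f = f
    simp
  obtain ⟨a, b, hb, -, h⟩ := exists_eq_chartFun_div j hf
  exact ⟨a, b, hb, h⟩

end Affine

/-! ### The product of curves is integral -/

section Irreducible

/-- `ℂ[x₀, x₁, y] ≃ ℂ[x₁, x₀][y]`. -/
def lastVarEquiv : MvPolynomial (Fin 3) ℂ ≃ₐ[ℂ] Polynomial (MvPolynomial (Fin 2) ℂ) :=
  (MvPolynomial.renameEquiv ℂ (Equiv.swap (0 : Fin 3) 2)).trans (MvPolynomial.finSuccEquiv ℂ 2)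

lemma lastVarEquiv_X : lastVarEquiv (MvPolynomial.X 0) = Polynomial.C (MvPolynomial.X 1) ∧
    lastVarEquiv (MvPolynomial.X 1) = Polynomial.C (MvPolynomial.X 0) ∧
    lastVarEquiv (MvPolynomial.X 2) = Polynomial.X := by
  refine ⟨?_, ?_, ?_⟩ <;>
    simp only [lastVarEquiv, AlgEquiv.trans_apply, MvPolynomial.renameEquiv_apply,
      MvPolynomial.rename_X]
  · exact MvPolynomial.finSuccEquiv_X_succ (n := 2) (j := 1)
  · rw [Equiv.swap_apply_of_ne_of_ne (by decide) (by decide)]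
    exact MvPolynomial.finSuccEquiv_X_succ (n := 2) (j := 0)
  · rw [Equiv.swap_apply_right]
    exact MvPolynomial.finSuccEquiv_X_zero

/-- A monic quadratic y² − h without roots over the factorial ring ℂ[x₀, x₁] is irreducible, hence
prime. -/
lemma isDomain_coordRing {F : MvPolynomial (Fin 3) ℂ} {h : MvPolynomial (Fin 2) ℂ}
    (hF : lastVarEquiv F = Polynomial.X ^ 2 - Polynomial.C h) (hh : ∀ a, a ^ 2 ≠ h) :
    IsDomain (CoordRing F) := by
  have hm : (Polynomial.X ^ 2 - Polynomial.C h).Monic := Polynomial.monic_X_pow_sub_C h two_ne_zero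
  have hd : (Polynomial.X ^ 2 - Polynomial.C h).natDegree = 2 := Polynomial.natDegree_X_pow_sub_C
  have hirr : Irreducible (Polynomial.X ^ 2 - Polynomial.C h) := by
    rw [hm.irreducible_iff_roots_eq_zero_of_degree_le_three (by omega) (by omega)]
    refine Multiset.eq_zero_of_forall_notMem fun a ha ↦ hh a ?_
    have := Polynomial.isRoot_of_mem_roots ha
    rw [Polynomial.IsRoot, Polynomial.eval_sub, Polynomial.eval_pow, Polynomial.eval_X,
      Polynomial.eval_C, sub_eq_zero] at this
    exact this
  have hp : Prime F := by
    rw [← MulEquiv.prime_iff lastVarEquiv.toMulEquiv]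
    change Prime (lastVarEquiv F)
    rw [hF]
    exact hirr.prime
  have := (Ideal.span_singleton_prime hp.ne_zero).mpr hp
  exact Ideal.Quotient.isDomain _

instance : IsDomain (CoordRing F₂) := by
  refine isDomain_coordRing (h := MvPolynomial.X 1 * MvPolynomial.X 0 *
    (MvPolynomial.X 1 ^ 4 + MvPolynomial.X 0 ^ 4)) ?_ fun a ha ↦ ?_
  · simp only [F₂, map_sub, map_mul, map_add, map_pow, lastVarEquiv_X]
  -- On the line x₀ = 1 the polynomial h becomes X + X⁵, of odd degree, so it is not a square.
  · have h := congrArg (MvPolynomial.aeval ![Polynomial.X, (1 : Polynomial ℂ)]) ha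
    simp only [map_pow, map_mul, map_add, MvPolynomial.aeval_X, Matrix.cons_val] at h
    have hd := congrArg Polynomial.natDegree h
    rw [Polynomial.natDegree_pow] at hd
    have : (1 * Polynomial.X * (1 ^ 4 + Polynomial.X ^ 4) : Polynomial ℂ).natDegree = 5 := by
      compute_degree!
    omega

instance : IsDomain (CoordRing F₃) := by
  refine isDomain_coordRing (h := MvPolynomial.X 1 ^ 8 + MvPolynomial.X 0 ^ 8) ?_ fun a ha ↦ ?_
  · simp only [F₃, map_sub, map_add, map_pow, lastVarEquiv_X]
  · have h := congrArg (MvPolynomial.aeval ![Polynomial.X, (1 : Polynomial ℂ)]) ha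
    simp only [map_pow, map_add, MvPolynomial.aeval_X, Matrix.cons_val] at h
    set b := MvPolynomial.aeval ![Polynomial.X, (1 : Polynomial ℂ)] a
    -- On the line x₀ = 1 the polynomial h becomes X⁸ + 1, which is separable, hence squarefree; a
    -- square root would be a unit, of degree 0.
    have hs : (Polynomial.X ^ 8 - Polynomial.C (-1) : Polynomial ℂ).Separable :=
      Polynomial.separable_X_pow_sub_C (n := 8) (-1) (by norm_num) (by norm_num)
    have hb : b ^ 2 = Polynomial.X ^ 8 - Polynomial.C (-1) := by
      rw [h]; simp; ring
    have hu : IsUnit b := hs.squarefree b ⟨1, by rw [mul_one, ← hb, sq]⟩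
    have hd := congrArg Polynomial.natDegree hb
    rw [Polynomial.natDegree_pow, Polynomial.natDegree_eq_zero_of_isUnit hu,
      Polynomial.natDegree_X_pow_sub_C] at hd
    omega

end Irreducible

/-- A square root of `2`. -/
lemma exists_sq_eq_two : ∃ s : ℂ, s ^ 2 = 2 := IsAlgClosed.exists_pow_nat_eq 2 two_pos

/-! ### Complex points of the charts -/

section Points

variable {k : ℕ} {F : MvPolynomial (Fin 3) ℂ} [IsWeighted k F] {c i : Fin 3}

lemma chartMap_mem_basicOpen (hc : wt k c = 1) (hi : wt k i = 1)
    {x : (specOver (ChartRing k F c)).left}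
    (hx : chartCoord F hc i ∉ (x : PrimeSpectrum (ChartRing k F c)).asIdeal) :
    (chartMap F hc).left x ∈ Set.range (chartMap F hi).left := by
  rw [mem_range_chartMap]
  have h := Proj.awayι_preimage_basicOpen (coordGrading k F) (coord_mem k F c) (wt_pos hc)
    (coord_mem k F i) (wt_pos hi)
  have e : HomogeneousLocalization.Away.isLocalizationElem (coord_mem k F c) (coord_mem k F i) =
      chartCoord F hc i := by
    apply HomogeneousLocalization.val_injective
    change Localization.mk (coord F i ^ wt k c) _ = Localization.mk (coord F i) _
    congr 1
    rw [hc, pow_one]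
  rw [e] at h
  exact (le_of_eq h.symm : _ ≤ (Proj.awayι (coordGrading k F) _ (coord_mem k F c) (wt_pos hc)) ⁻¹ᵁ
    Proj.basicOpen (coordGrading k F) (coord F i)) hx

/-- The prime ideal of a complex point. -/
def pointOf {R : Type} [CommRing R] [Algebra ℂ R] (ψ : R →ₐ[ℂ] ℂ) : (specOver R).left :=
  (⟨RingHom.ker ψ, RingHom.ker_isPrime ψ.toRingHom⟩ : PrimeSpectrum R)

lemma chartMap_pointOf_mem (hc : wt k c = 1) (hi : wt k i = 1) {ψ : ChartRing k F c →ₐ[ℂ] ℂ}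
    (h : ψ (chartCoord F hc i) ≠ 0) :
    (chartMap F hc).left (pointOf ψ) ∈ Set.range (chartMap F hi).left :=
  chartMap_mem_basicOpen hc hi h

end Points

section IntegralY

open scoped TensorProduct
open CartesianMonoidalCategory

/-- The coordinate rings of the standard affine charts of `C₂ × C₂ × C₃`. -/
abbrev YRing (c : Fin 2 × Fin 2 × Fin 2) : Type :=
  ChartRing 3 F₂ c.1.castSucc ⊗[ℂ]
    (ChartRing 3 F₂ c.2.1.castSucc ⊗[ℂ] ChartRing 4 F₃ c.2.2.castSucc)

/-- The standard affine charts of `C₂ × C₂ × C₃`. -/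
def yChart (c : Fin 2 × Fin 2 × Fin 2) : specOver (YRing c) ⟶ Y :=
  prodChart (S := C₂) (T := C₂ ⊗ C₃) (chartMap F₂ (wt_castSucc 3 c.1))
    (prodChart (S := C₂) (T := C₃) (chartMap F₂ (wt_castSucc 3 c.2.1))
      (chartMap F₃ (wt_castSucc 4 c.2.2)))

instance (c : Fin 2 × Fin 2 × Fin 2) : IsOpenImmersion (yChart c).left := by
  have h1 : IsOpenImmersion (prodChart (S := C₂) (T := C₃) (chartMap F₂ (wt_castSucc 3 c.2.1))
      (chartMap F₃ (wt_castSucc 4 c.2.2))).left :=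
    inferInstanceAs (IsOpenImmersion (prodChart (S := weightedCurve 3 F₂) (T := weightedCurve 4 F₃)
      (chartMap F₂ (wt_castSucc 3 c.2.1)) (chartMap F₃ (wt_castSucc 4 c.2.2))).left)
  exact inferInstanceAs (IsOpenImmersion (prodChart (S := weightedCurve 3 F₂) (T := C₂ ⊗ C₃)
    (chartMap F₂ (wt_castSucc 3 c.1)) (prodChart (S := C₂) (T := C₃) _ _)).left)

/-- The point (1 : 1 : √2) lies on the curve and in both charts; it supplies the common point of the
charts of Y. -/
lemma exists_point₂ (c : Fin 2) : ∃ ψ : ChartRing 3 F₂ c.castSucc →ₐ[ℂ] ℂ,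
    ∀ i : Fin 2, ψ (chartCoord F₂ (wt_castSucc 3 c) i.castSucc) = 1 := by
  obtain ⟨s, hs⟩ := exists_sq_eq_two
  obtain ⟨ψ, hψ⟩ := exists_algHom_chartRing F₂ (wt_castSucc 3 c) (a := ![1, 1, s])
    (by fin_cases c <;> rfl) (by simp [F₂, hs]; norm_num)
  exact ⟨ψ, fun i ↦ (hψ _).trans (by fin_cases i <;> rfl)⟩

lemma exists_point₃ (c : Fin 2) : ∃ ψ : ChartRing 4 F₃ c.castSucc →ₐ[ℂ] ℂ,
    ∀ i : Fin 2, ψ (chartCoord F₃ (wt_castSucc 4 c) i.castSucc) = 1 := by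
  obtain ⟨s, hs⟩ := exists_sq_eq_two
  obtain ⟨ψ, hψ⟩ := exists_algHom_chartRing F₃ (wt_castSucc 4 c) (a := ![1, 1, s])
    (by fin_cases c <;> rfl) (by simp [F₃, hs]; norm_num)
  exact ⟨ψ, fun i ↦ (hψ _).trans (by fin_cases i <;> rfl)⟩

lemma coord_ne_zero {k : ℕ} {F : MvPolynomial (Fin 3) ℂ} [IsWeighted k F] {c : Fin 3}
    (h : Nontrivial (ChartRing k F c)) : coord F c ≠ 0 := by
  intro h0
  have : Subsingleton (ChartRing k F c) :=
    HomogeneousLocalization.subsingleton _ (x := .powers (coord F c)) ⟨1, by simpa using h0⟩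
  exact not_subsingleton _ this

instance (c : Fin 2) : IsDomain (ChartRing 3 F₂ c.castSucc) := by
  obtain ⟨ψ, -⟩ := exists_point₂ c
  exact isDomain_chartRing 3 F₂ _ (coord_ne_zero ψ.toRingHom.domain_nontrivial)

instance (c : Fin 2) : IsDomain (ChartRing 4 F₃ c.castSucc) := by
  obtain ⟨ψ, -⟩ := exists_point₃ c
  exact isDomain_chartRing 4 F₃ _ (coord_ne_zero ψ.toRingHom.domain_nontrivial)

instance (c : Fin 2 × Fin 2 × Fin 2) : IsDomain (YRing c) := by
  have := chartRing_finiteType F₂ (wt_castSucc 3 c.1)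
  have := chartRing_finiteType F₂ (wt_castSucc 3 c.2.1)
  have := isDomain_tensorProduct (ChartRing 3 F₂ c.2.1.castSucc) (ChartRing 4 F₃ c.2.2.castSucc)
  exact isDomain_tensorProduct _ _

lemma exists_mem_range_C₂ (x : C₂.left) :
    ∃ c : Fin 2, x ∈ Set.range (chartMap F₂ (wt_castSucc 3 c)).left := by
  refine exists_mem_range_chartMap (F := F₂) ?_ x
  have h : coord F₂ 2 ^ 2 = coord F₂ 0 * (coord F₂ 1 * (coord F₂ 0 ^ 4 + coord F₂ 1 ^ 4)) := by
    have := Ideal.Quotient.eq_zero_iff_mem.mpr (Ideal.mem_span_singleton_self F₂)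
    rw [← sub_eq_zero, ← mul_assoc]
    exact this
  rw [h]
  exact Ideal.mul_mem_right _ _ (Ideal.subset_span (by simp))

lemma exists_mem_range_C₃ (x : C₃.left) :
    ∃ c : Fin 2, x ∈ Set.range (chartMap F₃ (wt_castSucc 4 c)).left := by
  refine exists_mem_range_chartMap (F := F₃) ?_ x
  have h : coord F₃ 2 ^ 2 = coord F₃ 0 * coord F₃ 0 ^ 7 + coord F₃ 1 * coord F₃ 1 ^ 7 := by
    have := Ideal.Quotient.eq_zero_iff_mem.mpr (Ideal.mem_span_singleton_self F₃)
    rw [← sub_eq_zero, ← pow_succ', ← pow_succ']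
    exact this
  rw [h]
  exact add_mem (Ideal.mul_mem_right _ _ (Ideal.subset_span (by simp)))
    (Ideal.mul_mem_right _ _ (Ideal.subset_span (by simp)))

lemma mem_range_yChart {c : Fin 2 × Fin 2 × Fin 2} {y : Y.left}
    (h₁ : pr₁.left y ∈ Set.range (chartMap F₂ (wt_castSucc 3 c.1)).left)
    (h₂ : pr₂.left y ∈ Set.range (chartMap F₂ (wt_castSucc 3 c.2.1)).left)
    (h₃ : pr₃.left y ∈ Set.range (chartMap F₃ (wt_castSucc 4 c.2.2)).left) :
    y ∈ Set.range (yChart c).left :=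
  mem_range_prodChart (S := C₂) (T := C₂ ⊗ C₃) _ _ y h₁
    (mem_range_prodChart (S := C₂) (T := C₃) _ _ _ h₂ h₃)

lemma exists_mem_range_yChart (y : Y.left) : ∃ c, y ∈ Set.range (yChart c).left := by
  obtain ⟨a, ha⟩ := exists_mem_range_C₂ (pr₁.left y)
  obtain ⟨b, hb⟩ := exists_mem_range_C₂ (pr₂.left y)
  obtain ⟨c, hc⟩ := exists_mem_range_C₃ (pr₃.left y)
  exact ⟨(a, b, c), mem_range_yChart ha hb hc⟩

lemma yChart_pr₁ (c : Fin 2 × Fin 2 × Fin 2) : yChart c ≫ pr₁ =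
    specMap Algebra.TensorProduct.includeLeft ≫ chartMap F₂ (wt_castSucc 3 c.1) :=
  prodChart_fst _ _

lemma prodChart_snd_fst {A B C : Type} [CommRing A] [Algebra ℂ A] [CommRing B] [Algebra ℂ B]
    [CommRing C] [Algebra ℂ C] {S T U : Over SpecC} (f : specOver A ⟶ S) (g : specOver B ⟶ T)
    (h : specOver C ⟶ U) : prodChart f (prodChart g h) ≫ snd S (T ⊗ U) ≫ fst T U =
      specMap Algebra.TensorProduct.includeRight ≫
        specMap Algebra.TensorProduct.includeLeft ≫ g := by
  rw [← Category.assoc, prodChart_snd, Category.assoc, prodChart_fst]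

lemma prodChart_snd_snd {A B C : Type} [CommRing A] [Algebra ℂ A] [CommRing B] [Algebra ℂ B]
    [CommRing C] [Algebra ℂ C] {S T U : Over SpecC} (f : specOver A ⟶ S) (g : specOver B ⟶ T)
    (h : specOver C ⟶ U) : prodChart f (prodChart g h) ≫ snd S (T ⊗ U) ≫ snd T U =
      specMap Algebra.TensorProduct.includeRight ≫
        specMap Algebra.TensorProduct.includeRight ≫ h := by
  rw [← Category.assoc, prodChart_snd, Category.assoc, prodChart_snd]

lemma yChart_pr₂ (c : Fin 2 × Fin 2 × Fin 2) : yChart c ≫ pr₂ =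
    specMap Algebra.TensorProduct.includeRight ≫ specMap Algebra.TensorProduct.includeLeft ≫
      chartMap F₂ (wt_castSucc 3 c.2.1) :=
  prodChart_snd_fst _ _ _

lemma yChart_pr₃ (c : Fin 2 × Fin 2 × Fin 2) : yChart c ≫ pr₃ =
    specMap Algebra.TensorProduct.includeRight ≫ specMap Algebra.TensorProduct.includeRight ≫
      chartMap F₃ (wt_castSucc 4 c.2.2) :=
  prodChart_snd_snd _ _ _

/-- The complex point of a product given by points of the factors. -/
def prodPoint {A B : Type} [CommRing A] [Algebra ℂ A] [CommRing B] [Algebra ℂ B]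
    (ψ : A →ₐ[ℂ] ℂ) (χ : B →ₐ[ℂ] ℂ) : A ⊗[ℂ] B →ₐ[ℂ] ℂ :=
  Algebra.TensorProduct.lift ψ χ fun _ _ ↦ Commute.all _ _

lemma prodPoint_comp_left {A B : Type} [CommRing A] [Algebra ℂ A] [CommRing B] [Algebra ℂ B]
    (ψ : A →ₐ[ℂ] ℂ) (χ : B →ₐ[ℂ] ℂ) :
    (prodPoint ψ χ).comp Algebra.TensorProduct.includeLeft = ψ :=
  Algebra.TensorProduct.lift_comp_includeLeft ψ χ fun _ _ ↦ Commute.all _ _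

lemma prodPoint_comp_right {A B : Type} [CommRing A] [Algebra ℂ A] [CommRing B] [Algebra ℂ B]
    (ψ : A →ₐ[ℂ] ℂ) (χ : B →ₐ[ℂ] ℂ) :
    (prodPoint ψ χ).comp Algebra.TensorProduct.includeRight = χ :=
  Algebra.TensorProduct.lift_comp_includeRight ψ χ fun _ _ ↦ Commute.all _ _

/-- The charts are spectra of domains, and the point with all three components (1 : 1 : √2) lies in
all eight of them. -/
lemma isIntegral_Y : IsIntegral Y.left := by
  obtain ⟨ψ, hψ⟩ := exists_point₂ 0
  obtain ⟨χ, hχ⟩ := exists_point₃ 0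
  let c₀ : Fin 2 × Fin 2 × Fin 2 := (0, 0, 0)
  let pt : (specOver (YRing c₀)).left := pointOf (prodPoint ψ (prodPoint ψ χ))
  have h1 : pr₁.left ((yChart c₀).left pt) =
      (chartMap F₂ (wt_castSucc 3 0)).left (pointOf ψ) :=
    (congrArg (fun f ↦ f.left pt) (yChart_pr₁ c₀)).trans
      (congrArg (chartMap F₂ (wt_castSucc 3 0)).left
        (congrArg pointOf (prodPoint_comp_left ψ (prodPoint ψ χ))))
  have h2 : pr₂.left ((yChart c₀).left pt) =
      (chartMap F₂ (wt_castSucc 3 0)).left (pointOf ψ) :=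
    (congrArg (fun f ↦ f.left pt) (yChart_pr₂ c₀)).trans
      (congrArg (chartMap F₂ (wt_castSucc 3 0)).left
        (congrArg pointOf ((congrArg (·.comp Algebra.TensorProduct.includeLeft)
          (prodPoint_comp_right ψ (prodPoint ψ χ))).trans (prodPoint_comp_left ψ χ))))
  have h3 : pr₃.left ((yChart c₀).left pt) =
      (chartMap F₃ (wt_castSucc 4 0)).left (pointOf χ) :=
    (congrArg (fun f ↦ f.left pt) (yChart_pr₃ c₀)).trans
      (congrArg (chartMap F₃ (wt_castSucc 4 0)).left
        (congrArg pointOf ((congrArg (·.comp Algebra.TensorProduct.includeRight)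
          (prodPoint_comp_right ψ (prodPoint ψ χ))).trans (prodPoint_comp_right ψ χ))))
  refine isIntegral_of_charts (fun c ↦ (yChart c).left) exists_mem_range_yChart
    (x₀ := (yChart c₀).left pt) fun c ↦ mem_range_yChart ?_ ?_ ?_
  · rw [h1]
    exact chartMap_pointOf_mem _ _ (by rw [hψ]; exact one_ne_zero)
  · rw [h2]
    exact chartMap_pointOf_mem _ _ (by rw [hψ]; exact one_ne_zero)
  · rw [h3]
    exact chartMap_pointOf_mem _ _ (by rw [hχ]; exact one_ne_zero)

end IntegralY

/-! ### Coordinates as rational functions -/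

section PullFun

variable {T W C D : Over SpecC} [IrreducibleSpace T.left] [IrreducibleSpace W.left]

lemma pullFun_eq_germ (f : T ⟶ C) {U : C.left.Opens} (s : Γ(C.left, U)) {V : T.left.Opens}
    (hV : genericPoint T.left ∈ V) (e : V ≤ f.left ⁻¹ᵁ U) :
    pullFun f s = T.left.presheaf.germ V _ hV (f.left.appLE U V e s) := by
  rw [pullFun, dif_pos (e hV), Scheme.Hom.appLE]
  exact (TopCat.Presheaf.germ_res_apply _ (homOfLE e) _ hV _).symm

lemma pullFun_comp (f : T ⟶ C) (h : C ⟶ D) {U : D.left.Opens} (s : Γ(D.left, U))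
    {V : C.left.Opens} (hV : genericPoint T.left ∈ f.left ⁻¹ᵁ V) (e : V ≤ h.left ⁻¹ᵁ U) :
    pullFun (f ≫ h) s = pullFun f (h.left.appLE U V e s) := by
  have e' : f.left ⁻¹ᵁ V ≤ (f ≫ h).left ⁻¹ᵁ U := fun x hx ↦ e hx
  rw [pullFun_eq_germ f _ hV le_rfl, pullFun_eq_germ (f ≫ h) s hV e']
  congr 1
  exact congr($(Scheme.Hom.appLE_comp_appLE f.left h.left U V (f.left ⁻¹ᵁ V) e le_rfl) s).symm

lemma funMap_pullFun (h : W ⟶ T) [IsDominant h.left] (f : T ⟶ C) {U : C.left.Opens}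
    (s : Γ(C.left, U)) : funMap h (pullFun f s) = pullFun (h ≫ f) s := by
  by_cases hT : genericPoint T.left ∈ f.left ⁻¹ᵁ U
  · rw [pullFun_eq_germ f s hT le_rfl,
      funMap_germ_appLE h hT (genericPoint_mem_preimage h hT) le_rfl,
      pullFun_eq_germ (h ≫ f) s (V := h.left ⁻¹ᵁ f.left ⁻¹ᵁ U) (genericPoint_mem_preimage h hT)
        le_rfl]
    congr 1
    exact congr($(Scheme.Hom.appLE_comp_appLE h.left f.left U _ _ le_rfl le_rfl) s)
  -- If the generic point misses U, it does so on W as well, and both sides take the default value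
  -- 0.
  · have hW : genericPoint W.left ∉ (h ≫ f).left ⁻¹ᵁ U := fun hW ↦ hT (by
      change f.left (h.left _) ∈ U at hW
      rwa [map_genericPoint h] at hW)
    rw [pullFun, dif_neg hT, pullFun, dif_neg hW, map_zero]

end PullFun

section ChartFunctions

variable {k : ℕ} {F : MvPolynomial (Fin 3) ℂ} [IsWeighted k F] {c : Fin 3}

variable (k F c) in
/-- The chart `{x_c ≠ 0}`. -/
def chartOpen : (weightedCurve k F).left.Opens := Proj.basicOpen (coordGrading k F) (coord F c)

/-- An element of the coordinate ring of a chart as a function on it. -/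
def chartSection (a : ChartRing k F c) : Γ((weightedCurve k F).left, chartOpen k F c) :=
  Proj.awayToSection (coordGrading k F) (coord F c) a

lemma le_preimage_chartMap (hc : wt k c = 1) : (⊤ : (specOver (ChartRing k F c)).left.Opens) ≤
    (chartMap F hc).left ⁻¹ᵁ chartOpen k F c :=
  fun x _ ↦ (mem_range_chartMap F hc _).mp ⟨x, rfl⟩

/-- Composing with the isomorphism from the basic open set to the spectrum turns the chart map into
the inclusion of that open set, where the two sides agree; the isomorphism can then be cancelled. -/
lemma awayι_appLE {A : Type} [CommRing A] [Algebra ℂ A] (𝒜 : ℕ → Submodule ℂ A) [GradedAlgebra 𝒜]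
    {f : A} {m : ℕ} (hf : f ∈ 𝒜 m) (hm : 0 < m)
    (e : ⊤ ≤ Proj.awayι 𝒜 f hf hm ⁻¹ᵁ Proj.basicOpen 𝒜 f) :
    Proj.awayToSection 𝒜 f ≫ (Proj.awayι 𝒜 f hf hm).appLE (Proj.basicOpen 𝒜 f) ⊤ e =
      (Scheme.ΓSpecIso (CommRingCat.of (HomogeneousLocalization.Away 𝒜 f))).inv := by
  have e₀ : ⊤ ≤ (Proj.basicOpenIsoSpec 𝒜 f hf hm).hom ⁻¹ᵁ ⊤ := le_rfl
  have h : (Proj.basicOpenIsoSpec 𝒜 f hf hm).hom.appLE ⊤ ⊤ e₀ =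
      (Scheme.ΓSpecIso _).hom ≫ Proj.awayToSection 𝒜 f ≫ (Proj.basicOpen 𝒜 f).topIso.inv := by
    rw [← Proj.basicOpenToSpec_app_top, Proj.basicOpenIsoSpec_hom]
    exact Scheme.Hom.appLE_eq_app _
  have h2 : (Proj.basicOpenIsoSpec 𝒜 f hf hm).hom ≫ Proj.awayι 𝒜 f hf hm =
      (Proj.basicOpen 𝒜 f).ι := by rw [Proj.awayι, Iso.hom_inv_id_assoc]
  have hi : Mono ((Proj.basicOpenIsoSpec 𝒜 f hf hm).hom.appLE ⊤ ⊤ e₀) := by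
    rw [h]
    have : IsIso (Proj.awayToSection 𝒜 f) :=
      inferInstanceAs (IsIso (Proj.basicOpenIsoAway 𝒜 f hf hm).hom)
    infer_instance
  rw [← cancel_mono ((Proj.basicOpenIsoSpec 𝒜 f hf hm).hom.appLE ⊤ ⊤ e₀), Category.assoc,
    Scheme.Hom.appLE_comp_appLE, h, Iso.inv_hom_id_assoc]
  congr 1
  simp only [h2]
  rw [Scheme.Opens.ι_appLE]
  rfl

lemma pullFun_chartMap {R : Type} [CommRing R] [Algebra ℂ R] [IsDomain R] (hc : wt k c = 1)
    (φ : ChartRing k F c →ₐ[ℂ] R) (a : ChartRing k F c) :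
    pullFun (specMap φ ≫ chartMap F hc) (chartSection a) = specFun R (φ a) := by
  rw [pullFun_comp (specMap φ) (chartMap F hc) _ (V := ⊤) trivial (le_preimage_chartMap hc),
    pullFun_eq_germ (specMap φ) _ (V := ⊤) trivial le_rfl, specFun_apply]
  congr 1
  have h1 : (chartMap F hc).left.appLE (chartOpen k F c) ⊤
      (le_preimage_chartMap hc) (chartSection a) = specSection a :=
    congr($(awayι_appLE (coordGrading k F) (coord_mem k F c) (wt_pos hc)
      (le_preimage_chartMap hc)) a)
  rw [h1]
  have h2 := congr($(Scheme.ΓSpecIso_inv_naturality (CommRingCat.ofHom φ.toRingHom)) a)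
  refine Eq.trans ?_ h2.symm
  exact congr($(Scheme.Hom.appLE_eq_app (specMap φ).left (U := ⊤)) (specSection a))

end ChartFunctions

lemma specMap_comp {R S T : Type} [CommRing R] [Algebra ℂ R] [CommRing S] [Algebra ℂ S]
    [CommRing T] [Algebra ℂ T] (f : R →ₐ[ℂ] S) (g : S →ₐ[ℂ] T) :
    specMap (g.comp f) = specMap g ≫ specMap f := by
  ext1
  exact Spec.map_comp (CommRingCat.ofHom f.toRingHom) (CommRingCat.ofHom g.toRingHom)

lemma pullFun_chartMap_comp {k : ℕ} {F : MvPolynomial (Fin 3) ℂ} [IsWeighted k F] {c : Fin 3}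
    {R S : Type} [CommRing R] [Algebra ℂ R] [IsDomain R] [CommRing S] [Algebra ℂ S]
    (hc : wt k c = 1) (φ : ChartRing k F c →ₐ[ℂ] S) (ψ : S →ₐ[ℂ] R) (a : ChartRing k F c) :
    pullFun (specMap ψ ≫ specMap φ ≫ chartMap F hc) (chartSection a) = specFun R (ψ (φ a)) := by
  rw [← Category.assoc, ← specMap_comp]
  exact pullFun_chartMap hc (ψ.comp φ) a

section YFunctions

open scoped TensorProduct

variable [IsIntegral Y.left]

/-- The index of the chart of `Y` on which no `x₀ᵢ` vanishes. -/
def c₀ : Fin 2 × Fin 2 × Fin 2 := (0, 0, 0)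

/-- The chart of `Y` on which no `x₀ᵢ` vanishes. -/
abbrev yChart₀ : specOver (YRing c₀) ⟶ Y := yChart c₀

lemma pullFun_pr₁ (a : ChartRing 3 F₂ (0 : Fin 2).castSucc) :
    pullFun pr₁ (C := weightedCurve 3 F₂) (chartSection a) = chartFun yChart₀ (a ⊗ₜ 1) := by
  refine (funMap_bijective_of_isOpenImmersion yChart₀).1 ?_
  rw [funMap_chartFun]
  refine (funMap_pullFun yChart₀ pr₁ (C := weightedCurve 3 F₂) (chartSection a)).trans ?_
  exact (congrArg (fun f ↦ pullFun f (C := weightedCurve 3 F₂) (chartSection a))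
    (yChart_pr₁ c₀)).trans (pullFun_chartMap _ _ a)

lemma pullFun_pr₂ (a : ChartRing 3 F₂ (0 : Fin 2).castSucc) :
    pullFun pr₂ (C := weightedCurve 3 F₂) (chartSection a) =
      chartFun yChart₀ (1 ⊗ₜ (a ⊗ₜ 1)) := by
  refine (funMap_bijective_of_isOpenImmersion yChart₀).1 ?_
  rw [funMap_chartFun]
  refine (funMap_pullFun yChart₀ pr₂ (C := weightedCurve 3 F₂) (chartSection a)).trans ?_
  exact (congrArg (fun f ↦ pullFun f (C := weightedCurve 3 F₂) (chartSection a))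
    (yChart_pr₂ c₀)).trans (pullFun_chartMap_comp _ _ _ a)

lemma pullFun_pr₃ (a : ChartRing 4 F₃ (0 : Fin 2).castSucc) :
    pullFun pr₃ (C := weightedCurve 4 F₃) (chartSection a) =
      chartFun yChart₀ (1 ⊗ₜ (1 ⊗ₜ a)) := by
  refine (funMap_bijective_of_isOpenImmersion yChart₀).1 ?_
  rw [funMap_chartFun]
  refine (funMap_pullFun yChart₀ pr₃ (C := weightedCurve 4 F₃) (chartSection a)).trans ?_
  exact (congrArg (fun f ↦ pullFun f (C := weightedCurve 4 F₃) (chartSection a))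
    (yChart_pr₃ c₀)).trans (pullFun_chartMap_comp _ _ _ a)

/-- The `j`-th coordinate of the `i`-th factor on the charts of `Y`. -/
def yCoord (c : Fin 2 × Fin 2 × Fin 2) (j : Fin 3) : Fin 3 → YRing c :=
  ![chartCoord F₂ (wt_castSucc 3 c.1) j ⊗ₜ 1,
    1 ⊗ₜ (chartCoord F₂ (wt_castSucc 3 c.2.1) j ⊗ₜ 1),
    1 ⊗ₜ (1 ⊗ₜ chartCoord F₃ (wt_castSucc 4 c.2.2) j)]

lemma u_eq (i : Fin 3) : u i = chartFun yChart₀ (yCoord _ 1 i) := by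
  fin_cases i
  · exact pullFun_pr₁ _
  · exact pullFun_pr₂ _
  · exact pullFun_pr₃ _

lemma v_eq (i : Fin 3) : v i = chartFun yChart₀ (yCoord _ 2 i) := by
  fin_cases i
  · exact pullFun_pr₁ _
  · exact pullFun_pr₂ _
  · exact pullFun_pr₃ _

end YFunctions

/-! ### The function field of `Y` -/

section Coordinates

open scoped TensorProduct

/-- The coordinates `p₁, p₂, p₃` on the charts of `Y`: each `pᵢ` is `x₁ᵢ / x₀ᵢ` or its inverse. -/
def yP (c : Fin 2 × Fin 2 × Fin 2) : Fin 3 → YRing c :=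
  ![chartCoord F₂ (wt_castSucc 3 c.1) c.1.rev.castSucc ⊗ₜ 1,
    1 ⊗ₜ (chartCoord F₂ (wt_castSucc 3 c.2.1) c.2.1.rev.castSucc ⊗ₜ 1),
    1 ⊗ₜ (1 ⊗ₜ chartCoord F₃ (wt_castSucc 4 c.2.2) c.2.2.rev.castSucc)]

/-- The coordinates `q₁, q₂, q₃` on the charts of `Y`. -/
abbrev yQ (c : Fin 2 × Fin 2 × Fin 2) : Fin 3 → YRing c := yCoord c 2

/-- The polynomials `hᵢ` such that `qᵢ ^ 2 = hᵢ(pᵢ)`. -/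
def yH : Fin 3 → Polynomial ℂ :=
  ![.X * (1 + .X ^ 4), .X * (1 + .X ^ 4), 1 + .X ^ 8]

lemma aeval_F₂ {R : Type} [CommRing R] [Algebra ℂ R] (a : Fin 3 → R) :
    MvPolynomial.aeval a F₂ = a 2 ^ 2 - a 0 * a 1 * (a 0 ^ 4 + a 1 ^ 4) := by
  simp only [F₂, map_sub, map_mul, map_add, map_pow, MvPolynomial.aeval_X]

lemma aeval_F₃ {R : Type} [CommRing R] [Algebra ℂ R] (a : Fin 3 → R) :
    MvPolynomial.aeval a F₃ = a 2 ^ 2 - (a 0 ^ 8 + a 1 ^ 8) := by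
  simp only [F₃, map_sub, map_add, map_pow, MvPolynomial.aeval_X]

/-- Both curve equations are symmetric in x₀ and x₁, so the two charts of each curve have the same
affine equation. -/
lemma eq_of_castSucc_eq_one {R : Type} [CommRing R] {a : Fin 3 → R} {c : Fin 2}
    (h : a c.castSucc = 1) :
    a 0 * a 1 * (a 0 ^ 4 + a 1 ^ 4) = a c.rev.castSucc * (1 + a c.rev.castSucc ^ 4) ∧
      a 0 ^ 8 + a 1 ^ 8 = 1 + a c.rev.castSucc ^ 8 := by
  fin_cases c
  · change a 0 = 1 at h
    change a 0 * a 1 * (a 0 ^ 4 + a 1 ^ 4) = a 1 * (1 + a 1 ^ 4) ∧ a 0 ^ 8 + a 1 ^ 8 = 1 + a 1 ^ 8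
    rw [h]
    constructor <;> ring
  · change a 1 = 1 at h
    change a 0 * a 1 * (a 0 ^ 4 + a 1 ^ 4) = a 0 * (1 + a 0 ^ 4) ∧ a 0 ^ 8 + a 1 ^ 8 = 1 + a 0 ^ 8
    rw [h]
    constructor <;> ring

lemma chartCoord_sq₂ (c : Fin 2) : chartCoord F₂ (wt_castSucc 3 c) 2 ^ 2 =
    Polynomial.aeval (chartCoord F₂ (wt_castSucc 3 c) c.rev.castSucc)
      (.X * (1 + .X ^ 4) : Polynomial ℂ) := by
  have h := aeval_chartCoord_eq_zero F₂ (wt_castSucc 3 c)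
  rw [aeval_F₂, sub_eq_zero] at h
  simp only [map_mul, map_add, map_pow, map_one, Polynomial.aeval_X]
  exact h.trans (eq_of_castSucc_eq_one (chartCoord_self F₂ (wt_castSucc 3 c))).1

lemma chartCoord_sq₃ (c : Fin 2) : chartCoord F₃ (wt_castSucc 4 c) 2 ^ 2 =
    Polynomial.aeval (chartCoord F₃ (wt_castSucc 4 c) c.rev.castSucc)
      (1 + .X ^ 8 : Polynomial ℂ) := by
  have h := aeval_chartCoord_eq_zero F₃ (wt_castSucc 4 c)
  rw [aeval_F₃, sub_eq_zero] at h
  simp only [map_add, map_pow, map_one, Polynomial.aeval_X]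
  exact h.trans (eq_of_castSucc_eq_one (chartCoord_self F₃ (wt_castSucc 4 c))).2

lemma yQ_sq (c : Fin 2 × Fin 2 × Fin 2) (i : Fin 3) :
    yQ c i ^ 2 = Polynomial.aeval (yP c i) (yH i) := by
  let l₁ : ChartRing 3 F₂ c.1.castSucc →ₐ[ℂ] YRing c := Algebra.TensorProduct.includeLeft
  let l₂ : ChartRing 3 F₂ c.2.1.castSucc →ₐ[ℂ] YRing c :=
    Algebra.TensorProduct.includeRight.comp Algebra.TensorProduct.includeLeft
  let l₃ : ChartRing 4 F₃ c.2.2.castSucc →ₐ[ℂ] YRing c :=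
    Algebra.TensorProduct.includeRight.comp Algebra.TensorProduct.includeRight
  fin_cases i
  · change l₁ _ ^ 2 = Polynomial.aeval (l₁ _) _
    rw [Polynomial.aeval_algHom_apply, ← map_pow, chartCoord_sq₂]
    rfl
  · change l₂ _ ^ 2 = Polynomial.aeval (l₂ _) _
    rw [Polynomial.aeval_algHom_apply, ← map_pow, chartCoord_sq₂]
    rfl
  · change l₃ _ ^ 2 = Polynomial.aeval (l₃ _) _
    rw [Polynomial.aeval_algHom_apply, ← map_pow, chartCoord_sq₃]
    rfl

/-- The charts of the curves are generated by `p` and `q`. -/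
lemma chartRing_induction {k : ℕ} {F : MvPolynomial (Fin 3) ℂ} [IsWeighted k F] (c : Fin 2)
    (S : Subalgebra ℂ (ChartRing k F c.castSucc))
    (hp : chartCoord F (wt_castSucc k c) c.rev.castSucc ∈ S)
    (hq : chartCoord F (wt_castSucc k c) 2 ∈ S) (a : ChartRing k F c.castSucc) : a ∈ S := by
  obtain ⟨p, rfl⟩ := aeval_chartCoord_surjective F (wt_castSucc k c) a
  have hS : ∀ i, chartCoord F (wt_castSucc k c) i ∈ S := by
    have h1 : chartCoord F (wt_castSucc k c) c.castSucc ∈ S := by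
      rw [chartCoord_self]; exact S.one_mem
    intro i
    obtain rfl | ⟨j, rfl⟩ : i = 2 ∨ ∃ j : Fin 2, j.castSucc = i := by
      fin_cases i
      exacts [.inr ⟨0, rfl⟩, .inr ⟨1, rfl⟩, .inl rfl]
    · exact hq
    · obtain rfl | rfl : j = c ∨ j = c.rev := by clear hp hq h1 S; revert c j; decide
      · exact h1
      · exact hp
  induction p using MvPolynomial.induction_on with
  | C z => rw [MvPolynomial.algHom_C]; exact S.algebraMap_mem z
  | add p q hp hq => rw [map_add]; exact add_mem hp hq
  | mul_X p i hp => rw [map_mul, MvPolynomial.aeval_X]; exact mul_mem hp (hS i)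

/-- The charts of `Y` are generated by the `pᵢ` and `qᵢ`. -/
lemma yRing_induction (c : Fin 2 × Fin 2 × Fin 2) (S : Subalgebra ℂ (YRing c))
    (hp : ∀ i, yP c i ∈ S) (hq : ∀ i, yQ c i ∈ S) (a : YRing c) : a ∈ S := by
  let l₁ : ChartRing 3 F₂ c.1.castSucc →ₐ[ℂ] YRing c := Algebra.TensorProduct.includeLeft
  let l₂ : ChartRing 3 F₂ c.2.1.castSucc →ₐ[ℂ] YRing c :=
    Algebra.TensorProduct.includeRight.comp Algebra.TensorProduct.includeLeft
  let l₃ : ChartRing 4 F₃ c.2.2.castSucc →ₐ[ℂ] YRing c :=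
    Algebra.TensorProduct.includeRight.comp Algebra.TensorProduct.includeRight
  have h1 := chartRing_induction c.1 (S.comap l₁) (hp 0) (hq 0)
  have h2 := chartRing_induction c.2.1 (S.comap l₂) (hp 1) (hq 1)
  have h3 := chartRing_induction c.2.2 (S.comap l₃) (hp 2) (hq 2)
  induction a using TensorProduct.induction_on with
  | zero => exact S.zero_mem
  | add a b ha hb => exact add_mem ha hb
  | tmul a b =>
    rw [show a ⊗ₜ[ℂ] b = a ⊗ₜ 1 * 1 ⊗ₜ b by
      rw [Algebra.TensorProduct.tmul_mul_tmul, mul_one, one_mul]]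
    refine mul_mem (h1 a) ?_
    induction b using TensorProduct.induction_on with
    | zero => rw [TensorProduct.tmul_zero]; exact S.zero_mem
    | add a b ha hb => rw [TensorProduct.tmul_add]; exact add_mem ha hb
    | tmul a b =>
      rw [show (1 : ChartRing 3 F₂ c.1.castSucc) ⊗ₜ[ℂ] (a ⊗ₜ[ℂ] b) =
          1 ⊗ₜ (a ⊗ₜ 1) * 1 ⊗ₜ (1 ⊗ₜ b) by
        rw [Algebra.TensorProduct.tmul_mul_tmul, Algebra.TensorProduct.tmul_mul_tmul, mul_one,
          one_mul, mul_one]]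
      exact mul_mem (h2 a) (h3 b)

/-- The projection of the chart to the p-coordinates hits every complex point, because the equations
for the qᵢ can be solved in ℂ. -/
lemma exists_point_yRing (x : Fin 3 → ℂ) :
    ∃ ψ : YRing c₀ →ₐ[ℂ] ℂ, ∀ i, ψ (yP c₀ i) = x i := by
  have h2 : ∀ x : ℂ, ∃ ψ : ChartRing 3 F₂ (0 : Fin 2).castSucc →ₐ[ℂ] ℂ,
      ψ (chartCoord F₂ (wt_castSucc 3 0) 1) = x := by
    intro x
    obtain ⟨s, hs⟩ := IsAlgClosed.exists_pow_nat_eq (x * (1 + x ^ 4)) two_pos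
    obtain ⟨ψ, hψ⟩ := exists_algHom_chartRing F₂ (wt_castSucc 3 0) (a := ![1, x, s]) rfl
      (by simp [F₂, hs])
    exact ⟨ψ, hψ 1⟩
  have h3 : ∀ x : ℂ, ∃ ψ : ChartRing 4 F₃ (0 : Fin 2).castSucc →ₐ[ℂ] ℂ,
      ψ (chartCoord F₃ (wt_castSucc 4 0) 1) = x := by
    intro x
    obtain ⟨s, hs⟩ := IsAlgClosed.exists_pow_nat_eq (1 + x ^ 8) two_pos
    obtain ⟨ψ, hψ⟩ := exists_algHom_chartRing F₃ (wt_castSucc 4 0) (a := ![1, x, s]) rfl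
      (by simp [F₃, hs])
    exact ⟨ψ, hψ 1⟩
  obtain ⟨ψ₀, h₀⟩ := h2 (x 0)
  obtain ⟨ψ₁, h₁⟩ := h2 (x 1)
  obtain ⟨ψ₂, h₂⟩ := h3 (x 2)
  refine ⟨prodPoint ψ₀ (prodPoint ψ₁ ψ₂), fun i ↦ ?_⟩
  fin_cases i
  · exact (congr($(prodPoint_comp_left ψ₀ (prodPoint ψ₁ ψ₂)) _)).trans h₀
  · exact (congr($(prodPoint_comp_right ψ₀ (prodPoint ψ₁ ψ₂)) _)).trans
      ((congr($(prodPoint_comp_left ψ₁ ψ₂) _)).trans h₁)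
  · exact (congr($(prodPoint_comp_right ψ₀ (prodPoint ψ₁ ψ₂)) _)).trans
      ((congr($(prodPoint_comp_right ψ₁ ψ₂) _)).trans h₂)

variable [IsIntegral Y.left]

lemma u_eq_chartFun (i : Fin 3) : u i = chartFun yChart₀ (yP c₀ i) :=
  (u_eq i).trans (by fin_cases i <;> rfl)

lemma v_sq (i : Fin 3) : v i ^ 2 = Polynomial.aeval (u i) (yH i) := by
  rw [v_eq, u_eq_chartFun, Polynomial.aeval_algHom_apply, ← map_pow]
  exact congrArg _ (yQ_sq c₀ i)

lemma v_sq' : v 0 ^ 2 = u 0 * (1 + u 0 ^ 4) ∧ v 1 ^ 2 = u 1 * (1 + u 1 ^ 4) ∧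
    v 2 ^ 2 = 1 + u 2 ^ 8 := by
  refine ⟨(v_sq 0).trans ?_, (v_sq 1).trans ?_, (v_sq 2).trans ?_⟩ <;> simp [yH]

lemma algebraicIndependent_u : AlgebraicIndependent ℂ u := by
  rw [algebraicIndependent_iff]
  intro p hp
  rw [show (u : Fin 3 → Y.left.functionField) = fun i ↦ chartFun yChart₀ (yP c₀ i) from
    funext u_eq_chartFun, ← MvPolynomial.comp_aeval_apply] at hp
  have hp' := (injective_iff_map_eq_zero _).mp (chartFun_injective yChart₀) _ hp
  -- A relation between the u's holds at every point of the chart, hence on all of ℂ³, so its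
  -- polynomial is zero.
  refine MvPolynomial.funext fun x ↦ ?_
  obtain ⟨ψ, hψ⟩ := exists_point_yRing x
  have h := congrArg ψ hp'
  rw [MvPolynomial.comp_aeval_apply, map_zero, funext hψ] at h
  rwa [map_zero]

/-- The function field consists of quotients of polynomials in the u's and v's, and each v is a
square root of a polynomial in the corresponding u. -/
lemma isAlgebraic_of_isAlgebraic_u {S : Subalgebra ℂ Y.left.functionField}
    (hu : ∀ i, IsAlgebraic S (u i)) : Algebra.IsAlgebraic S Y.left.functionField := by
  let T : Subalgebra ℂ Y.left.functionField :=
    (Subalgebra.algebraicClosure S Y.left.functionField).restrictScalars ℂ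
  have hT : ∀ i, u i ∈ T := hu
  have hv : ∀ i, v i ∈ T := fun i ↦ by
    have h : v i ^ 2 ∈ T := by
      rw [v_sq]
      exact Algebra.adjoin_le (Set.singleton_subset_iff.mpr (hT i))
        (Polynomial.aeval_mem_adjoin_singleton ℂ (u i))
    exact IsAlgebraic.of_pow two_pos h
  have hall : ∀ a, chartFun yChart₀ a ∈ T := fun a ↦
    yRing_induction c₀ (T.comap (chartFun yChart₀)) (fun i ↦ by
      rw [Subalgebra.mem_comap, ← u_eq_chartFun]; exact hT i) (fun i ↦ by
      rw [Subalgebra.mem_comap, ← v_eq]; exact hv i) a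
  refine ⟨fun f ↦ ?_⟩
  obtain ⟨a, b, -, rfl⟩ := exists_eq_chartFun_div' yChart₀ f
  exact (hall a).mul (hall b).inv

lemma isTranscendenceBasis_u : IsTranscendenceBasis ℂ u := by
  rw [algebraicIndependent_u.isTranscendenceBasis_iff_isAlgebraic]
  exact isAlgebraic_of_isAlgebraic_u fun i ↦ isAlgebraic_algebraMap
    (⟨u i, Algebra.subset_adjoin ⟨i, rfl⟩⟩ : Algebra.adjoin ℂ (Set.range u))

lemma u_ne_zero (i : Fin 3) : u i ≠ 0 := algebraicIndependent_u.ne_zero i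

lemma v_ne_zero (i : Fin 3) : v i ≠ 0 := by
  intro h
  have h1 := v_sq i
  rw [h, zero_pow two_ne_zero] at h1
  have h2 : Transcendental ℂ (u i) := algebraicIndependent_u.transcendental i
  refine h2 ⟨yH i, ?_, h1.symm⟩
  intro h0
  have := congrArg (Polynomial.eval 1) h0
  fin_cases i <;> simp [yH] at this

end Coordinates

/-! ### Local generators of the pluricanonical sheaves -/

section Generator

variable {K : Type} [Field K] [Algebra ℂ K] {n d : ℕ} {O : Subring K}

/-- The functions in `O` whose differential lies in the lattice generated by `S`. -/
def diffSubalgebra (hc : ∀ c : ℂ, algebraMap ℂ K c ∈ O) (S : Set Ω[K⁄ℂ]) : Subalgebra ℂ K where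
  carrier := {z | z ∈ O ∧ KaehlerDifferential.D ℂ K z ∈ latt O S}
  mul_mem' := fun {a b} ha hb ↦ ⟨O.mul_mem ha.1 hb.1, by
    rw [Derivation.leibniz]
    exact add_mem (smul_mem_latt ha.1 hb.2) (smul_mem_latt hb.1 ha.2)⟩
  add_mem' := fun {a b} ha hb ↦ ⟨O.add_mem ha.1 hb.1, by
    rw [map_add]; exact add_mem ha.2 hb.2⟩
  algebraMap_mem' := fun c ↦ ⟨hc c, by rw [Derivation.map_algebraMap]; exact zero_mem _⟩

lemma D_div_mem_latt {S : Set Ω[K⁄ℂ]} {s t : K} (ht : t⁻¹ ∈ O) (hs' : s ∈ O)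
    (hDs : KaehlerDifferential.D ℂ K s ∈ latt O S) (hDt : KaehlerDifferential.D ℂ K t ∈ latt O S) :
    KaehlerDifferential.D ℂ K (s * t⁻¹) ∈ latt O S := by
  rw [Derivation.leibniz, Derivation.leibniz_inv]
  refine add_mem (smul_mem_latt hs' ?_) (smul_mem_latt ht hDs)
  rw [neg_smul]
  refine neg_mem (smul_mem_latt ?_ hDt)
  exact O.pow_mem ht 2

/-- In the basis e, the lattice spanned over O has coordinates in O. Determinants of regular
differentials therefore lie in O. -/
lemma repr_mem_of_mem_latt (hc : ∀ c : ℂ, algebraMap ℂ K c ∈ O)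
    (e : Module.Basis (Fin n) K Ω[K⁄ℂ]) {η : Ω[K⁄ℂ]} (hη : η ∈ latt O (Set.range e)) (i : Fin n) :
    e.repr η i ∈ O := by
  let Q : AddSubmonoid Ω[K⁄ℂ] := O.toAddSubgroup.toAddSubmonoid.comap (e.coord i).toAddMonoidHom
  refine latt_induction (Q := Q) ?_ hc ?_ hη
  · rintro _ ⟨j, rfl⟩
    change e.repr (e j) i ∈ O
    rw [e.repr_self, Finsupp.single_apply]
    split_ifs
    exacts [O.one_mem, O.zero_mem]
  · intro b hb x hx
    change e.coord i (b • x) ∈ O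
    rw [map_smul, smul_eq_mul]
    exact O.mul_mem hb hx

omit [Algebra ℂ K] in
lemma det_mem {M : Matrix (Fin n) (Fin n) K} (hM : ∀ i j, M i j ∈ O) : M.det ∈ O := by
  rw [Matrix.det_apply]
  refine O.sum_mem fun σ _ ↦ ?_
  rw [Units.smul_def]
  exact O.zsmul_mem (O.prod_mem fun i _ ↦ hM _ _) _

/-- If the differentials of `a₁, …, aₙ` generate the differentials of `O`, then
`(d a₁ ∧ ⋯ ∧ d aₙ)^{⊗ d}` generates the `d`-canonical forms. -/
lemma exists_eq_smul_elemForm [Module.Finite K Ω[K⁄ℂ]] (hn : Module.finrank K Ω[K⁄ℂ] = n)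
    (hc : ∀ c : ℂ, algebraMap ℂ K c ∈ O) (hfrac : ∀ f : K, ∃ s ∈ O, ∃ t ∈ O, f = s * t⁻¹)
    {a : Fin n → K} (ha : ∀ f ∈ O, KaehlerDifferential.D ℂ K f ∈
      latt O (Set.range fun i ↦ KaehlerDifferential.D ℂ K (a i)))
    {x : RatForm K n d} (hx : x ∈ formsOver n d O O) : ∃ b ∈ O, x = b • elemForm fun _ ↦ a := by
  have hle : ∀ η ∈ latt O (Set.range fun i ↦ KaehlerDifferential.D ℂ K (a i)),
      η ∈ Submodule.span K (Set.range fun i ↦ KaehlerDifferential.D ℂ K (a i)) := fun η hη ↦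
    latt_induction (Q := (Submodule.span K _).toAddSubmonoid) Submodule.subset_span hc
      (fun b _ x hx ↦ Submodule.smul_mem _ b hx) hη
  have hspan : ⊤ ≤ Submodule.span K (Set.range fun i ↦ KaehlerDifferential.D ℂ K (a i)) := by
    rw [← KaehlerDifferential.span_range_derivation ℂ K, Submodule.span_le]
    rintro _ ⟨f, rfl⟩
    obtain ⟨s, hs, t, ht, rfl⟩ := hfrac f
    rw [Derivation.leibniz, Derivation.leibniz_inv]
    exact add_mem (Submodule.smul_mem _ _ (Submodule.smul_mem _ _ (hle _ (ha t ht))))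
      (Submodule.smul_mem _ _ (hle _ (ha s hs)))
  let e := basisOfTopLeSpanOfCardEqFinrank _ hspan (by rw [Fintype.card_fin, hn])
  have he : ∀ i, e i = KaehlerDifferential.D ℂ K (a i) := fun i ↦ by
    simp only [e, coe_basisOfTopLeSpanOfCardEqFinrank]
  have he' : Set.range e = Set.range fun i ↦ KaehlerDifferential.D ℂ K (a i) :=
    congrArg Set.range (funext he)
  refine ⟨basisForm e d x, ?_, ?_⟩
  · rw [formsOver_eq_latt] at hx
    refine latt_induction (Q := O.toAddSubgroup.toAddSubmonoid.comap
      (basisForm e d).toAddMonoidHom) ?_ hc ?_ hx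
    · rintro _ ⟨a', ha', rfl⟩
      change basisForm e d (elemForm a') ∈ O
      rw [elemForm, basisForm_tprod]
      refine O.prod_mem fun j _ ↦ ?_
      rw [Module.Basis.det_apply]
      refine det_mem fun i k ↦ ?_
      rw [Module.Basis.toMatrix_apply]
      refine repr_mem_of_mem_latt hc e ?_ i
      rw [he']
      exact ha _ (ha' j k)
    · intro b hb y hy
      change basisForm e d (b • y) ∈ O
      rw [map_smul, smul_eq_mul]
      exact O.mul_mem hb hy
  · conv_lhs => rw [eq_basisForm_smul e x]
    congr 1
    simp only [elemForm, ← he]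

/-- Generators of pluricanonical forms pull back to generators. -/
lemma exists_eq_smul_formMap {L : Type} [Field L] [Algebra ℂ L] (φ : K →ₐ[ℂ] L) {B : Subring L}
    (hc : ∀ c : ℂ, algebraMap ℂ L c ∈ B) (hB : O.map φ.toRingHom ≤ B) {τ₀ : RatForm K n d}
    (h : ∀ x ∈ formsOver n d O O, ∃ b ∈ O, x = b • τ₀) {τ : RatForm L n d}
    (hτ : τ ∈ formsOver n d (O.map φ.toRingHom) B) : ∃ b ∈ B, τ = b • formMap n d φ τ₀ := by
  rw [formsOver_eq_latt] at hτ
  let Q : AddSubmonoid (RatForm L n d) :=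
    { carrier := {τ | ∃ b ∈ B, τ = b • formMap n d φ τ₀}
      zero_mem' := ⟨0, B.zero_mem, by rw [zero_smul]⟩
      add_mem' := by
        rintro _ _ ⟨b, hb, rfl⟩ ⟨b', hb', rfl⟩
        exact ⟨b + b', B.add_mem hb hb', (add_smul _ _ _).symm⟩ }
  refine latt_induction (Q := Q) ?_ hc ?_ hτ
  · rintro _ ⟨a, ha, rfl⟩
    choose a' ha' haa using ha
    obtain ⟨b, hb, h'⟩ := h (elemForm a') (Submodule.subset_span
      ⟨1, O.one_mem, a', ha', (one_smul _ _).symm⟩)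
    refine ⟨φ b, hB ⟨b, hb, rfl⟩, ?_⟩
    rw [← formMap_smul, ← h', formMap_elemForm]
    congr 1
    exact funext fun j ↦ funext fun i ↦ (haa j i).symm
  · rintro b hb _ ⟨b', hb', rfl⟩
    exact ⟨b * b', B.mul_mem hb hb', (mul_smul _ _ _).symm⟩

end Generator

section ChartUnits

variable {R : Type} [CommRing R] [Algebra ℂ R]

lemma mem_basicOpen_specSection (x : (specOver R).left) (a : R) :
    x ∈ (specOver R).left.basicOpen (specSection a) ↔
      a ∉ (x : PrimeSpectrum R).asIdeal := by
  have := basicOpen_eq_of_affine (R := CommRingCat.of R) a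
  exact (iff_of_eq (congrArg (x ∈ ·) this))

variable [IsDomain R] {X : Over SpecC} [IsIntegral X.left] (j : specOver R ⟶ X)
  [IsOpenImmersion j.left]

lemma inv_chartFun_mem_localRing {x : (specOver R).left} {a : R}
    (ha : a ∉ (x : PrimeSpectrum R).asIdeal) : (chartFun j a)⁻¹ ∈ localRing X (j.left x) := by
  rw [mem_localRing_iff_funMap, map_inv₀, funMap_chartFun]
  rw [← mem_basicOpen_specSection, Scheme.mem_basicOpen _ _ _ (show x ∈ ⊤ from trivial)] at ha
  obtain ⟨w, hw⟩ := ha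
  have hne : Nonempty (⊤ : (specOver R).left.Opens) := ⟨⟨x, trivial⟩⟩
  have key : specFun R a = algebraMap ((specOver R).left.presheaf.stalk x)
      (specOver R).left.functionField w := by
    rw [hw]
    exact (Scheme.algebraMap_germ_eq_germToFunctionField (specOver R).left (U := ⊤) (x := x)
      trivial _).symm
  refine ⟨(↑w⁻¹ : (specOver R).left.presheaf.stalk x), ?_⟩
  rw [key]
  refine eq_inv_of_mul_eq_one_right ?_
  rw [← map_mul, Units.mul_inv, map_one]

end ChartUnits

lemma algebraMap_mem_localRing {X : Over SpecC} [IrreducibleSpace X.left] (x : X.left) (c : ℂ) :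
    algebraMap ℂ X.left.functionField c ∈ localRing X x :=
  ⟨constants X x c, constants_stalkSpecializes _ c⟩

section YGenerator

/-- Separability of hᵢ, that is, smoothness of the affine curve q² = hᵢ(p); explicit Bézout
coefficients are given. -/
lemma isCoprime_yH (i : Fin 3) : IsCoprime (yH i) (Polynomial.derivative (yH i)) := by
  have h4 : (4 : Polynomial ℂ) * Polynomial.C (1 / 4) = 1 := by
    rw [← Polynomial.C_ofNat, ← Polynomial.C_mul]; norm_num
  have h5 : IsCoprime (.X * (1 + .X ^ 4) : Polynomial ℂ)
      (Polynomial.derivative (.X * (1 + .X ^ 4))) := by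
    refine ⟨-25 * Polynomial.C (1 / 4) * .X ^ 3, 1 + 5 * Polynomial.C (1 / 4) * .X ^ 4, ?_⟩
    have : Polynomial.derivative (.X * (1 + .X ^ 4) : Polynomial ℂ) = 1 + 5 * .X ^ 4 := by
      simp [Polynomial.derivative_pow, Polynomial.C_ofNat]
      ring
    rw [this]
    linear_combination (-5 * Polynomial.X ^ 4) * h4
  have h8 : IsCoprime (1 + .X ^ 8 : Polynomial ℂ) (Polynomial.derivative (1 + .X ^ 8)) := by
    refine ⟨1, -Polynomial.C (1 / 4) * Polynomial.C (1 / 2) * .X, ?_⟩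
    have h2 : (2 : Polynomial ℂ) * Polynomial.C (1 / 2) = 1 := by
      rw [← Polynomial.C_ofNat, ← Polynomial.C_mul]; norm_num
    have : Polynomial.derivative (1 + .X ^ 8 : Polynomial ℂ) = 8 * .X ^ 7 := by
      simp [Polynomial.derivative_pow, Polynomial.C_ofNat]
    rw [this]
    linear_combination (-2 * Polynomial.C (1 / 2) * Polynomial.X ^ 8) * h4 - Polynomial.X ^ 8 * h2
  fin_cases i
  exacts [h5, h5, h8]

variable [IsIntegral Y.left]

lemma finrank_differentials_Y : Module.Finite Y.left.functionField Ω[Y.left.functionField⁄ℂ] ∧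
    Module.finrank Y.left.functionField Ω[Y.left.functionField⁄ℂ] = 3 := by
  obtain ⟨e, -⟩ := exists_basis_D isTranscendenceBasis_u
  exact ⟨.of_basis e, by rw [Module.finrank_eq_card_basis e, Fintype.card_fin]⟩

lemma two_smul_D_yQ (c : Fin 2 × Fin 2 × Fin 2) (i : Fin 3) :
    (2 * chartFun (yChart c) (yQ c i)) •
        KaehlerDifferential.D ℂ Y.left.functionField (chartFun (yChart c) (yQ c i)) =
      chartFun (yChart c) (Polynomial.aeval (yP c i) (yH i).derivative) •
        KaehlerDifferential.D ℂ Y.left.functionField (chartFun (yChart c) (yP c i)) := by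
  have h := congrArg (fun z ↦ KaehlerDifferential.D ℂ Y.left.functionField (chartFun (yChart c) z))
    (yQ_sq c i)
  simp only [map_pow, ← Polynomial.aeval_algHom_apply, Derivation.leibniz_pow,
    Derivation.map_aeval] at h ⊢
  rw [← h, mul_smul]
  simp [two_smul]

omit [IsIntegral Y.left] in
lemma D_mem_latt_of_inv {K : Type} [Field K] [Algebra ℂ K] {O : Subring K} {S : Set Ω[K⁄ℂ]}
    {a b : K} {η ξ : Ω[K⁄ℂ]} (ha : a ∈ O) (hb : b⁻¹ ∈ O) (hb0 : b ≠ 0) (h : b • η = a • ξ)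
    (hξ : ξ ∈ latt O S) : η ∈ latt O S := by
  rw [← inv_smul_smul₀ hb0 η, h]
  exact smul_mem_latt hb (smul_mem_latt ha hξ)

/-- The bicanonical sheaf of `Y` has local generators. -/
lemma exists_generator_Y (y : Y.left) (d : ℕ) : ∃ (U : Y.left.Opens)
    (a : Fin 3 → Y.left.functionField), y ∈ U ∧ ∀ y' ∈ U, (∀ i, a i ∈ localRing Y y') ∧
      ∀ x ∈ formsOver 3 d (localRing Y y') (localRing Y y'),
        ∃ b ∈ localRing Y y', x = b • elemForm fun _ ↦ a := by
  classical
  obtain ⟨c, x, rfl⟩ := exists_mem_range_yChart y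
  have hx := (x : PrimeSpectrum (YRing c)).isPrime
  let I := (x : PrimeSpectrum (YRing c)).asIdeal
  let h' : Fin 3 → YRing c := fun i ↦ Polynomial.aeval (yP c i) (yH i).derivative
  -- At a point with qᵢ = 0 the derivative hᵢ'(pᵢ) is nonzero, by the Bézout identity and qᵢ² =
  -- hᵢ(pᵢ).
  have hcase : ∀ i, yQ c i ∈ I → h' i ∉ I := by
    intro i hq hh
    obtain ⟨α, β, hαβ⟩ := isCoprime_yH i
    have h1 := congrArg (Polynomial.aeval (yP c i)) hαβ
    rw [map_add, map_mul, map_mul, ← yQ_sq, map_one] at h1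
    refine hx.one_notMem ?_
    rw [← h1]
    exact I.add_mem (I.mul_mem_left _ (I.pow_mem_of_mem hq 2 two_pos)) (I.mul_mem_left _ hh)
  -- By 2q dq = h'(p) dp, the parameter of each factor is q where q vanishes at the given point and
  -- p elsewhere. The elements e collect what must be invertible; the choice is made at x and stays
  -- valid wherever ∏ e ≠ 0.
  let a : Fin 3 → YRing c := fun i ↦ if yQ c i ∈ I then yQ c i else yP c i
  let e : Fin 3 → YRing c := fun i ↦ if yQ c i ∈ I then h' i else yQ c i
  have he : ∏ i, e i ∉ I := by
    intro h
    obtain ⟨i, -, hi⟩ := (hx.prod_mem_iff).mp h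
    by_cases hq : yQ c i ∈ I
    · simp only [e, if_pos hq] at hi
      exact hcase i hq hi
    · simp only [e, if_neg hq] at hi
      exact hq hi
  refine ⟨(yChart c).left ''ᵁ (specOver (YRing c)).left.basicOpen (specSection (∏ i, e i)),
    fun i ↦ chartFun (yChart c) (a i), ⟨x, (mem_basicOpen_specSection x _).mpr he, rfl⟩, ?_⟩
  rintro _ ⟨x', hx', rfl⟩
  replace hx' := (mem_basicOpen_specSection x' _).mp hx'
  have hprime := (x' : PrimeSpectrum (YRing c)).isPrime
  have he' : ∀ i, e i ∉ (x' : PrimeSpectrum (YRing c)).asIdeal := fun i hi ↦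
    hx' (hprime.prod_mem_iff.mpr ⟨i, Finset.mem_univ i, hi⟩)
  set O := localRing Y ((yChart c).left x') with hO
  have hinv : ∀ i, (chartFun (yChart c) (e i))⁻¹ ∈ O := fun i ↦
    inv_chartFun_mem_localRing _ (he' i)
  have hne : ∀ i, chartFun (yChart c) (e i) ≠ 0 := fun i h ↦ he' i (by
    rw [(injective_iff_map_eq_zero _).mp (chartFun_injective (yChart c)) _ h]
    exact Ideal.zero_mem _)
  have hmem : ∀ z, chartFun (yChart c) z ∈ O := fun z ↦ chartFun_mem_localRing _ z x'
  have hc : ∀ z : ℂ, algebraMap ℂ Y.left.functionField z ∈ O := algebraMap_mem_localRing _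
  refine ⟨fun i ↦ hmem _, fun ξ hξ ↦ ?_⟩
  obtain ⟨hfin, hrank⟩ := finrank_differentials_Y
  let S := Set.range fun i ↦ KaehlerDifferential.D ℂ Y.left.functionField
    (chartFun (yChart c) (a i))
  have h2 : (2 : Y.left.functionField) ∈ O := by
    have := hc 2
    rwa [map_ofNat] at this
  have h2' : (2 : Y.left.functionField)⁻¹ ∈ O := by
    have := hc 2⁻¹
    rwa [map_inv₀, map_ofNat] at this
  have h20 : (2 : Y.left.functionField) ≠ 0 := by
    have := (algebraMap ℂ Y.left.functionField).injective.ne (two_ne_zero (α := ℂ))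
    rwa [map_ofNat, map_zero] at this
  have hpq : ∀ i, KaehlerDifferential.D ℂ Y.left.functionField (chartFun (yChart c) (yP c i)) ∈
      latt O S ∧ KaehlerDifferential.D ℂ Y.left.functionField (chartFun (yChart c) (yQ c i)) ∈
      latt O S := by
    intro i
    have ha : KaehlerDifferential.D ℂ Y.left.functionField (chartFun (yChart c) (a i)) ∈
      latt O S := subset_latt ⟨i, rfl⟩
    have hi := hinv i
    have h0 := hne i
    by_cases hq : yQ c i ∈ I
    · simp only [a, e, if_pos hq] at ha hi h0
      exact ⟨D_mem_latt_of_inv (O.mul_mem h2 (hmem _)) hi h0 (two_smul_D_yQ c i).symm ha, ha⟩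
    · simp only [a, e, if_neg hq] at ha hi h0
      refine ⟨ha, D_mem_latt_of_inv (hmem (h' i)) ?_ (mul_ne_zero h20 h0) (two_smul_D_yQ c i) ha⟩
      rw [mul_inv]
      exact O.mul_mem h2' hi
  -- The elements with differential in the lattice form a subalgebra, so the generators pᵢ and qᵢ
  -- suffice.
  have hall : ∀ z, KaehlerDifferential.D ℂ Y.left.functionField (chartFun (yChart c) z) ∈
      latt O S := fun z ↦ (yRing_induction c ((diffSubalgebra hc S).comap (chartFun (yChart c)))
        (fun i ↦ ⟨hmem _, (hpq i).1⟩) (fun i ↦ ⟨hmem _, (hpq i).2⟩) z).2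
  refine exists_eq_smul_elemForm hrank hc (fun f ↦ ?_) (fun f hf ↦ ?_) hξ
  · obtain ⟨s, t, -, rfl⟩ := exists_eq_chartFun_div' (yChart c) f
    exact ⟨_, hmem s, _, hmem t, rfl⟩
  · obtain ⟨s, t, -, ht, rfl⟩ := exists_eq_chartFun_div (yChart c) hf
    exact D_div_mem_latt ht (hmem s) (hall s) (hall t)

end YGenerator

/-! ### The action of `G` on the function field -/

lemma projMap_appLE_awayToSection {A : Type} [CommRing A] [Algebra ℂ A] (𝒜 : ℕ → Submodule ℂ A)
    [GradedAlgebra 𝒜] (f : 𝒜 →+*ᵍ 𝒜)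
    (hf : HomogeneousIdeal.irrelevant 𝒜 ≤ (HomogeneousIdeal.irrelevant 𝒜).map f) {s x : A}
    {m n : ℕ} (hs : s ∈ 𝒜 m) (hx : x ∈ 𝒜 (n • m)) :
    (Proj.map f hf).appLE (Proj.basicOpen 𝒜 s) (Proj.basicOpen 𝒜 (f s)) le_rfl
        (Proj.awayToSection 𝒜 s (HomogeneousLocalization.Away.mk 𝒜 hs n x hx)) =
      Proj.awayToSection 𝒜 (f s)
        (HomogeneousLocalization.Away.mk 𝒜 (f.map_mem hs) n (f x) (f.map_mem hx)) := by
  have h := congr($(Proj.awayToSection_comp_appLE f hf hs)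
    (HomogeneousLocalization.Away.mk 𝒜 hs n x hx))
  refine h.trans ?_
  change Proj.awayToSection 𝒜 (f s) (HomogeneousLocalization.Away.map f s
    (HomogeneousLocalization.Away.mk 𝒜 hs n x hx)) = _
  rw [HomogeneousLocalization.Away.map_mk]

section Scale

variable {k : ℕ} {F : MvPolynomial (Fin 3) ℂ} [IsWeighted k F] {c c' : Fin 3 → ℂ}
  {T : Over SpecC} [IrreducibleSpace T.left]

/-- A function of the form `x / sⁿ` on `{s ≠ 0}`. -/
def fracSection {s : CoordRing F} {m : ℕ} (hs : s ∈ coordGrading k F m) (n : ℕ) (x : CoordRing F)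
    (hx : x ∈ coordGrading k F (n • m)) :
    Γ((weightedCurve k F).left, (Proj.basicOpen (coordGrading k F) s :)) :=
  Proj.awayToSection (coordGrading k F) s (HomogeneousLocalization.Away.mk _ hs n x hx)

lemma pullFun_fracSection_congr (f : T ⟶ weightedCurve k F) {s s' : CoordRing F} (h : s' = s)
    {m : ℕ} (hs : s ∈ coordGrading k F m) (hs' : s' ∈ coordGrading k F m) (n : ℕ) (x : CoordRing F)
    (hx : x ∈ coordGrading k F (n • m)) :
    pullFun f (fracSection hs' n x hx) = pullFun f (fracSection hs n x hx) := by
  subst h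
  rfl

omit [IsWeighted k F] in
lemma scaleHom_coord (h : IsSemiInvariant F c) (i : Fin 3) :
    scaleHom k h (coord F i) = c i • coord F i := by
  change Ideal.Quotient.mk _ (scalePoly c (MvPolynomial.X i)) = _
  rw [scalePoly, MvPolynomial.aeval_X, ← MvPolynomial.smul_eq_C_mul]
  rfl

lemma smul_chartCoord {j : Fin 3} (hj : wt k j = 1) (z : ℂ) (i : Fin 3)
    (hx : z • coord F i ∈ coordGrading k F (wt k i • wt k j)) :
    (HomogeneousLocalization.Away.mk _ (coord_mem k F j) (wt k i) (z • coord F i) hx :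
      ChartRing k F j) = z • chartCoord F hj i := by
  apply chartVal_injective k F j
  rw [map_smul]
  change Localization.mk _ _ = z • Localization.mk _ _
  rw [Localization.smul_mk]

/-- As x_j is fixed, the automorphism maps the chart x_j ≠ 0 to itself and scales each coordinate
function by cᵢ. -/
lemma pullFun_scaleAut (f : T ⟶ weightedCurve k F) (h : IsSemiInvariant F c)
    (h' : IsSemiInvariant F c') (hc : ∀ i, c i * c' i = 1) {j : Fin 3} (hj : wt k j = 1)
    (hcj : c j = 1) (hf : genericPoint T.left ∈ f.left ⁻¹ᵁ chartOpen k F j) (i : Fin 3) :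
    pullFun (f ≫ (scaleAut k h h' hc).hom) (chartSection (chartCoord F hj i)) =
      pullFun f (chartSection (c i • chartCoord F hj i)) := by
  have hs : scaleHom k h (coord F j) = coord F j := by rw [scaleHom_coord, hcj, one_smul]
  have hV : genericPoint T.left ∈
      f.left ⁻¹ᵁ (Proj.basicOpen (coordGrading k F) (scaleHom k h (coord F j)) :) := by
    rw [hs]; exact hf
  have hx : scaleHom k h (coord F i) ∈ coordGrading k F (wt k i • wt k j) := by
    rw [hj, smul_eq_mul, mul_one]
    exact (scaleHom k h).map_mem (coord_mem k F i)
  have h1 := pullFun_comp f (scaleAut k h h' hc).hom (chartSection (chartCoord F hj i)) hV le_rfl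
  refine h1.trans ?_
  have h3 : (scaleAut k h h' hc).hom.left.appLE (chartOpen k F j)
      (Proj.basicOpen (coordGrading k F) (scaleHom k h (coord F j))) le_rfl
        (chartSection (chartCoord F hj i)) =
      fracSection ((scaleHom k h).map_mem (coord_mem k F j)) (wt k i)
        (scaleHom k h (coord F i)) hx :=
    projMap_appLE_awayToSection (coordGrading k F) (scaleHom k h)
      (irrelevant_le_map_scaleHom k h h' hc) (coord_mem k F j) _
  refine (congrArg _ h3).trans ?_
  refine (pullFun_fracSection_congr f hs (coord_mem k F j) _ _ _ _).trans ?_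
  refine congrArg (fun z ↦ pullFun f (chartSection z)) ?_
  rw [← smul_chartCoord hj (c i) i (by rw [← scaleHom_coord h]; exact hx)]
  congr 1
  exact scaleHom_coord h i

end Scale

section Action

open scoped TensorProduct
open CartesianMonoidalCategory

lemma g_hom_pr₁ : g.hom ≫ pr₁ = pr₁ ≫ g₂.hom := tensorHom_fst g₂.hom (g₂.hom ⊗ₘ g₃.hom)

lemma tensorHom_snd_fst {S T U S' T' U' : Over SpecC} (f : S ⟶ S') (g : T ⟶ T') (h : U ⟶ U') :
    (f ⊗ₘ (g ⊗ₘ h)) ≫ snd S' (T' ⊗ U') ≫ fst T' U' = (snd S (T ⊗ U) ≫ fst T U) ≫ g := by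
  rw [tensorHom_snd_assoc, tensorHom_fst, Category.assoc]

lemma tensorHom_snd_snd {S T U S' T' U' : Over SpecC} (f : S ⟶ S') (g : T ⟶ T') (h : U ⟶ U') :
    (f ⊗ₘ (g ⊗ₘ h)) ≫ snd S' (T' ⊗ U') ≫ snd T' U' = (snd S (T ⊗ U) ≫ snd T U) ≫ h := by
  rw [tensorHom_snd_assoc, tensorHom_snd, Category.assoc]

lemma g_hom_pr₂ : g.hom ≫ pr₂ = pr₂ ≫ g₂.hom := tensorHom_snd_fst g₂.hom g₂.hom g₃.hom

lemma g_hom_pr₃ : g.hom ≫ pr₃ = pr₃ ≫ g₃.hom := tensorHom_snd_snd g₂.hom g₂.hom g₃.hom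

variable [IsIntegral Y.left]

lemma genericPoint_mem_chartOpen :
    genericPoint Y.left ∈ pr₁.left ⁻¹ᵁ chartOpen 3 F₂ 0 ∧
    genericPoint Y.left ∈ pr₂.left ⁻¹ᵁ chartOpen 3 F₂ 0 ∧
    genericPoint Y.left ∈ pr₃.left ⁻¹ᵁ chartOpen 4 F₃ 0 := by
  rw [← map_genericPoint yChart₀]
  refine ⟨?_, ?_, ?_⟩
  · exact (mem_range_chartMap F₂ (wt_castSucc 3 0) _).mp ⟨_, (congrArg
      (fun f ↦ f.left (genericPoint (specOver (YRing c₀)).left)) (yChart_pr₁ c₀)).symm⟩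
  · exact (mem_range_chartMap F₂ (wt_castSucc 3 0) _).mp ⟨_, (congrArg
      (fun f ↦ f.left (genericPoint (specOver (YRing c₀)).left)) (yChart_pr₂ c₀)).symm⟩
  · exact (mem_range_chartMap F₃ (wt_castSucc 4 0) _).mp ⟨_, (congrArg
      (fun f ↦ f.left (genericPoint (specOver (YRing c₀)).left)) (yChart_pr₃ c₀)).symm⟩

lemma funMap_g₁ (i : Fin 3) :
    funMap g.hom (chartFun yChart₀ (chartCoord F₂ (wt_castSucc 3 0) i ⊗ₜ 1)) =
      (![1, ω ^ 2, ω] i : ℂ) • chartFun yChart₀ (chartCoord F₂ (wt_castSucc 3 0) i ⊗ₜ 1) := by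
  refine Eq.trans ?_ ((pullFun_pr₁ ((![1, ω ^ 2, ω] i : ℂ) • chartCoord F₂ (wt_castSucc 3 0) i)).trans
    (map_smul ((chartFun yChart₀).comp Algebra.TensorProduct.includeLeft) _ _))
  refine (congrArg (funMap g.hom) (pullFun_pr₁ _).symm).trans ?_
  refine (funMap_pullFun g.hom pr₁ (C := weightedCurve 3 F₂) _).trans ?_
  refine (congrArg (fun f ↦ pullFun f (C := weightedCurve 3 F₂) (chartSection
    (chartCoord F₂ (wt_castSucc 3 0) i))) g_hom_pr₁).trans ?_
  exact pullFun_scaleAut (k := 3) (F := F₂) pr₁ _ _ _ (wt_castSucc 3 0) rfl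
    genericPoint_mem_chartOpen.1 i

lemma funMap_g₂ (i : Fin 3) :
    funMap g.hom (chartFun yChart₀ (1 ⊗ₜ (chartCoord F₂ (wt_castSucc 3 0) i ⊗ₜ 1))) =
      (![1, ω ^ 2, ω] i : ℂ) •
        chartFun yChart₀ (1 ⊗ₜ (chartCoord F₂ (wt_castSucc 3 0) i ⊗ₜ 1)) := by
  refine Eq.trans ?_ ((pullFun_pr₂ ((![1, ω ^ 2, ω] i : ℂ) • chartCoord F₂ (wt_castSucc 3 0) i)).trans
    (map_smul ((chartFun yChart₀).comp (Algebra.TensorProduct.includeRight.comp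
      Algebra.TensorProduct.includeLeft)) _ _))
  refine (congrArg (funMap g.hom) (pullFun_pr₂ _).symm).trans ?_
  refine (funMap_pullFun g.hom pr₂ (C := weightedCurve 3 F₂) _).trans ?_
  refine (congrArg (fun f ↦ pullFun f (C := weightedCurve 3 F₂) (chartSection
    (chartCoord F₂ (wt_castSucc 3 0) i))) g_hom_pr₂).trans ?_
  exact pullFun_scaleAut (k := 3) (F := F₂) pr₂ _ _ _ (wt_castSucc 3 0) rfl
    genericPoint_mem_chartOpen.2.1 i

lemma funMap_g₃ (i : Fin 3) :
    funMap g.hom (chartFun yChart₀ (1 ⊗ₜ (1 ⊗ₜ chartCoord F₃ (wt_castSucc 4 0) i))) =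
      (![1, ω, 1] i : ℂ) •
        chartFun yChart₀ (1 ⊗ₜ (1 ⊗ₜ chartCoord F₃ (wt_castSucc 4 0) i)) := by
  refine Eq.trans ?_ ((pullFun_pr₃ ((![1, ω, 1] i : ℂ) • chartCoord F₃ (wt_castSucc 4 0) i)).trans
    (map_smul ((chartFun yChart₀).comp (Algebra.TensorProduct.includeRight.comp
      Algebra.TensorProduct.includeRight)) _ _))
  refine (congrArg (funMap g.hom) (pullFun_pr₃ _).symm).trans ?_
  refine (funMap_pullFun g.hom pr₃ (C := weightedCurve 4 F₃) _).trans ?_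
  refine (congrArg (fun f ↦ pullFun f (C := weightedCurve 4 F₃) (chartSection
    (chartCoord F₃ (wt_castSucc 4 0) i))) g_hom_pr₃).trans ?_
  exact pullFun_scaleAut (k := 4) (F := F₃) pr₃ _ _ _ (wt_castSucc 4 0) rfl
    genericPoint_mem_chartOpen.2.2 i

/-- `σ` scales the coordinates by the weights of the action of `G`. -/
structure IsScaling (σ : Y.left.functionField →ₐ[ℂ] Y.left.functionField) (ζ : ℂ) : Prop where
  pow_eq : ζ ^ 8 = 1
  u₀ : σ (u 0) = ζ ^ 2 • u 0
  u₁ : σ (u 1) = ζ ^ 2 • u 1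
  u₂ : σ (u 2) = ζ • u 2
  v₀ : σ (v 0) = ζ • v 0
  v₁ : σ (v 1) = ζ • v 1
  v₂ : σ (v 2) = v 2

lemma isScaling_g : IsScaling (funMap g.hom) ω where
  pow_eq := ω_pow_eight
  u₀ := by rw [u_eq]; exact funMap_g₁ 1
  u₁ := by rw [u_eq]; exact funMap_g₂ 1
  u₂ := by rw [u_eq]; exact funMap_g₃ 1
  v₀ := by rw [v_eq]; exact funMap_g₁ 2
  v₁ := by rw [v_eq]; exact funMap_g₂ 2
  v₂ := by rw [v_eq]; exact (funMap_g₃ 2).trans (one_smul ℂ _)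

lemma IsScaling.comp {σ τ : Y.left.functionField →ₐ[ℂ] Y.left.functionField} {ζ ξ : ℂ}
    (hσ : IsScaling σ ζ) (hτ : IsScaling τ ξ) : IsScaling (σ.comp τ) (ζ * ξ) where
  pow_eq := by rw [mul_pow, hσ.pow_eq, hτ.pow_eq, one_mul]
  u₀ := by rw [AlgHom.comp_apply, hτ.u₀, map_smul, hσ.u₀, smul_smul]; ring_nf
  u₁ := by rw [AlgHom.comp_apply, hτ.u₁, map_smul, hσ.u₁, smul_smul]; ring_nf
  u₂ := by rw [AlgHom.comp_apply, hτ.u₂, map_smul, hσ.u₂, smul_smul]; ring_nf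
  v₀ := by rw [AlgHom.comp_apply, hτ.v₀, map_smul, hσ.v₀, smul_smul]; ring_nf
  v₁ := by rw [AlgHom.comp_apply, hτ.v₁, map_smul, hσ.v₁, smul_smul]; ring_nf
  v₂ := by rw [AlgHom.comp_apply, hτ.v₂, hσ.v₂]

lemma IsScaling.inv {σ τ : Y.left.functionField →ₐ[ℂ] Y.left.functionField} {ζ : ℂ}
    (hσ : IsScaling σ ζ) (h : τ.comp σ = AlgHom.id ℂ _) : IsScaling τ ζ⁻¹ := by
  have hζ : ζ ≠ 0 := fun h0 ↦ by simpa [h0] using hσ.pow_eq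
  have key : ∀ {x : Y.left.functionField} {z : ℂ}, z ≠ 0 → σ x = z • x → τ x = z⁻¹ • x := by
    intro x z hz hx
    have h1 : τ (σ x) = x := DFunLike.congr_fun h x
    rw [hx, map_smul] at h1
    rw [← h1, smul_smul, inv_mul_cancel₀ hz, one_smul, h1]
  have key2 : ∀ {x : Y.left.functionField}, σ x = x → τ x = x := fun {x} hx ↦ by
    have h1 : τ (σ x) = x := DFunLike.congr_fun h x
    rwa [hx] at h1
  exact
    { pow_eq := by rw [inv_pow, hσ.pow_eq, inv_one]
      u₀ := by rw [inv_pow]; exact key (pow_ne_zero _ hζ) hσ.u₀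
      u₁ := by rw [inv_pow]; exact key (pow_ne_zero _ hζ) hσ.u₁
      u₂ := key hζ hσ.u₂
      v₀ := key hζ hσ.v₀
      v₁ := key hζ hσ.v₁
      v₂ := key2 hσ.v₂ }

lemma funMap_mul (γ δ : Aut Y) : funMap (γ * δ).hom = (funMap δ.hom).comp (funMap γ.hom) := by
  have : IsDominant (δ.hom ≫ γ.hom).left := isDominant_aut (γ * δ)
  exact funMap_comp δ.hom γ.hom

lemma funMap_one : funMap (1 : Aut Y).hom = AlgHom.id ℂ Y.left.functionField := by
  have : IsDominant (𝟙 Y : Y ⟶ Y).left := isDominant_aut (1 : Aut Y)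
  exact funMap_id

/-- `G` acts on the coordinates by scaling. -/
lemma exists_isScaling {γ : Aut Y} (hγ : γ ∈ G) : ∃ ζ, IsScaling (funMap γ.hom) ζ := by
  let H : Subgroup (Aut Y) :=
    { carrier := {γ | ∃ ζ, IsScaling (funMap γ.hom) ζ}
      mul_mem' := by
        rintro γ δ ⟨ζ, h⟩ ⟨ξ, h'⟩
        exact ⟨ξ * ζ, by rw [funMap_mul]; exact h'.comp h⟩
      one_mem' := ⟨1, by rw [funMap_one]; exact ⟨by simp, by simp, by simp, by simp, by simp,
        by simp, by simp⟩⟩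
      inv_mem' := by
        rintro γ ⟨ζ, h⟩
        refine ⟨ζ⁻¹, h.inv ?_⟩
        rw [← funMap_mul, mul_inv_cancel, funMap_one] }
  have hG : G ≤ H := (Subgroup.zpowers_le).mpr ⟨ω, isScaling_g⟩
  exact hG hγ

/-- The invariant coordinates on `Y`. -/
@[simps]
def quotCoordsY : QuotCoords Y.left.functionField where
  r₁ := u 0 / u 2 ^ 2
  r₂ := u 1 / u 2 ^ 2
  P := u 2 ^ 8
  A := v 0 / u 2
  B := v 1 / u 2
  c := v 2
  P_ne := pow_ne_zero _ (u_ne_zero 2)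
  A_ne := div_ne_zero (v_ne_zero 0) (u_ne_zero 2)
  B_ne := div_ne_zero (v_ne_zero 1) (u_ne_zero 2)
  c_ne := v_ne_zero 2
  rel₁ := by
    have := u_ne_zero 2
    rw [div_pow, v_sq'.1]
    field_simp
  rel₂ := by
    have := u_ne_zero 2
    rw [div_pow, v_sq'.2.1]
    field_simp
  rel₃ := v_sq'.2.2

omit [IsIntegral Y.left] in
lemma QuotCoords.ext' {L : Type} [Field L] {q q' : QuotCoords L} (h₁ : q.r₁ = q'.r₁)
    (h₂ : q.r₂ = q'.r₂) (h₃ : q.P = q'.P) (h₄ : q.A = q'.A) (h₅ : q.B = q'.B) (h₆ : q.c = q'.c) :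
    q = q' := by
  cases q; cases q'; congr

/-- The weights cancel: 2 − 2 for r₁ and r₂, 8 for P, 1 − 1 for A and B, 0 for c. -/
lemma IsScaling.map_quotCoordsY {σ : Y.left.functionField →ₐ[ℂ] Y.left.functionField} {ζ : ℂ}
    (hσ : IsScaling σ ζ) : quotCoordsY.map σ.toRingHom = quotCoordsY := by
  have h2 := u_ne_zero 2
  have hζ : ζ ≠ 0 := fun h0 ↦ by simpa [h0] using hσ.pow_eq
  have hz : algebraMap ℂ Y.left.functionField ζ ≠ 0 := (map_ne_zero _).mpr hζ
  have hp : algebraMap ℂ Y.left.functionField ζ ^ 8 = 1 := by rw [← map_pow, hσ.pow_eq, map_one]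
  apply QuotCoords.ext'
  · change σ (u 0 / u 2 ^ 2) = u 0 / u 2 ^ 2
    rw [map_div₀, map_pow, hσ.u₀, hσ.u₂, Algebra.smul_def, Algebra.smul_def, map_pow]
    field_simp
  · change σ (u 1 / u 2 ^ 2) = u 1 / u 2 ^ 2
    rw [map_div₀, map_pow, hσ.u₁, hσ.u₂, Algebra.smul_def, Algebra.smul_def, map_pow]
    field_simp
  · change σ (u 2 ^ 8) = u 2 ^ 8
    rw [map_pow, hσ.u₂, Algebra.smul_def, mul_pow, hp, one_mul]
  · change σ (v 0 / u 2) = v 0 / u 2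
    rw [map_div₀, hσ.v₀, hσ.u₂, Algebra.smul_def, Algebra.smul_def]
    field_simp
  · change σ (v 1 / u 2) = v 1 / u 2
    rw [map_div₀, hσ.v₁, hσ.u₂, Algebra.smul_def, Algebra.smul_def]
    field_simp
  · exact hσ.v₂

end Action

/-! ### The invariant bicanonical forms -/

namespace QuotCoords

variable {K L : Type} [Field K] [Algebra ℂ K] [Field L] [Algebra ℂ L] (q : QuotCoords K)

lemma diffMap_dlog (f : K →ₐ[ℂ] L) (x : K) : diffMap f (dlog x) = dlog (f x) := by
  rw [dlog, diffMap_smul, diffMap_D, map_inv₀, dlog]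

lemma diffMap_diff (f : K →ₐ[ℂ] L) (i : Fin 3) :
    diffMap f (q.diff i) = (q.map f.toRingHom).diff i := by
  fin_cases i
  · simp [diff, diffMap_smul, diffMap_dlog, map_ofNat]
  · simp [diff, diffMap_smul, diffMap_dlog, map_ofNat]
  · simp [diff, diffMap_smul, diffMap_dlog, map_ofNat]

lemma map_coeff (f : K →ₐ[ℂ] L) (i j : ℕ) : f (q.coeff i j) = (q.map f.toRingHom).coeff i j := by
  simp [coeff, map_ofNat]

lemma formMap_form (f : K →ₐ[ℂ] L) (i j : ℕ) :
    formMap 3 2 f (q.form i j) = (q.map f.toRingHom).form i j := by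
  rw [form, formMap_smul, formMap_tprod, map_coeff, form]
  simp only [diffMap_diff]

/-- The three invariant functions `r₁, r₂, P`. -/
abbrev params : Fin 3 → K := ![q.r₁, q.r₂, q.P]

lemma params_map (f : K →ₐ[ℂ] L) : (q.map f.toRingHom).params = f ∘ q.params := by
  ext i
  fin_cases i <;> rfl

lemma coeff_ne_zero (i j : ℕ) : q.coeff i j ≠ 0 := by
  have := charZero_of_injective_algebraMap (algebraMap ℂ K).injective
  simp [coeff, q.r₁_ne, q.r₂_ne, q.P_ne, q.A_ne, q.B_ne, q.c_ne]

omit [Algebra ℂ K] in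
lemma coeff_succ_left (i j : ℕ) : q.coeff (i + 1) j = q.r₁ * q.coeff i j := by
  unfold coeff; ring

omit [Algebra ℂ K] in
lemma coeff_succ_right (i j : ℕ) : q.coeff i (j + 1) = q.r₂ * q.coeff i j := by
  unfold coeff; ring

lemma form_succ_left (i j : ℕ) : q.form (i + 1) j = q.r₁ • q.form i j := by
  rw [form, coeff_succ_left, form, smul_smul]

lemma form_succ_right (i j : ℕ) : q.form i (j + 1) = q.r₂ • q.form i j := by
  rw [form, coeff_succ_right, form, smul_smul]

variable {q}

/-- In the basis dr₁, dr₂, dP the three logarithmic differentials have determinant 1/(8r₁r₂P). -/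
lemma form_ne_zero (hq : IsTranscendenceBasis ℂ q.params) (i j : ℕ) : q.form i j ≠ 0 := by
  have := charZero_of_injective_algebraMap (algebraMap ℂ K).injective
  obtain ⟨e, he⟩ := exists_basis_D hq
  have h0 : dlog q.r₁ = q.r₁⁻¹ • e 0 := by rw [he]; rfl
  have h1 : dlog q.r₂ = q.r₂⁻¹ • e 1 := by rw [he]; rfl
  have h2 : dlog q.P = q.P⁻¹ • e 2 := by rw [he]; rfl
  have hdet : e.det q.diff = q.r₁⁻¹ * q.r₂⁻¹ * (8⁻¹ * q.P⁻¹) := by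
    rw [Module.Basis.det_apply, Matrix.det_fin_three]
    simp [Module.Basis.toMatrix_apply, diff, h0, h1, h2]
  intro h
  have h' := congrArg (basisForm e 2) h
  rw [form, map_smul, basisForm_tprod, map_zero, smul_eq_mul, Fin.prod_univ_two, hdet] at h'
  simp [q.coeff_ne_zero, q.r₁_ne, q.r₂_ne, q.P_ne] at h'

variable (q) in
/-- The three invariant bicanonical forms. -/
def forms : Fin 3 → RatForm K 3 2 := ![q.form 2 2, q.form 1 2, q.form 2 1]

variable (q) in
lemma formMap_forms (f : K →ₐ[ℂ] L) (i : Fin 3) :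
    formMap 3 2 f (q.forms i) = (q.map f.toRingHom).forms i := by
  fin_cases i <;> exact q.formMap_form f _ _

lemma forms_mem {R : Subring K} {ord : K → ℤ} (h : IsDiscrete R ord) (i : Fin 3) :
    q.forms i ∈ formsOver 3 2 R R := by
  fin_cases i
  · exact q.form_mem h (.inl ⟨rfl, rfl⟩)
  · exact q.form_mem h (.inr (.inl ⟨rfl, rfl⟩))
  · exact q.form_mem h (.inr (.inr ⟨rfl, rfl⟩))

/-- Relative to `form 1 1` the forms are r₁r₂, r₂ and r₁, distinct monomials in algebraically
independent elements. -/
lemma linearIndependent_forms (hq : IsTranscendenceBasis ℂ q.params) :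
    LinearIndependent ℂ q.forms := by
  obtain ⟨e, -⟩ := exists_basis_D hq
  refine LinearIndependent.of_comp ((basisForm e 2).restrictScalars ℂ) ?_
  refine Fintype.linearIndependent_iff.mpr fun a ha ↦ ?_
  have h0 : q.forms 0 = (q.r₁ * q.r₂) • q.form 1 1 := by
    rw [mul_smul, ← form_succ_right, ← form_succ_left]; rfl
  have h1 : q.forms 1 = q.r₂ • q.form 1 1 := by rw [← form_succ_right]; rfl
  have h2 : q.forms 2 = q.r₁ • q.form 1 1 := by rw [← form_succ_left]; rfl
  have hne : basisForm e 2 (q.form 1 1) ≠ 0 := fun h ↦ form_ne_zero hq 1 1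
    (basisForm_injective e (h.trans (map_zero _).symm))
  simp only [Fin.sum_univ_three, Function.comp_apply, LinearMap.coe_restrictScalars, h0, h1, h2,
    map_smul, smul_eq_mul, ← smul_mul_assoc, ← add_mul, mul_eq_zero, hne, or_false] at ha
  let p : MvPolynomial (Fin 3) ℂ := a 0 • (.X 0 * .X 1) + a 1 • .X 1 + a 2 • .X 0
  have hp : p = 0 := by
    refine algebraicIndependent_iff.mp hq.1 p ?_
    simp only [p, map_add, map_smul, map_mul, MvPolynomial.aeval_X]
    rw [smul_mul_assoc] at ha
    exact ha
  -- Evaluating the polynomial a₀X₀X₁ + a₁X₁ + a₂X₀ at three points isolates its coefficients.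
  have e := fun x ↦ congrArg (MvPolynomial.eval x) hp
  have e1 := e ![0, 1, 0]
  have e2 := e ![1, 0, 0]
  have e3 := e ![1, 1, 0]
  simp [p, MvPolynomial.smul_eval] at e1 e2 e3
  rw [e1, e2] at e3
  intro i
  fin_cases i
  · simpa using e3
  · exact e1
  · exact e2

/-- Independence descends along f, and an independent family of size at least the transcendence
degree is a basis; the degree of K is at most that of L, which is 3. -/
lemma isTranscendenceBasis_params_of_map (f : K →ₐ[ℂ] L)
    (h : IsTranscendenceBasis ℂ (q.map f.toRingHom).params) : IsTranscendenceBasis ℂ q.params := by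
  rw [params_map] at h
  have h1 : AlgebraicIndependent ℂ q.params :=
    (f.algebraicIndependent_iff f.toRingHom.injective).mp h.1
  refine h1.isTranscendenceBasis_of_trdeg_le_of_finite ?_
  rw [h.cardinalMk_eq_trdeg]
  exact trdeg_le_of_injective f f.toRingHom.injective

end QuotCoords

/-! ### The three forms on Y in invariant coordinates -/

section FormsY

variable [IsIntegral Y.left]

/-- The function u₃ is algebraic over P = u₃⁸, and u₁ = r₁u₃², u₂ = r₂u₃², so the field is algebraic
over the three invariants. -/
lemma isTranscendenceBasis_quotCoordsY : IsTranscendenceBasis ℂ quotCoordsY.params := by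
  let S := Algebra.adjoin ℂ (Set.range quotCoordsY.params)
  have hS : ∀ i, IsAlgebraic S (quotCoordsY.params i) := fun i ↦
    isAlgebraic_algebraMap (⟨_, Algebra.subset_adjoin ⟨i, rfl⟩⟩ : S)
  have h2 : IsAlgebraic S (u 2) := IsAlgebraic.of_pow (n := 8) (by norm_num) (hS 2)
  have hne := u_ne_zero 2
  have h0 : IsAlgebraic S (u 0) := by
    have h := (hS 0).mul (h2.pow 2)
    have e : quotCoordsY.params 0 * u 2 ^ 2 = u 0 := div_mul_cancel₀ _ (pow_ne_zero _ hne)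
    rwa [e] at h
  have h1 : IsAlgebraic S (u 1) := by
    have h := (hS 1).mul (h2.pow 2)
    have e : quotCoordsY.params 1 * u 2 ^ 2 = u 1 := div_mul_cancel₀ _ (pow_ne_zero _ hne)
    rwa [e] at h
  have : Algebra.IsAlgebraic (Algebra.adjoin ℂ (Set.range quotCoordsY.params))
      Y.left.functionField := isAlgebraic_of_isAlgebraic_u fun i ↦ by
    fin_cases i
    exacts [h0, h1, h2]
  refine Algebra.IsAlgebraic.isTranscendenceBasis_of_le_trdeg_of_finite ℂ _ ?_
  rw [← isTranscendenceBasis_u.cardinalMk_eq_trdeg]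

lemma diff_quotCoordsY (i : Fin 3) : quotCoordsY.diff i = dlog (u i) := by
  have := charZero_of_injective_algebraMap (algebraMap ℂ Y.left.functionField).injective
  have h2 := u_ne_zero 2
  have h8 : dlog (u 2 ^ 8) = (8 : Y.left.functionField) • dlog (u 2) := by
    simpa using dlog_pow h2 8
  have hr : ∀ x : Y.left.functionField, x ≠ 0 →
      dlog (x / u 2 ^ 2) + (1 / 4 : Y.left.functionField) • dlog (u 2 ^ 8) = dlog x := by
    intro x hx
    rw [div_eq_mul_inv, dlog_mul hx (inv_ne_zero (pow_ne_zero _ h2)),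
      dlog_inv (pow_ne_zero _ h2), dlog_pow h2, h8, smul_smul]
    push_cast
    rw [show (1 / 4 * 8 : Y.left.functionField) = 2 by norm_num]
    abel
  fin_cases i
  · exact hr _ (u_ne_zero 0)
  · exact hr _ (u_ne_zero 1)
  · change (1 / 8 : Y.left.functionField) • dlog (u 2 ^ 8) = dlog (u 2)
    rw [h8, smul_smul, show (1 / 8 * 8 : Y.left.functionField) = 1 by norm_num, one_smul]

/-- Writing duᵢ = uᵢ dlog uᵢ gives the coefficient ∏ uᵢ²/(2vᵢ)², whence the factor 1/64. After
substituting u₁ = r₁u₃² and u₂ = r₂u₃², the total power of u₃ is 2i + 2j + k + 10 = 20, the one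
contained in P²/(A²B²). -/
lemma bicanonicalForm_eq {i j k : ℕ} (h : 2 * i + 2 * j + k = 10) :
    bicanonicalForm ![i, j, k] = quotCoordsY.form i j := by
  have := charZero_of_injective_algebraMap (algebraMap ℂ Y.left.functionField).injective
  have hu := u_ne_zero
  have hv := v_ne_zero
  have hθ : θ = (∏ i, (u i / (2 * v i))) •
      exteriorPower.ιMulti Y.left.functionField 3 quotCoordsY.diff := by
    rw [θ, ← AlternatingMap.map_smul_univ]
    congr 1
    ext i : 1
    rw [diff_quotCoordsY, D_eq_smul_dlog (hu i), smul_smul]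
    congr 1
    field_simp
  rw [bicanonicalForm, hθ, MultilinearMap.map_smul_univ, smul_smul, QuotCoords.form]
  congr 1
  rw [Fin.prod_univ_three, Fin.prod_univ_two, Fin.prod_univ_three]
  simp only [QuotCoords.coeff, quotCoordsY_r₁, quotCoordsY_r₂, quotCoordsY_P, quotCoordsY_A,
    quotCoordsY_B, quotCoordsY_c]
  have h2 := hu 2
  have h3 := hv 0
  have h4 := hv 1
  have h5 := hv 2
  set w := u 2
  obtain ⟨r, hr⟩ : ∃ r, u 0 = r * w ^ 2 := ⟨u 0 / w ^ 2, by field_simp⟩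
  obtain ⟨s, hs⟩ : ∃ s, u 1 = s * w ^ 2 := ⟨u 1 / w ^ 2, by field_simp⟩
  have hw : w ^ (2 * i + 2 * j + k) = w ^ 10 := by rw [h]
  simp only [Matrix.cons_val, hr, hs]
  rw [mul_div_cancel_right₀ _ (pow_ne_zero 2 h2), mul_div_cancel_right₀ _ (pow_ne_zero 2 h2)]
  calc _ = w ^ (2 * i + 2 * j + k) * (r ^ (i + 2) * s ^ (j + 2) * w ^ 10 /
      (64 * v 0 ^ 2 * v 1 ^ 2 * v 2 ^ 2)) := by field_simp; ring
    _ = _ := by rw [hw]; field_simp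

lemma threeForms_eq : threeForms = quotCoordsY.forms := by
  ext i : 1
  fin_cases i <;> exact bicanonicalForm_eq (by norm_num)

lemma formMap_threeForms {γ : Aut Y} (hγ : γ ∈ G) (i : Fin 3) :
    formMap 3 2 (funMap γ.hom) (threeForms i) = threeForms i := by
  obtain ⟨ζ, hζ⟩ := exists_isScaling hγ
  rw [threeForms_eq, QuotCoords.formMap_forms, hζ.map_quotCoordsY]

end FormsY

/-! ### The function field of a quotient -/

section Quotient

variable {Y X : Over SpecC} [IsIntegral Y.left] {G : Subgroup (Aut Y)} {π : Y ⟶ X}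

/-- Functions on X inject into functions on Y, and surjectivity of π makes the preimage of a
nonempty open set nonempty. -/
lemma IsQuotientBy.isIntegral (hπ : IsQuotientBy G π) : IsIntegral X.left where
  nonempty := ⟨π.left (genericPoint Y.left)⟩
  component_integral U hU := by
    obtain ⟨x, hx⟩ := hU
    have := hπ.surjective
    obtain ⟨y, rfl⟩ := π.left.surjective x
    have : Nonempty (π.left ⁻¹ᵁ U) := ⟨⟨y, hx⟩⟩
    exact (hπ.injective U).isDomain (π.left.app U).hom

omit [IsIntegral Y.left] in
lemma IsQuotientBy.isDominant (hπ : IsQuotientBy G π) : IsDominant π.left := by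
  have := hπ.surjective
  infer_instance

/-- Invariant rational functions descend to the quotient. -/
lemma IsQuotientBy.exists_funMap_eq (hπ : IsQuotientBy G π) [IsIntegral X.left]
    [IsDominant π.left] {f : Y.left.functionField} (hf : ∀ γ ∈ G, funMap γ.hom f = f) :
    ∃ h, funMap π h = f := by
  have := hπ.finite
  obtain ⟨V, hV, s, rfl⟩ := Y.left.presheaf.exists_germ_eq f
  -- The largest open set whose preimage lies in V; it is open because π is finite, hence closed.
  let U : X.left.Opens := ⟨(π.left '' (V : Set Y.left)ᶜ)ᶜ,
    (π.left.isClosedMap _ V.isOpen.isClosed_compl).isOpen_compl⟩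
  have hUV : π.left ⁻¹ᵁ U ≤ V := fun y hy ↦ by
    by_contra h
    exact hy ⟨y, h, rfl⟩
  -- The fibre over the generic point is the G-orbit of the generic point of Y, which automorphisms
  -- fix, so it lies in V.
  have hU : genericPoint X.left ∈ U := by
    rintro ⟨y, hy, hyx⟩
    rw [← map_genericPoint π] at hyx
    obtain ⟨γ, -, h⟩ := hπ.orbit _ _ hyx.symm
    rw [map_genericPoint γ.hom] at h
    exact hy (h ▸ hV)
  have hU' := genericPoint_mem_preimage π hU
  let s' : Γ(Y.left, π.left ⁻¹ᵁ U) := Y.left.presheaf.map (homOfLE hUV).op s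
  have hs' : Y.left.presheaf.germ (π.left ⁻¹ᵁ U) _ hU' s' = Y.left.presheaf.germ V _ hV s :=
    TopCat.Presheaf.germ_res_apply _ (homOfLE hUV) _ hU' _
  obtain ⟨h, hh⟩ := hπ.invariants U s' fun γ hγ e ↦ by
    apply germ_injective_of_isIntegral Y.left (genericPoint Y.left) hU'
    rw [← funMap_germ_appLE γ.hom hU' hU' e, hs']
    exact hf γ hγ
  exact ⟨X.left.presheaf.germ U _ hU h, by rw [funMap_germ, hh]; exact hs'⟩

end Quotient

/-- Invariant coordinates descend along a homomorphism of fields. -/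
lemma QuotCoords.exists_map_eq {K L : Type} [Field K] [Field L] (f : L →+* K) (q : QuotCoords K)
    (h : ∀ x ∈ ({q.r₁, q.r₂, q.P, q.A, q.B, q.c} : Set K), x ∈ f.range) :
    ∃ q' : QuotCoords L, q'.map f = q := by
  obtain ⟨r₁, h₁⟩ := h q.r₁ (by simp)
  obtain ⟨r₂, h₂⟩ := h q.r₂ (by simp)
  obtain ⟨P, h₃⟩ := h q.P (by simp)
  obtain ⟨A, h₄⟩ := h q.A (by simp)
  obtain ⟨B, h₅⟩ := h q.B (by simp)
  obtain ⟨c, h₆⟩ := h q.c (by simp)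
  refine ⟨{ r₁ := r₁, r₂ := r₂, P := P, A := A, B := B, c := c,
            P_ne := fun e ↦ q.P_ne (by rw [← h₃, e, map_zero])
            A_ne := fun e ↦ q.A_ne (by rw [← h₄, e, map_zero])
            B_ne := fun e ↦ q.B_ne (by rw [← h₅, e, map_zero])
            c_ne := fun e ↦ q.c_ne (by rw [← h₆, e, map_zero])
            rel₁ := f.injective (by simpa [h₁, h₃, h₄] using q.rel₁)
            rel₂ := f.injective (by simpa [h₂, h₃, h₅] using q.rel₂)
            rel₃ := f.injective (by simpa [h₃, h₆] using q.rel₃) }, ?_⟩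
  exact QuotCoords.ext' h₁ h₂ h₃ h₄ h₅ h₆

lemma mem_localRing_genericPoint {X : Over SpecC} [IrreducibleSpace X.left]
    (f : X.left.functionField) : f ∈ localRing X (genericPoint X.left) := by
  refine ⟨f, ?_⟩
  change X.left.presheaf.stalkSpecializes _ f = f
  simp

/-! ### Descent of the forms to X' and the twisted bicanonical sheaf -/

section Descent

variable [IsIntegral Y.left]

/-- At the generic point every function is regular. This allows division of the forms by a local
generator. -/
lemma threeForms_mem_formsOver (i : Fin 3) : threeForms i ∈
    formsOver 3 2 (localRing Y (genericPoint Y.left)) (localRing Y (genericPoint Y.left)) := by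
  set O := localRing Y (genericPoint Y.left)
  have hO : ∀ f, f ∈ O := mem_localRing_genericPoint
  have hθ : θ ∈ regForms 3 O O := by
    rw [θ]
    refine ιMulti_mem_regForms (fun _ ↦ hO _) fun i ↦ ?_
    exact smul_mem_latt (hO _) (D_mem_regDiff (hO _))
  have h : ∀ b, bicanonicalForm b ∈ formsOver 3 2 O O := fun b ↦ by
    rw [bicanonicalForm]
    refine smul_mem_formsOver (hO _) ?_
    exact tprod_mem_formsOver (ξ := fun _ ↦ θ) (fun _ ↦ hO _) fun _ ↦ hθ
  fin_cases i
  exacts [h _, h _, h _]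

variable {X X' : Over SpecC} {π : Y ⟶ X} {ρ : X' ⟶ X} [IsIntegral X'.left]

/-- The invariant coordinates descend to the resolution of the quotient. -/
lemma exists_quotCoords (hπ : IsQuotientBy G π) [IsIntegral X.left] [IsDominant π.left]
    [IsDominant ρ.left] (hρ : IsBirationalMor ρ) :
    ∃ (ι : X'.left.functionField →ₐ[ℂ] Y.left.functionField)
      (q : QuotCoords X'.left.functionField), ι.comp (funMap ρ) = funMap π ∧
        q.map ι.toRingHom = quotCoordsY := by
  let eρ := AlgEquiv.ofBijective (funMap ρ) hρ.funMap_bijective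
  -- Since ρ is birational, the function field of X' is that of X and embeds into that of Y.
  let ι := (funMap π).comp eρ.symm.toAlgHom
  have hι : ι.comp (funMap ρ) = funMap π := by
    ext x
    exact congrArg (funMap π) (eρ.symm_apply_apply x)
  have hinv : ∀ x, (∀ γ ∈ G, funMap γ.hom x = x) → x ∈ ι.toRingHom.range := fun x hx ↦ by
    obtain ⟨h, rfl⟩ := hπ.exists_funMap_eq hx
    exact ⟨funMap ρ h, DFunLike.congr_fun hι h⟩
  have hγ : ∀ γ ∈ G, quotCoordsY.map (funMap γ.hom).toRingHom = quotCoordsY := fun γ hγ ↦ by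
    obtain ⟨ζ, hζ⟩ := exists_isScaling hγ
    exact hζ.map_quotCoordsY
  obtain ⟨q, hq⟩ := QuotCoords.exists_map_eq ι.toRingHom quotCoordsY (by
    rintro x (rfl | rfl | rfl | rfl | rfl | rfl)
    · exact hinv _ fun γ h ↦ congrArg QuotCoords.r₁ (hγ γ h)
    · exact hinv _ fun γ h ↦ congrArg QuotCoords.r₂ (hγ γ h)
    · exact hinv _ fun γ h ↦ congrArg QuotCoords.P (hγ γ h)
    · exact hinv _ fun γ h ↦ congrArg QuotCoords.A (hγ γ h)
    · exact hinv _ fun γ h ↦ congrArg QuotCoords.B (hγ γ h)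
    · exact hinv _ fun γ h ↦ congrArg QuotCoords.c (hγ γ h))
  exact ⟨ι, q, hι, hq⟩

lemma isTranscendenceBasis_params {ι : X'.left.functionField →ₐ[ℂ] Y.left.functionField}
    {q : QuotCoords X'.left.functionField} (hq : q.map ι.toRingHom = quotCoordsY) :
    IsTranscendenceBasis ℂ q.params :=
  QuotCoords.isTranscendenceBasis_params_of_map ι (by rw [hq]; exact isTranscendenceBasis_quotCoordsY)

/-- The three bicanonical forms are sections of the twisted bicanonical sheaf. -/
lemma threeForms_mem_twistedSections [IsIntegral X.left] [IsDominant π.left] [IsDominant ρ.left]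
    [IsLocallyNoetherian X'.left]
    (hX' : IsNormalScheme X'.left) {ι : X'.left.functionField →ₐ[ℂ] Y.left.functionField}
    {q : QuotCoords X'.left.functionField} (hρ : IsBirationalMor ρ)
    (hι : ι.comp (funMap ρ) = funMap π)
    (hq : q.map ι.toRingHom = quotCoordsY) {Yt : Over SpecC} [IsIntegral Yt.left] (φ : Yt ⟶ Y)
    [IsDominant φ.left] (ε : Yt ⟶ X') (h : IsNormalizedBaseChange π ρ φ ε) (i : Fin 3) :
    threeForms i ∈ twistedSections φ ε 3 2 := by
  intro y
  have := h.finite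
  have := h.surjective
  -- It suffices to check this on the image of the function field of X, where it is the
  -- commutativity of the base change square.
  have hε : (funMap φ).comp ι = funMap ε := by
    have hd : IsDominant (ε ≫ ρ).left := by rw [Over.comp_left]; infer_instance
    have hd' : IsDominant (φ ≫ π).left := by rw [Over.comp_left]; infer_instance
    ext x
    obtain ⟨x, rfl⟩ := hρ.funMap_bijective.2 x
    have h1 := funMap_comp ε ρ
    have h2 := funMap_comp φ π
    have h3 : funMap (ε ≫ ρ) = funMap (φ ≫ π) := by
      congr 1
      exact h.comm
    calc (funMap φ) (ι (funMap ρ x)) = funMap φ (funMap π x) :=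
          congrArg _ (DFunLike.congr_fun hι x)
      _ = funMap (φ ≫ π) x := (DFunLike.congr_fun h2 x).symm
      _ = funMap (ε ≫ ρ) x := by rw [h3]
      _ = funMap ε (funMap ρ x) := DFunLike.congr_fun h1 x
  -- On Yt the pull-back of the form from Y is the pull-back of its descent from X'.
  have hs : formMap 3 2 (funMap φ) (threeForms i) = formMap 3 2 (funMap ε) (q.forms i) := by
    rw [threeForms_eq, QuotCoords.formMap_forms, QuotCoords.formMap_forms, ← hq, ← hε]
    rfl
  obtain ⟨U, a, hy, hU⟩ := exists_generator_Y y 2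
  have hτ := (hU y hy).1
  let τ₀ : RatForm Y.left.functionField 3 2 := elemForm fun _ ↦ a
  have hτ₀ : τ₀ ∈ formsOver 3 2 (localRing Y y) (localRing Y y) :=
    Submodule.subset_span ⟨1, Subring.one_mem _, _, fun _ ↦ hτ, (one_smul _ _).symm⟩
  -- The form is f times the local generator τ₀ of the bicanonical sheaf of Y; f is the candidate
  -- section of the ideal sheaf.
  obtain ⟨f, hf⟩ : ∃ f : Y.left.functionField, threeForms i = f • τ₀ := by
    obtain ⟨b, -, hb⟩ := (hU _ (genericPoint_mem hy)).2 _ (threeForms_mem_formsOver i)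
    exact ⟨b, hb⟩
  refine ⟨U, hy, Submodule.subset_span ⟨f, ?_, τ₀, hτ₀, hf⟩⟩
  intro w hw hwU τ hτ
  rw [pulledRing_eq_map] at hτ
  have hle := pulledRing_le φ w
  rw [pulledRing_eq_map] at hle
  obtain ⟨b, hb, rfl⟩ := exists_eq_smul_formMap (funMap φ) (algebraMap_mem_localRing w) hle
    (hU (φ.left w) hwU).2 hτ
  -- With τ = b φ^*τ₀, the product fτ becomes b times the pull-back under ε of the descended form.
  rw [smul_comm, ← formMap_smul, ← hf, hs]
  refine smul_mem_formsOver hb ?_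
  -- The image of w in X' has codimension one, so the descended form is regular there.
  obtain ⟨ord, hord⟩ := exists_isDiscrete_localRing hX' (coheight_map_eq_one hX' ε.left hw)
  refine formMap_mem_formsOver (funMap ε) (fun a ha ↦ ?_) (fun a ha ↦ ?_) (q.forms_mem hord i)
  · rw [pulledRing_eq_map]
    exact ⟨a, ha, rfl⟩
  · refine pulledRing_le ε w ?_
    rw [pulledRing_eq_map]
    exact ⟨a, ha, rfl⟩

end Descent

/-! ### Plurigenera, Kodaira dimension and Calabi-Yau varieties -/

section Bicanonical

variable {X : Over SpecC} [IsIntegral X.left] {q : QuotCoords X.left.functionField}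

lemma dim_eq_three (hq : IsTranscendenceBasis ℂ q.params) : dim X = 3 := by
  rw [dim, ← hq.cardinalMk_eq_trdeg]
  simp

variable (X) in
/-- The rational `d`-canonical forms of degree `n` that are regular in codimension one. -/
def regularForms (n d : ℕ) : Submodule ℂ (RatForm X.left.functionField n d) :=
  ⨅ (x : X.left) (_ : Order.coheight x = 1), formsOver n d (localRing X x) (localRing X x)

lemma forms_mem_regularForms [IsLocallyNoetherian X.left] (hX : IsNormalScheme X.left)
    (i : Fin 3) : q.forms i ∈ regularForms X 3 2 := by
  simp only [regularForms, Submodule.mem_iInf]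
  intro x hx
  obtain ⟨ord, h⟩ := exists_isDiscrete_localRing hX hx
  exact q.forms_mem h i

lemma three_le_plurigenus [IsLocallyNoetherian X.left] (hX : IsNormalScheme X.left)
    (hq : IsTranscendenceBasis ℂ q.params) : 3 ≤ plurigenus X 2 := by
  -- The dimension occurs in the type of forms; with the degree as a free argument it can be
  -- rewritten to 3.
  change 3 ≤ Module.rank ℂ (regularForms X (dim X) 2)
  rw [dim_eq_three hq]
  have h : LinearIndependent ℂ fun i ↦
      (⟨q.forms i, forms_mem_regularForms hX i⟩ : regularForms X 3 2) :=
    LinearIndependent.of_comp (Submodule.subtype _) (QuotCoords.linearIndependent_forms hq)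
  have := h.cardinal_le_rank
  simpa using this

lemma exists_mem_sectionRatios [IsLocallyNoetherian X.left] (hX : IsNormalScheme X.left)
    (hq : IsTranscendenceBasis ℂ q.params) : pluriSections X 2 ≠ ⊥ ∧
      q.r₁ ∈ sectionRatios X 2 ∧ q.r₂ ∈ sectionRatios X 2 := by
  have key : ∀ i, q.forms i ∈ regularForms X 3 2 := forms_mem_regularForms hX
  have h1 : q.forms 0 = q.r₁ • q.forms 1 := q.form_succ_left 1 2
  have h2 : q.forms 0 = q.r₂ • q.forms 2 := q.form_succ_right 2 1
  have h3 : q.forms 1 ≠ 0 := QuotCoords.form_ne_zero hq 1 2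
  have h4 : q.forms 2 ≠ 0 := QuotCoords.form_ne_zero hq 2 1
  -- Generalizing the degree again avoids rewriting `dim X` inside dependent types.
  suffices h : ∀ n, n = 3 → regularForms X n 2 ≠ ⊥ ∧
      (∃ s ∈ regularForms X n 2, ∃ t ∈ regularForms X n 2, t ≠ 0 ∧ s = q.r₁ • t) ∧
      ∃ s ∈ regularForms X n 2, ∃ t ∈ regularForms X n 2, t ≠ 0 ∧ s = q.r₂ • t from
    h (dim X) (dim_eq_three hq)
  rintro _ rfl
  exact ⟨fun h ↦ h3 ((Submodule.eq_bot_iff _).mp h _ (key 1)),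
    ⟨_, key 0, _, key 1, h3, h1⟩, ⟨_, key 0, _, key 2, h4, h2⟩⟩

/-- Already the bicanonical map has image of dimension at least 2: the ratios r₁ and r₂ of sections
are algebraically independent. -/
lemma two_le_kodairaDim [IsLocallyNoetherian X.left] (hX : IsNormalScheme X.left)
    (hq : IsTranscendenceBasis ℂ q.params) : 2 ≤ kodairaDim X := by
  obtain ⟨hne, h1, h2⟩ := exists_mem_sectionRatios hX hq
  refine le_trans ?_ (le_iSup₂ (f := fun (d : ℕ) (_ : 0 < d ∧ pluriSections X d ≠ ⊥) ↦
    ((Cardinal.toENat (Algebra.trdeg ℂ (Algebra.adjoin ℂ (sectionRatios X d))) : ℕ∞) :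
      WithBot ℕ∞)) 2 ⟨two_pos, hne⟩)
  let A := Algebra.adjoin ℂ (sectionRatios X 2)
  let x : Fin 2 → A := ![⟨q.r₁, Algebra.subset_adjoin h1⟩, ⟨q.r₂, Algebra.subset_adjoin h2⟩]
  have hx : AlgebraicIndependent ℂ x := by
    rw [← AlgHom.algebraicIndependent_iff A.val Subtype.val_injective]
    have h := hq.1.comp (Fin.castSucc : Fin 2 → Fin 3) (Fin.castSucc_injective 2)
    convert h using 1
    ext i
    fin_cases i <;> rfl
  have h := hx.cardinalMk_le_trdeg
  have h' := OrderHomClass.mono Cardinal.toENat h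
  have e : Cardinal.toENat (Cardinal.mk (Fin 2)) = 2 := by simp
  rw [e] at h'
  exact WithBot.coe_le_coe.mpr h'

end Bicanonical

/-! ### No birational model is Calabi-Yau -/

section CalabiYau

/-- If σ generates the canonical forms, σ ⊗ σ generates the bicanonical ones. The coordinate
`basisForm` expresses this inside K, where the two tensor powers can be compared. -/
lemma exists_basisForm_two_eq {K : Type} [Field K] [Algebra ℂ K] {n : ℕ} {O : Subring K}
    (hc : ∀ c : ℂ, algebraMap ℂ K c ∈ O) (e : Module.Basis (Fin n) K Ω[K⁄ℂ])
    {σ : RatForm K n 1} (hσ : ∀ τ ∈ formsOver n 1 O O, ∃ b ∈ O, τ = b • σ) {x : RatForm K n 2}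
    (hx : x ∈ formsOver n 2 O O) : ∃ b ∈ O, basisForm e 2 x = b * basisForm e 1 σ ^ 2 := by
  rw [formsOver_eq_latt] at hx
  let Q : AddSubmonoid (RatForm K n 2) :=
    { carrier := {x | ∃ b ∈ O, basisForm e 2 x = b * basisForm e 1 σ ^ 2}
      zero_mem' := ⟨0, O.zero_mem, by simp⟩
      add_mem' := by
        rintro x y ⟨b, hb, h⟩ ⟨b', hb', h'⟩
        exact ⟨b + b', O.add_mem hb hb', by rw [map_add, h, h', add_mul]⟩ }
  refine latt_induction (Q := Q) ?_ hc ?_ hx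
  · rintro _ ⟨a, ha, rfl⟩
    have key : ∀ j, ∃ b ∈ O, e.det (fun i ↦ KaehlerDifferential.D ℂ K (a j i)) =
        b * basisForm e 1 σ := fun j ↦ by
      obtain ⟨b, hb, h⟩ := hσ (elemForm fun _ ↦ a j) (Submodule.subset_span
        ⟨1, O.one_mem, _, fun _ ↦ ha j, (one_smul _ _).symm⟩)
      refine ⟨b, hb, ?_⟩
      have h' := congrArg (basisForm e 1) h
      rw [elemForm, basisForm_tprod, map_smul, Fin.prod_univ_one] at h'
      exact h'
    obtain ⟨b, hb, h⟩ := key 0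
    obtain ⟨b', hb', h'⟩ := key 1
    refine ⟨b * b', O.mul_mem hb hb', ?_⟩
    rw [elemForm, basisForm_tprod, Fin.prod_univ_two, h, h']
    ring
  · rintro b hb x ⟨b', hb', h⟩
    exact ⟨b * b', O.mul_mem hb hb', by rw [map_smul, h, smul_eq_mul, mul_assoc]⟩

variable {Z : Over SpecC} [IsIntegral Z.left] {q : QuotCoords Z.left.functionField}

/-- A normal projective variety with trivial canonical divisor has no two independent
bicanonical sections. -/
lemma not_isCalabiYau (hq : IsTranscendenceBasis ℂ q.params) : ¬ IsCalabiYau Z := by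
  intro h
  have hZ := h.terminal.normal
  obtain ⟨hcl, hft⟩ := h.projective.universallyClosed
  have := isLocallyNoetherian_of_locallyOfFiniteType Z.hom
  have hσ : ∃ σ : RatForm Z.left.functionField (dim Z) 1, σ ≠ 0 ∧ ∀ x : Z.left,
      Order.coheight x = 1 → ∀ τ ∈ formsOver (dim Z) 1 (localRing Z x) (localRing Z x),
        ∃ b ∈ localRing Z x, τ = b • σ := by
    obtain ⟨σ, hσ⟩ := h.canonical_trivial
    exact ⟨σ, (hσ (genericPoint Z.left)).1, fun x hx τ hτ ↦
      ((hσ x).2 x specializes_rfl hx τ).mp hτ⟩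
  rw [dim_eq_three hq] at hσ
  obtain ⟨σ, hσ0, hσ⟩ := hσ
  obtain ⟨e, -⟩ := exists_basis_D hq
  set s := basisForm e 1 σ
  have hs : s ≠ 0 := fun h0 ↦ hσ0 (basisForm_injective e (h0.trans (map_zero _).symm))
  have key : ∀ i, ∃ c : ℂ, basisForm e 2 (q.forms i) = algebraMap ℂ _ c * s ^ 2 := by
    intro i
    -- The quotient of a bicanonical form by σ² is regular in codimension one, hence regular
    -- everywhere, hence constant on the projective variety Z.
    have hloc : ∀ x, basisForm e 2 (q.forms i) / s ^ 2 ∈ localRing Z x := by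
      refine mem_localRing_of_codim_one hZ fun x' hx' ↦ ?_
      obtain ⟨ord, hord⟩ := exists_isDiscrete_localRing hZ hx'
      obtain ⟨b, hb, hb'⟩ := exists_basisForm_two_eq (algebraMap_mem_localRing x') e (hσ x' hx')
        (q.forms_mem hord i)
      rw [hb', mul_div_cancel_right₀ _ (pow_ne_zero 2 hs)]
      exact hb
    obtain ⟨t, ht⟩ := exists_section_eq hloc
    obtain ⟨c, hc⟩ := exists_algebraMap_eq_of_universallyClosed t
    refine ⟨c, ?_⟩
    rw [hc, ht, div_mul_cancel₀ _ (pow_ne_zero 2 hs)]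
  obtain ⟨c, hc⟩ := key 0
  obtain ⟨c', hc'⟩ := key 1
  have h1 : q.forms 0 = q.r₁ • q.forms 1 := q.form_succ_left 1 2
  rw [h1, map_smul, hc', smul_eq_mul, ← mul_assoc] at hc
  have hc0 : c' ≠ 0 := by
    rintro rfl
    rw [map_zero, zero_mul] at hc'
    exact QuotCoords.form_ne_zero hq 1 2 (basisForm_injective e (hc'.trans (map_zero _).symm))
  -- Two of the forms differ by the factor r₁, which would be a ratio of constants although it is
  -- transcendental.
  have hr : q.r₁ = algebraMap ℂ _ (c / c') := by
    rw [map_div₀, eq_div_iff ((map_ne_zero _).mpr hc0)]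
    exact mul_right_cancel₀ (pow_ne_zero 2 hs) hc
  have ht : Transcendental ℂ q.r₁ := hq.1.transcendental 0
  exact ht (hr ▸ isAlgebraic_algebraMap _)

/-- The coordinates and their transcendence are transported along the isomorphism of function
fields. -/
lemma not_isCalabiYau_of_birationalOver {X : Over SpecC} [IsIntegral X.left]
    {q : QuotCoords X.left.functionField} (hq : IsTranscendenceBasis ℂ q.params)
    (h : Scheme.BirationalOver Z.hom X.hom) : ¬ IsCalabiYau Z := by
  obtain ⟨e⟩ := exists_algEquiv_of_birationalOver h
  refine not_isCalabiYau (q := q.map e.toAlgHom.toRingHom) ?_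
  refine QuotCoords.isTranscendenceBasis_params_of_map e.symm.toAlgHom ?_
  have h' : (q.map e.toAlgHom.toRingHom).map e.symm.toAlgHom.toRingHom = q := by
    apply QuotCoords.ext' <;> exact e.symm_apply_apply _
  rw [h']
  exact hq

end CalabiYau

end FakeCY

end

open FakeCY in
theorem proposition7p2 (X : Over SpecC) (π : Y ⟶ X) (hπ : IsQuotientBy G π)
    (X' : Over SpecC) [IsIntegral X'.left] (ρ : X' ⟶ X) (hρ : IsResolution ρ) :
    (∃ _ : IsIntegral Y.left,
      LinearIndependent ℂ threeForms ∧
      (∀ i, ∀ γ ∈ G, formMap 3 2 (funMap γ.hom) (threeForms i) = threeForms i) ∧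
      ∀ (Yt : Over SpecC) [IsIntegral Yt.left] (φ : Yt ⟶ Y) [IsDominant φ.left] (ε : Yt ⟶ X'),
        IsNormalizedBaseChange π ρ φ ε → ∀ i, threeForms i ∈ twistedSections φ ε 3 2) ∧
    3 ≤ plurigenus X' 2 ∧
    (∀ (Z : Over SpecC) [IsIntegral Z.left], IsMinimalModel Z X' → ¬ IsCalabiYau Z) ∧
    (∀ (Z : Over SpecC) [IsIntegral Z.left],
      Scheme.BirationalOver Z.hom X'.hom → ¬ IsCalabiYau Z) ∧
    2 ≤ kodairaDim X' := by
  have hY := isIntegral_Y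
  have hX := hπ.isIntegral
  have hdπ := hπ.isDominant
  have hdρ := hρ.birational.isDominant
  have hsm := hρ.smooth
  have hN := isLocallyNoetherian_of_locallyOfFiniteType X'.hom
  have hX' := isNormalScheme_of_smooth X'.hom
  obtain ⟨ι, q, hι, hq⟩ := exists_quotCoords hπ hρ.birational
  have ht := isTranscendenceBasis_params hq
  refine ⟨⟨hY, ?_, fun i γ hγ ↦ formMap_threeForms hγ i, fun Yt _ φ _ ε h i ↦
    threeForms_mem_twistedSections hX' hρ.birational hι hq φ ε h i⟩, three_le_plurigenus hX' ht,
    fun Z _ h ↦ not_isCalabiYau_of_birationalOver ht h.birational,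
    fun Z _ h ↦ not_isCalabiYau_of_birationalOver ht h, two_le_kodairaDim hX' ht⟩
  rw [threeForms_eq]
  exact QuotCoords.linearIndependent_forms isTranscendenceBasis_quotCoordsY
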